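/- Let $\mathbb S^1=\mathbb R/\mathbb Z$ and let $f:\mathbb S^1\times\mathbb R\to\mathbb R$ be smooth and proper. Let $(B^1,B^0)$ be either $(C^1(\mathbb S^1),C^0(\mathbb S^1))$ or $(H^1(\mathbb S^1),L^2(\mathbb S^1))$ (real-valued functions), let $F:B^1\to B^0$ be $F(u)(t)=u'(t)+f(t,u(t))$, and let $\Sigma_1:B^1\to\mathbb R$ be $\Sigma_1(u)=\int_{\mathbb S^1}\frac{\partial f}{\partial x}(t,u(t))\,dt$, where $\frac{\partial f}{\partial x}$ is the derivative of $f$ in its second variable. A critical point (singularity) of $F$ is a $u\in B^1$ at which $DF(u)$ is not surjective. It is a fold if there are a Banach space $X$ and smooth local coordinates near $u$ and near $F(u)$, with values in $X\times\mathbb R$, in which $F$ takes the form $(x,y)\mapsto(x,\mu(x,y))$ with $\mu$ smooth and, at the point corresponding to $u$, $\partial_y\mu=0$ and $\partial_y^2\mu\neq0$. Suppose that $0$ is a regular value of $\Sigma_1$, that $F$ has at least one critical point, and that every critical point of $F$ is a fold. Then $F$ is a (smooth) global fold: with $\tilde B^0=\{v\in B^0:\int_{\mathbb S^1} v=0\}$,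 there are $C^\infty$ diffeomorphisms $\Xi_1:B^1\to\mathbb R\times\tilde B^0$ and $\Xi_0:B^0\to\mathbb R\times\tilde B^0$ such that $$(\Xi_0\circ F\circ\Xi_1^{-1})(x,\tilde v)=(x^2,\tilde v)\qquad\text{for all }(x,\tilde v)\in\mathbb R\times\tilde B^0.$$ -/

import Mathlib

open MeasureTheory Set
open scoped ContDiff

namespace PeriodicFirstOrder

noncomputable section

/-! ### Regular values, critical points, folds and global folds of maps of normed spaces -/

section General

variable {E F : Type} [NormedAddCommGroup E] [NormedSpace ℝ E]
  [NormedAddCommGroup F] [NormedSpace ℝ F]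

/-- `c` is a regular value of `G`: the derivative of `G` is onto at every point of the level `c`. -/
def IsRegularValue (G : E → F) (c : F) : Prop :=
  ∀ u, G u = c → Function.Surjective (fderiv ℝ G u)

/-- `u` is a critical point (a singularity) of `G`: the derivative of `G` at `u` is not onto. -/
def IsCriticalPoint (G : E → F) (u : E) : Prop :=
  ¬ Function.Surjective (fderiv ℝ G u)

/-- `u₀` is a fold of `G` (a Morin singularity of order one): in suitable smooth local coordinates
`α` around `u₀` and `β` around `G u₀`, with values in `X × ℝ` for a Banach space `X`, the map has
the adapted form `(x, y) ↦ (x, μ (x, y))` with `μ` smooth, and, at the point that corresponds to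
`u₀`, the first derivative of `μ` in `y` vanishes and the second one does not. -/
def IsFold (G : E → F) (u₀ : E) : Prop :=
  ∃ (X : Type) (_ : NormedAddCommGroup X) (_ : NormedSpace ℝ X) (_ : CompleteSpace X)
    (α : OpenPartialHomeomorph E (X × ℝ)) (β : OpenPartialHomeomorph F (X × ℝ)) (μ : X × ℝ → ℝ),
    u₀ ∈ α.source ∧ MapsTo G α.source β.source ∧
    ContDiffOn ℝ ∞ α α.source ∧ ContDiffOn ℝ ∞ α.symm α.target ∧
    ContDiffOn ℝ ∞ β β.source ∧ ContDiffOn ℝ ∞ β.symm β.target ∧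
    ContDiffOn ℝ ∞ μ α.target ∧
    (∀ p ∈ α.target, β (G (α.symm p)) = (p.1, μ p)) ∧
    deriv (fun y => μ ((α u₀).1, y)) (α u₀).2 = 0 ∧
    iteratedDeriv 2 (fun y => μ ((α u₀).1, y)) (α u₀).2 ≠ 0

/-- `G : E → F` is a (smooth) global fold with parameter space `X`: smooth global diffeomorphisms
`Ξ₁ : E → ℝ × X` and `Ξ₀ : F → ℝ × X` conjugate it to `(x, v) ↦ (x ^ 2, v)`. -/
def IsGlobalFold (X : Type) [NormedAddCommGroup X] [NormedSpace ℝ X] (G : E → F) : Prop :=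
  ∃ (Ξ₁ : E ≃ ℝ × X) (Ξ₀ : F ≃ ℝ × X),
    ContDiff ℝ ∞ Ξ₁ ∧ ContDiff ℝ ∞ Ξ₁.symm ∧ ContDiff ℝ ∞ Ξ₀ ∧ ContDiff ℝ ∞ Ξ₀.symm ∧
    ∀ (x : ℝ) (v : X), Ξ₀ (G (Ξ₁.symm (x, v))) = (x ^ 2, v)

end General

/-! ### Function spaces on the circle `ℝ / ℤ` -/

/-- `C⁰(S¹)`, with the supremum norm. -/
abbrev C0 : Type := C(UnitAddCircle, ℝ)

/-- `H⁰(S¹) = L²(S¹)`. -/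
abbrev H0 : Type := Lp ℝ 2 (volume : Measure UnitAddCircle)

lemma integrable_C0 (u : C0) : Integrable (fun t => u t) (volume : Measure UnitAddCircle) :=
  u.continuous.integrable_of_hasCompactSupport (HasCompactSupport.of_compactSpace _)

lemma integrable_H0 (v : H0) : Integrable (fun t => v t) (volume : Measure UnitAddCircle) :=
  (Lp.memLp v).integrable (by norm_num)

lemma ae_Ioc {P : UnitAddCircle → Prop} (h : ∀ᵐ t ∂(volume : Measure UnitAddCircle), P t) :
    ∀ᵐ s : ℝ ∂(volume.restrict (Ioc (0 : ℝ) 1)), P (s : UnitAddCircle) := by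
  have := (UnitAddCircle.measurePreserving_mk 0).quasiMeasurePreserving.ae h
  simpa using this

lemma intervalIntegrable_H0 (v : H0) {t : ℝ} (ht : t ∈ Icc (0 : ℝ) 1) :
    IntervalIntegrable (fun s : ℝ => v (s : UnitAddCircle)) volume 0 t := by
  rw [intervalIntegrable_iff_integrableOn_Ioc_of_le ht.1]
  have h := (UnitAddCircle.measurePreserving_mk 0).integrable_comp_of_integrable (integrable_H0 v)
  rw [zero_add] at h
  exact IntegrableOn.mono_set h (Ioc_subset_Ioc_right ht.2)

lemma ae_interval {P : UnitAddCircle → Prop}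
    (h : ∀ᵐ t ∂(volume : Measure UnitAddCircle), P t) {t : ℝ} (ht : t ∈ Icc (0 : ℝ) 1) :
    ∀ᵐ s : ℝ, s ∈ uIoc 0 t → P (s : UnitAddCircle) := by
  rw [uIoc_of_le ht.1]
  filter_upwards [(ae_restrict_iff' measurableSet_Ioc).1 (ae_Ioc h)] with s hs hst
  exact hs (Ioc_subset_Ioc_right ht.2 hst)

/-- `C¹(S¹)`: the pairs `(u, u')` of continuous periodic functions, the second of which is the
derivative of the first. The norm is `max (sup |u|) (sup |u'|)`. -/
def C1 : Submodule ℝ (C0 × C0) where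
  carrier := {p | ∀ s : ℝ, HasDerivAt (fun r : ℝ => p.1 (r : UnitAddCircle)) (p.2 s) s}
  zero_mem' := fun s => hasDerivAt_const s (0 : ℝ)
  add_mem' := fun hp hq s => (hp s).add (hq s)
  smul_mem' := fun c _ hp s => (hp s).const_mul c

/-- `H¹(S¹)`: the pairs `(u, u')` with `u` continuous and periodic and `u'` in `L²(S¹)`, such that
`u` is an indefinite integral of `u'`, i.e. `u` is absolutely continuous with derivative `u'` almost
everywhere. The norm is `max (sup |u|) ‖u'‖_{L²}`; by `H1.norm_le` and `H1.le_norm` it is equivalent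
to the Hilbert norm `(‖u‖_{L²} ^ 2 + ‖u'‖_{L²} ^ 2) ^ (1 / 2)`. -/
def H1 : Submodule ℝ (C0 × H0) where
  carrier := {p | ∀ t ∈ Icc (0 : ℝ) 1,
    p.1 (t : UnitAddCircle) = p.1 0 + ∫ s in (0 : ℝ)..t, p.2 (s : UnitAddCircle)}
  zero_mem' := fun t ht => by
    change (0 : ℝ) = 0 + ∫ s in (0 : ℝ)..t, (0 : H0) (s : UnitAddCircle)
    rw [intervalIntegral.integral_congr_ae (ae_interval (Lp.coeFn_zero ℝ 2 volume) ht)]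
    simp
  add_mem' := fun {p q} hp hq t ht => by
    have h := intervalIntegral.integral_congr_ae (ae_interval (Lp.coeFn_add p.2 q.2) ht)
    simp only [Pi.add_apply] at h
    rw [intervalIntegral.integral_add (intervalIntegrable_H0 p.2 ht)
      (intervalIntegrable_H0 q.2 ht)] at h
    change p.1 t + q.1 t = (p.1 0 + q.1 0) + ∫ s in (0 : ℝ)..t, (p.2 + q.2) (s : UnitAddCircle)
    rw [h, hp t ht, hq t ht]
    ring
  smul_mem' := fun c p hp t ht => by
    have h := intervalIntegral.integral_congr_ae (ae_interval (Lp.coeFn_smul c p.2) ht)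
    simp only [Pi.smul_apply, smul_eq_mul, intervalIntegral.integral_const_mul] at h
    change c * p.1 t = c * p.1 0 + ∫ s in (0 : ℝ)..t, (c • p.2) (s : UnitAddCircle)
    rw [h, hp t ht]
    ring

/-- The inclusion of `C⁰(S¹)` in `L²(S¹)`. -/
def toH0 (u : C0) : H0 := ContinuousMap.toLp 2 volume ℝ u

lemma norm_toH0_le (u : C0) : ‖toH0 u‖ ≤ ‖u‖ := by
  have h1 : ‖(ContinuousMap.toLp 2 volume ℝ : C0 →L[ℝ] H0)‖ ≤ 1 := by
    refine (ContinuousMap.toLp_norm_le (p := 2) (𝕜 := ℝ) (μ := volume)).trans ?_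
    simp [measureUnivNNReal]
  exact (ContinuousLinearMap.le_of_opNorm_le _ h1 u).trans_eq (one_mul _)

lemma isProbabilityMeasure_circle : IsProbabilityMeasure (volume : Measure UnitAddCircle) :=
  ⟨by simp⟩

lemma integral_abs_le (v : H0) : ∫ t, |v t| ≤ ‖v‖ := by
  have := isProbabilityMeasure_circle
  have h1 := eLpNorm_le_eLpNorm_of_exponent_le (p := 1) (q := 2) (by norm_num)
    (Lp.aestronglyMeasurable v)
  have h2 := ENNReal.toReal_mono (Lp.eLpNorm_ne_top v) h1
  rw [← Lp.norm_def] at h2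
  refine le_trans (le_of_eq ?_) h2
  rw [eLpNorm_one_eq_lintegral_enorm, ← integral_norm_eq_lintegral_enorm
    (Lp.aestronglyMeasurable v)]
  rfl

lemma H1.le_norm (u : H1) : √(‖toH0 u.1.1‖ ^ 2 + ‖u.1.2‖ ^ 2) ≤ 2 * ‖u‖ := by
  have h1 : ‖toH0 u.1.1‖ ≤ ‖u‖ := (norm_toH0_le _).trans (norm_fst_le u.1)
  have h2 : ‖u.1.2‖ ≤ ‖u‖ := norm_snd_le u.1
  refine Real.sqrt_le_iff.2 ⟨by positivity, ?_⟩
  nlinarith [norm_nonneg (toH0 u.1.1), norm_nonneg u.1.2, norm_nonneg u]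

lemma H1.norm_le (u : H1) : ‖u‖ ≤ 3 * √(‖toH0 u.1.1‖ ^ 2 + ‖u.1.2‖ ^ 2) := by
  have key : ∀ a b : ℝ, a ∈ Icc (0 : ℝ) 1 → b ∈ Icc (0 : ℝ) 1 →
      |u.1.1 (a : UnitAddCircle)| ≤ |u.1.1 (b : UnitAddCircle)| + 2 * ‖u.1.2‖ := by
    have hint : ∀ t ∈ Icc (0 : ℝ) 1, |∫ s in (0 : ℝ)..t, u.1.2 (s : UnitAddCircle)| ≤ ‖u.1.2‖ := by
      intro t ht
      have e1 : ∫ s in (0 : ℝ)..1, |u.1.2 (s : UnitAddCircle)| = ∫ t, |u.1.2 t| := by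
        simpa using UnitAddCircle.intervalIntegral_preimage 0 (fun t => |u.1.2 t|)
      have hI := (intervalIntegrable_H0 u.1.2 (t := 1) (by simp)).abs
      calc |∫ s in (0 : ℝ)..t, u.1.2 (s : UnitAddCircle)|
          ≤ ∫ s in (0 : ℝ)..t, |u.1.2 (s : UnitAddCircle)| :=
            intervalIntegral.abs_integral_le_integral_abs ht.1
        _ ≤ ∫ s in (0 : ℝ)..1, |u.1.2 (s : UnitAddCircle)| :=
            intervalIntegral.integral_mono_interval le_rfl ht.1 ht.2
              (Filter.Eventually.of_forall fun _ => abs_nonneg _) hI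
        _ ≤ ‖u.1.2‖ := e1 ▸ integral_abs_le u.1.2
    intro a b ha hb
    have h1 := u.2 a ha
    have h2 := u.2 b hb
    have h3 := abs_le.1 (hint a ha)
    have h4 := abs_le.1 (hint b hb)
    have h5 := abs_le.1 (le_refl |u.1.1 (b : UnitAddCircle)|)
    rw [abs_le]
    constructor <;> linarith [h3.1, h3.2, h4.1, h4.2, h5.1, h5.2]
  have rep : ∀ t : UnitAddCircle, ∃ a ∈ Icc (0 : ℝ) 1, (a : UnitAddCircle) = t := by
    intro t
    have h := (AddCircle.equivIco 1 0 t).2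
    exact ⟨_, ⟨h.1, by linarith [h.2]⟩, AddCircle.coe_equivIco (a := (0 : ℝ)) (p := 1)⟩
  have hL1 : ∫ t, |u.1.1 t| ≤ ‖toH0 u.1.1‖ := by
    refine le_trans (le_of_eq ?_) (integral_abs_le (toH0 u.1.1))
    refine integral_congr_ae ?_
    filter_upwards [ContinuousMap.coeFn_toLp (p := 2) (𝕜 := ℝ) volume u.1.1] with t ht
    simp only [toH0]
    rw [ht]
  have := isProbabilityMeasure_circle
  have hsup : ‖u.1.1‖ ≤ ‖toH0 u.1.1‖ + 2 * ‖u.1.2‖ := by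
    rw [ContinuousMap.norm_le _ (by positivity)]
    intro t
    have hpt : ∀ r, |u.1.1 t| ≤ |u.1.1 r| + 2 * ‖u.1.2‖ := by
      intro r
      obtain ⟨a, ha, rfl⟩ := rep t
      obtain ⟨b, hb, rfl⟩ := rep r
      exact key a b ha hb
    have h := integral_mono (μ := (volume : Measure UnitAddCircle)) (integrable_const |u.1.1 t|)
      ((integrable_C0 u.1.1).abs.add (integrable_const (2 * ‖u.1.2‖))) hpt
    rw [integral_add' (integrable_C0 u.1.1).abs (integrable_const _)] at h
    simp only [integral_const, probReal_univ, one_smul] at h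
    rw [Real.norm_eq_abs]
    linarith
  have h1 : ‖toH0 u.1.1‖ ≤ √(‖toH0 u.1.1‖ ^ 2 + ‖u.1.2‖ ^ 2) :=
    Real.le_sqrt_of_sq_le (by nlinarith [sq_nonneg ‖u.1.2‖])
  have h2 : ‖u.1.2‖ ≤ √(‖toH0 u.1.1‖ ^ 2 + ‖u.1.2‖ ^ 2) :=
    Real.le_sqrt_of_sq_le (by nlinarith [sq_nonneg ‖toH0 u.1.1‖])
  change max ‖u.1.1‖ ‖u.1.2‖ ≤ _
  refine max_le (by linarith) (by linarith [norm_nonneg u.1.2])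

/-- The continuous functions of average zero. -/
def C0tilde : Submodule ℝ C0 where
  carrier := {v | ∫ t, v t = 0}
  zero_mem' := by simp
  add_mem' := fun {v w} hv hw => by
    change ∫ t, (v t + w t) = 0
    rw [integral_add (integrable_C0 v) (integrable_C0 w), mem_ofPred.1 hv, mem_ofPred.1 hw, add_zero]
  smul_mem' := fun c v hv => by
    change ∫ t, c * v t = 0
    rw [integral_const_mul, mem_ofPred.1 hv, mul_zero]

/-- The square integrable functions of average zero. -/
def H0tilde : Submodule ℝ H0 where
  carrier := {v | ∫ t, v t = 0}
  zero_mem' := by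
    change ∫ t, (0 : H0) t = 0
    rw [integral_congr_ae (Lp.coeFn_zero ℝ 2 volume)]
    simp
  add_mem' := fun {v w} hv hw => by
    change ∫ t, (v + w) t = 0
    rw [integral_congr_ae (Lp.coeFn_add v w),
      integral_add' (integrable_H0 v) (integrable_H0 w), mem_ofPred.1 hv, mem_ofPred.1 hw, add_zero]
  smul_mem' := fun c v hv => by
    change ∫ t, (c • v) t = 0
    rw [integral_congr_ae (Lp.coeFn_smul c v)]
    simp only [Pi.smul_apply, smul_eq_mul]
    rw [integral_const_mul, mem_ofPred.1 hv, mul_zero]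

/-! ### The operator `F (u) = u' + f (t, u)` and the functional `Σ₁` -/

/-- `f : S¹ × ℝ → ℝ` is smooth: its lift to `ℝ × ℝ` (periodic in the first variable) is `C^∞`. -/
def IsSmooth (f : C(UnitAddCircle × ℝ, ℝ)) : Prop :=
  ContDiff ℝ ∞ fun p : ℝ × ℝ => f ((p.1 : UnitAddCircle), p.2)

/-- The function `t ↦ f (t, u (t))`. -/
def nemytskii (f : C(UnitAddCircle × ℝ, ℝ)) (u : C0) : C0 :=
  ⟨fun t => f (t, u t), by fun_prop⟩

/-- `F : C¹(S¹) → C⁰(S¹)`, `F (u) = u' + f (t, u)`. -/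
def operatorC (f : C(UnitAddCircle × ℝ, ℝ)) (u : C1) : C0 :=
  u.1.2 + nemytskii f u.1.1

/-- `F : H¹(S¹) → L²(S¹)`, `F (u) = u' + f (t, u)`. -/
def operatorH (f : C(UnitAddCircle × ℝ, ℝ)) (u : H1) : H0 :=
  u.1.2 + toH0 (nemytskii f u.1.1)

/-- `Σ₁ (u) = ∫ D₂ f (t, u (t)) dt`. -/
def sigma1 (f : C(UnitAddCircle × ℝ, ℝ)) (u : C0) : ℝ :=
  ∫ t : UnitAddCircle, deriv (fun x : ℝ => f (t, x)) (u t)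

end

end PeriodicFirstOrder

open PeriodicFirstOrder

/-!
Write the equation `u' + f (t, u) = v` in integral form. On continuous functions
`u ↦ u + ∫ (f (t, u) - avg)` is a diffeomorphism: its derivatives are compact perturbations of the
identity with trivial kernel, and properness of `f` bounds its preimages of bounded sets. Hence `u`
is determined, smoothly, by its initial value `x` and by the deviation `q` of `v` from its average,
and in these coordinates the operator is `(x, q) ↦ (c (x, q), q)`, where `c` is the average of
`f (t, u)`. The zeros of `∂c/∂x` are the zeros of `Σ₁`; at such a zero `∂²c/∂x²` is a positive
multiple of an explicit functional `Σ₂ (u)`, which is nonzero exactly at the folds.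

All critical points have the same sign of `Σ₂`: two zeros of `Σ₁` with opposite signs could be
joined by a path of zeros of `Σ₁`, obtained by mixing the two functions at high frequency, so that
all averages involved interpolate almost linearly, and `Σ₂` would vanish on this path. Thus, up to
sign, every `c (·, q)` has a unique critical point, a nondegenerate minimum; by properness it tends
to infinity at both ends, and the square root of `c (·, q) - min` is a global coordinate.
-/

namespace PeriodicFirstOrder

noncomputable section

/-! ### Averages and periodic primitives -/

lemma exists_coe_eq (t : UnitAddCircle) : ∃ s ∈ Icc (0 : ℝ) 1, (s : UnitAddCircle) = t := by
  obtain ⟨s, hs, rfl⟩ := AddCircle.eq_coe_Ico t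
  exact ⟨s, ⟨hs.1, hs.2.le⟩, rfl⟩

lemma coe_one_eq_zero : ((1 : ℝ) : UnitAddCircle) = 0 := AddCircle.coe_period 1

lemma coe_zero_eq_zero : ((0 : ℝ) : UnitAddCircle) = 0 := rfl

lemma periodic_comp_coe {α : Type*} (v : UnitAddCircle → α) :
    Function.Periodic (fun s : ℝ => v (s : UnitAddCircle)) 1 := fun s => by
  simp only [AddCircle.coe_add, coe_one_eq_zero, add_zero]

lemma continuous_comp_coe (u : C0) : Continuous (fun s : ℝ => u (s : UnitAddCircle)) :=
  u.continuous.comp (AddCircle.continuous_mk' 1)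

lemma ae_coe {P : UnitAddCircle → Prop} (h : ∀ᵐ t ∂(volume : Measure UnitAddCircle), P t) :
    ∀ᵐ s : ℝ, P (s : UnitAddCircle) := by
  rw [← Measure.restrict_univ (μ := volume), ← iUnion_Ioc_intCast ℝ, ae_restrict_iUnion_iff]
  exact fun n => (UnitAddCircle.measurePreserving_mk n).quasiMeasurePreserving.ae h

lemma intervalIntegral_coe (v : UnitAddCircle → ℝ) :
    ∫ s in (0 : ℝ)..1, v (s : UnitAddCircle) = ∫ t, v t := by
  simpa using UnitAddCircle.intervalIntegral_preimage 0 v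

lemma intervalIntegrable_coe (v : H0) (a b : ℝ) :
    IntervalIntegrable (fun s : ℝ => v (s : UnitAddCircle)) volume a b :=
  (periodic_comp_coe v).intervalIntegrable₀ one_ne_zero (intervalIntegrable_H0 v (by simp)) a b

lemma intervalIntegral_coe_add (v w : H0) (a b : ℝ) :
    ∫ s in a..b, (v + w) (s : UnitAddCircle) =
      (∫ s in a..b, v (s : UnitAddCircle)) + ∫ s in a..b, w (s : UnitAddCircle) := by
  rw [← intervalIntegral.integral_add (intervalIntegrable_coe v a b) (intervalIntegrable_coe w a b)]
  exact intervalIntegral.integral_congr_ae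
    ((ae_coe (Lp.coeFn_add v w)).mono fun s hs _ => hs)

lemma intervalIntegral_coe_smul (c : ℝ) (v : H0) (a b : ℝ) :
    ∫ s in a..b, (c • v) (s : UnitAddCircle) = c * ∫ s in a..b, v (s : UnitAddCircle) := by
  rw [← intervalIntegral.integral_const_mul]
  exact intervalIntegral.integral_congr_ae
    ((ae_coe (Lp.coeFn_smul c v)).mono fun s hs _ => hs)

lemma abs_intervalIntegral_coe_le (v : H0) {r : ℝ} (hr : r ∈ Icc (0 : ℝ) 1) :
    |∫ s in (0 : ℝ)..r, v (s : UnitAddCircle)| ≤ ‖v‖ :=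
  calc |∫ s in (0 : ℝ)..r, v (s : UnitAddCircle)|
    _ ≤ ∫ s in (0 : ℝ)..r, |v (s : UnitAddCircle)| :=
        intervalIntegral.abs_integral_le_integral_abs hr.1
    _ ≤ ∫ s in (0 : ℝ)..1, |v (s : UnitAddCircle)| :=
        intervalIntegral.integral_mono_interval le_rfl hr.1 hr.2
          (Filter.Eventually.of_forall fun _ => abs_nonneg _) (intervalIntegrable_coe v 0 1).abs
    _ = ∫ t, |v t| := intervalIntegral_coe fun t => |v t|
    _ ≤ ‖v‖ := integral_abs_le v

/-- The average of a square integrable function, as a continuous linear functional. -/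
def meanH : H0 →L[ℝ] ℝ :=
  LinearMap.mkContinuous
    { toFun := fun v => ∫ t, v t
      map_add' := fun v w => by simp only [← intervalIntegral_coe, intervalIntegral_coe_add]
      map_smul' := fun c v => by
        simp only [← intervalIntegral_coe, intervalIntegral_coe_smul, RingHom.id_apply,
          smul_eq_mul] }
    1 fun v => by
      rw [one_mul]
      exact (norm_integral_le_integral_norm _).trans (integral_abs_le v)

lemma meanH_eq_intervalIntegral (v : H0) :
    meanH v = ∫ s in (0 : ℝ)..1, v (s : UnitAddCircle) :=
  (intervalIntegral_coe v).symm

lemma abs_meanH_le (v : H0) : |meanH v| ≤ ‖v‖ := by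
  rw [meanH_eq_intervalIntegral]
  exact abs_intervalIntegral_coe_le v (by simp)

/-- The inclusion `toH0` of `C⁰(S¹)` in `L²(S¹)`, as a continuous linear map. -/
def toH0L : C0 →L[ℝ] H0 := ContinuousMap.toLp 2 volume ℝ

lemma toH0L_ae_eq (u : C0) : ∀ᵐ t ∂(volume : Measure UnitAddCircle), toH0L u t = u t :=
  ContinuousMap.coeFn_toLp (p := 2) (𝕜 := ℝ) volume u

/-- The average of a continuous function, as a continuous linear functional. -/
def meanC : C0 →L[ℝ] ℝ := meanH.comp toH0L

lemma meanC_apply (u : C0) : meanC u = ∫ t, u t :=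
  integral_congr_ae (toH0L_ae_eq u)

lemma meanC_one : meanC 1 = 1 := by
  rw [meanC_apply, ← intervalIntegral_coe]
  simp

lemma meanC_mono {u v : C0} (h : ∀ t, u t ≤ v t) : meanC u ≤ meanC v := by
  rw [meanC_apply, meanC_apply]
  exact integral_mono (integrable_C0 u) (integrable_C0 v) h

lemma abs_meanC_le_meanC {u v : C0} (h : ∀ t, |u t| ≤ v t) : |meanC u| ≤ meanC v := by
  have hneg := meanC_mono (u := -v) (v := u) fun t => (abs_le.1 (h t)).1
  rw [map_neg] at hneg
  exact abs_le.2 ⟨hneg, meanC_mono fun t => (abs_le.1 (h t)).2⟩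

lemma abs_meanC_le (u : C0) : |meanC u| ≤ ‖u‖ := by
  have h := abs_meanC_le_meanC (v := ‖u‖ • (1 : C0)) fun t => by
    simpa using u.norm_coe_le_norm t
  simpa [meanC_one] using h

/-- The primitive `∫₀ʳ a` of a periodic function, on the line. -/
def linePrim (a : C0) (r : ℝ) : ℝ := ∫ s in (0 : ℝ)..r, a (s : UnitAddCircle)

lemma linePrim_zero (a : C0) : linePrim a 0 = 0 := intervalIntegral.integral_same

lemma linePrim_one (a : C0) : linePrim a 1 = meanC a := by
  rw [meanC_apply, ← intervalIntegral_coe, linePrim]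

lemma hasDerivAt_linePrim (a : C0) (r : ℝ) : HasDerivAt (linePrim a) (a r) r := by
  have hc := continuous_comp_coe a
  exact intervalIntegral.integral_hasDerivAt_right (hc.intervalIntegrable 0 r)
    (hc.stronglyMeasurableAtFilter _ _) hc.continuousAt

lemma continuous_linePrim (a : C0) : Continuous (linePrim a) :=
  continuous_iff_continuousAt.2 fun r => (hasDerivAt_linePrim a r).continuousAt

lemma periodic_integral_sub_mean (v : H0) :
    Function.Periodic (fun r : ℝ => (∫ s in (0 : ℝ)..r, v (s : UnitAddCircle)) - r * meanH v) 1 :=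
  fun r => by
    have h := (periodic_comp_coe v).intervalIntegral_add_eq_add 0 r (intervalIntegrable_coe v)
    rw [zero_add, ← meanH_eq_intervalIntegral] at h
    simp only [h]
    ring

/-- The periodic primitive `r ↦ ∫₀ʳ (v - meanH v)`, as a continuous linear map `L² → C⁰`. -/
def primH : H0 →L[ℝ] C0 :=
  LinearMap.mkContinuous
    { toFun := fun v => ⟨(periodic_integral_sub_mean v).lift, continuous_coinduced_dom.2
        ((intervalIntegral.continuous_primitive (intervalIntegrable_coe v) 0).sub
          (continuous_id.mul continuous_const))⟩
      map_add' := fun v w => by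
        ext t
        obtain ⟨r, -, rfl⟩ := exists_coe_eq t
        change _ - r * meanH (v + w) = (_ - r * meanH v) + (_ - r * meanH w)
        rw [intervalIntegral_coe_add, map_add]
        ring
      map_smul' := fun c v => by
        ext t
        obtain ⟨r, -, rfl⟩ := exists_coe_eq t
        change _ - r * meanH (c • v) = c * (_ - r * meanH v)
        rw [intervalIntegral_coe_smul, map_smul, smul_eq_mul]
        ring }
    2 fun v => by
      refine (ContinuousMap.norm_le _ (by positivity)).2 fun t => ?_
      obtain ⟨r, hr, rfl⟩ := exists_coe_eq t
      calc |(∫ s in (0 : ℝ)..r, v (s : UnitAddCircle)) - r * meanH v|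
        _ ≤ |∫ s in (0 : ℝ)..r, v (s : UnitAddCircle)| + |r * meanH v| := abs_sub _ _
        _ = |∫ s in (0 : ℝ)..r, v (s : UnitAddCircle)| + r * |meanH v| := by
          rw [abs_mul, abs_of_nonneg hr.1]
        _ ≤ ‖v‖ + 1 * ‖v‖ := by
          gcongr
          exacts [abs_intervalIntegral_coe_le v hr, hr.2, abs_meanH_le v]
        _ = 2 * ‖v‖ := by ring

lemma primH_coe (v : H0) (r : ℝ) :
    primH v (r : UnitAddCircle) = (∫ s in (0 : ℝ)..r, v (s : UnitAddCircle)) - r * meanH v := rfl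

lemma primH_zero (v : H0) : primH v 0 = 0 := by
  simpa using primH_coe v 0

/-- The periodic primitive of a continuous function. -/
def primC : C0 →L[ℝ] C0 := primH.comp toH0L

lemma primC_zero (v : C0) : primC v 0 = 0 := primH_zero _

lemma primC_coe (v : C0) (r : ℝ) :
    primC v (r : UnitAddCircle) = linePrim v r - r * meanC v :=
  congrArg (· - r * meanC v) (intervalIntegral.integral_congr_ae
    ((ae_coe (toH0L_ae_eq v)).mono fun _ hs _ => hs))

lemma primC_one : primC 1 = 0 := by
  ext t
  obtain ⟨r, -, rfl⟩ := exists_coe_eq t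
  rw [primC_coe, meanC_one, linePrim]
  simp

lemma hasDerivAt_primC (v : C0) (r : ℝ) :
    HasDerivAt (fun s : ℝ => primC v (s : UnitAddCircle)) (v r - meanC v) r := by
  simp only [primC_coe]
  exact (hasDerivAt_linePrim v r).sub (hasDerivAt_mul_const (meanC v))

lemma eq_add_primC_of_hasDerivAt {y n : C0} {k : ℝ}
    (h : ∀ r : ℝ, HasDerivAt (fun s : ℝ => y (s : UnitAddCircle)) (n r - k) r) :
    meanC n = k ∧ y = y 0 • 1 + primC n := by
  have hy : ∀ r : ℝ, y r = y 0 + (linePrim n r - r * k) := fun r => by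
    have hc : Continuous fun s : ℝ => n (s : UnitAddCircle) - k :=
      (continuous_comp_coe n).sub continuous_const
    have hFTC := intervalIntegral.integral_eq_sub_of_hasDerivAt (fun s _ => h s)
      (hc.intervalIntegrable 0 r)
    rw [intervalIntegral.integral_sub ((continuous_comp_coe n).intervalIntegrable 0 r)
      intervalIntegrable_const, intervalIntegral.integral_const, sub_zero, smul_eq_mul] at hFTC
    rw [linePrim, hFTC, coe_zero_eq_zero, add_sub_cancel]
  have hk : meanC n = k := by
    have h1 := hy 1
    rw [coe_one_eq_zero, linePrim_one] at h1
    linarith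
  refine ⟨hk, ?_⟩
  ext t
  obtain ⟨r, -, rfl⟩ := exists_coe_eq t
  simp [hy r, primC_coe, hk]

lemma mem_C1_iff (p : C0 × C0) : p ∈ C1 ↔ meanC p.2 = 0 ∧ p.1 = p.1 0 • 1 + primC p.2 := by
  refine ⟨fun hp => eq_add_primC_of_hasDerivAt fun r => by simpa using hp r, ?_⟩
  rintro ⟨h0, h1⟩ s
  rw [h1]
  simpa [h0] using (hasDerivAt_primC p.2 s).const_add (p.1 0)

lemma mem_H1_iff (p : C0 × H0) : p ∈ H1 ↔ meanH p.2 = 0 ∧ p.1 = p.1 0 • 1 + primH p.2 := by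
  constructor
  · intro hp
    have h0 : meanH p.2 = 0 := by
      simpa [coe_one_eq_zero, ← meanH_eq_intervalIntegral] using hp 1 (by simp)
    refine ⟨h0, ?_⟩
    ext t
    obtain ⟨r, hr, rfl⟩ := exists_coe_eq t
    simpa [primH_coe, h0] using hp r hr
  · rintro ⟨h0, h1⟩ r -
    simpa [primH_coe, h0] using congrArg (fun v : C0 => v (r : UnitAddCircle)) h1

/-! ### Compactness of the periodic primitive -/

lemma lipschitzWith_of_comp_coe {α : Type*} [PseudoMetricSpace α] {u : UnitAddCircle → α}
    {K : NNReal} (h : ∀ s t : ℝ, dist (u s) (u t) ≤ K * |s - t|) : LipschitzWith K u := by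
  refine LipschitzWith.of_dist_le_mul fun x y => ?_
  induction x using QuotientAddGroup.induction_on with | _ s
  induction y using QuotientAddGroup.induction_on with | _ t
  have ht : u ((t + round (s - t) : ℝ) : UnitAddCircle) = u t := by
    simp
  calc dist (u s) (u t) ≤ K * |s - (t + round (s - t))| := ht ▸ h s (t + round (s - t))
    _ = K * dist (s : UnitAddCircle) t := by
      rw [dist_eq_norm, ← AddCircle.coe_sub, UnitAddCircle.norm_eq, sub_sub]

lemma isCompact_setOf_lipschitzWith {α β : Type*} [PseudoMetricSpace α] [CompactSpace α]
    [MetricSpace β] {s : Set β} (hs : IsCompact s) (K : NNReal) :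
    IsCompact {u : C(α, β) | (∀ t, u t ∈ s) ∧ LipschitzWith K u} := by
  refine ArzelaAscoli.isCompact_of_equicontinuous _ ?_
    (LipschitzWith.uniformEquicontinuous _ K fun u => u.2.2).equicontinuous
  have himage : ContinuousMap.toFun '' {u : C(α, β) | (∀ t, u t ∈ s) ∧ LipschitzWith K u} =
      (univ.pi fun _ => s) ∩ {u | LipschitzWith K u} := by
    ext u
    constructor
    · rintro ⟨w, hw, rfl⟩
      exact ⟨fun t _ => hw.1 t, hw.2⟩
    · exact fun hu => ⟨⟨u, hu.2.continuous⟩, ⟨fun t => hu.1 t (mem_univ t), hu.2⟩, rfl⟩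
  rw [himage]
  exact (isCompact_univ_pi fun _ => hs).inter_right (isClosed_setOfPred_lipschitzWith K)

lemma lipschitzWith_primC {v : C0} {K : NNReal} (h : ∀ t, |v t - meanC v| ≤ K) :
    LipschitzWith K (primC v) := by
  refine lipschitzWith_of_comp_coe fun s t => ?_
  simpa [Real.dist_eq] using Convex.norm_image_sub_le_of_norm_hasDerivWithin_le (C := K)
    (fun x _ => (hasDerivAt_primC v x).hasDerivWithinAt) (fun x _ => h x) convex_univ
    (mem_univ t) (mem_univ s)

lemma isCompactOperator_primC : IsCompactOperator primC := by
  refine (isCompactOperator_iff_image_closedBall_subset_compact (𝕜₁ := ℝ)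
    (f := (primC : C0 →ₗ[ℝ] C0)) zero_lt_one).2
    ⟨_, isCompact_setOf_lipschitzWith (isCompact_Icc (a := -‖primC‖) (b := ‖primC‖)) 2, ?_⟩
  rintro _ ⟨v, hv, rfl⟩
  have hv : ‖v‖ ≤ 1 := by simpa using hv
  refine ⟨fun t => abs_le.1 ?_, lipschitzWith_primC fun t => ?_⟩
  · exact ((primC v).norm_coe_le_norm t).trans (primC.unit_le_opNorm v hv)
  · calc |v t - meanC v| ≤ |v t| + |meanC v| := abs_sub _ _
      _ ≤ ‖v‖ + ‖v‖ := add_le_add (v.norm_coe_le_norm t) (abs_meanC_le v)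
      _ ≤ 1 + 1 := by gcongr
      _ = _ := by norm_num

/-! ### The Nemytskii operator -/

lemma isOpenQuotientMap_coe_prod :
    IsOpenQuotientMap (fun p : ℝ × ℝ => ((p.1 : UnitAddCircle), p.2)) :=
  IsOpenQuotientMap.prodMap QuotientAddGroup.isOpenQuotientMap_mk IsOpenQuotientMap.id

section Nemytskii

variable {f : C(UnitAddCircle × ℝ, ℝ)}

lemma IsSmooth.hasDerivAt (hf : IsSmooth f) (s x : ℝ) :
    HasDerivAt (fun x : ℝ => f ((s : UnitAddCircle), x))
      (fderiv ℝ (fun p : ℝ × ℝ => f ((p.1 : UnitAddCircle), p.2)) (s, x) (0, 1)) x :=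
  (ContDiff.differentiable hf (by simp)).differentiableAt.hasFDerivAt.comp_hasDerivAt x
    ((hasDerivAt_const x s).prodMk (hasDerivAt_id x))

lemma IsSmooth.deriv_eq_fderiv (hf : IsSmooth f) :
    (fun p : ℝ × ℝ => deriv (fun x : ℝ => f ((p.1 : UnitAddCircle), x)) p.2) =
      fun p => fderiv ℝ (fun p : ℝ × ℝ => f ((p.1 : UnitAddCircle), p.2)) p (0, 1) :=
  funext fun p => (hf.hasDerivAt p.1 p.2).deriv

/-- The derivative of a smooth function on `S¹ × ℝ` in the second variable. -/
def partialX (f : C(UnitAddCircle × ℝ, ℝ)) (hf : IsSmooth f) : C(UnitAddCircle × ℝ, ℝ) where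
  toFun p := deriv (fun x : ℝ => f (p.1, x)) p.2
  continuous_toFun := by
    refine isOpenQuotientMap_coe_prod.isQuotientMap.continuous_iff.2 ?_
    change Continuous fun p : ℝ × ℝ => deriv (fun x : ℝ => f ((p.1 : UnitAddCircle), x)) p.2
    rw [hf.deriv_eq_fderiv]
    exact (ContDiff.continuous_fderiv hf (by simp)).clm_apply continuous_const

lemma hasDerivAt_partialX (hf : IsSmooth f) (t : UnitAddCircle) (x : ℝ) :
    HasDerivAt (fun x : ℝ => f (t, x)) (partialX f hf (t, x)) x := by
  induction t using QuotientAddGroup.induction_on with | _ s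
  exact (hf.hasDerivAt s x).differentiableAt.hasDerivAt

lemma isSmooth_partialX (hf : IsSmooth f) : IsSmooth (partialX f hf) := by
  change ContDiff ℝ ∞ fun p : ℝ × ℝ => deriv (fun x : ℝ => f ((p.1 : UnitAddCircle), x)) p.2
  rw [hf.deriv_eq_fderiv]
  exact (ContDiff.fderiv_right hf (m := ∞) (by simp)).clm_apply contDiff_const

lemma continuous_nemytskii (f : C(UnitAddCircle × ℝ, ℝ)) : Continuous (nemytskii f) := by
  refine ContinuousMap.continuous_of_continuous_uncurry _ ?_
  change Continuous fun p : C0 × UnitAddCircle => f (p.2, p.1 p.2)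
  fun_prop

lemma abs_sub_sub_mul_le {φ φ' : ℝ → ℝ} {a h c ε : ℝ} (hd : ∀ x, HasDerivAt φ (φ' x) x)
    (hφ' : ∀ r ∈ Icc (0 : ℝ) 1, |φ' (a + r * h) - c| ≤ ε) :
    |φ (a + h) - φ a - c * h| ≤ ε * |h| := by
  have hbound : ∀ r ∈ Icc (0 : ℝ) 1, ‖φ' (a + r * h) * h - c * h‖ ≤ ε * |h| := fun r hr => by
    rw [← sub_mul, norm_mul, Real.norm_eq_abs, Real.norm_eq_abs]
    exact mul_le_mul_of_nonneg_right (hφ' r hr) (abs_nonneg h)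
  have hderiv : ∀ r ∈ Icc (0 : ℝ) 1, HasDerivWithinAt (fun r => φ (a + r * h) - c * (r * h))
      (φ' (a + r * h) * h - c * h) (Icc 0 1) r := fun r _ => by
    have hr := hasDerivAt_mul_const (x := r) h
    exact (((hd _).comp r (hr.const_add a)).sub (hr.const_mul c)).hasDerivWithinAt
  have hmean := (convex_Icc (0 : ℝ) 1).norm_image_sub_le_of_norm_hasDerivWithin_le hderiv hbound
    (left_mem_Icc.2 zero_le_one) (right_mem_Icc.2 zero_le_one)
  rw [Real.norm_eq_abs] at hmean
  convert hmean using 1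
  · congr 1
    ring_nf
  · simp

/-- Multiplication of continuous functions, as a continuous bilinear map. -/
def mulL : C0 →L[ℝ] C0 →L[ℝ] C0 := ContinuousLinearMap.mul ℝ C0

lemma hasFDerivAt_nemytskii (hf : IsSmooth f) (u : C0) :
    HasFDerivAt (nemytskii f) (mulL (nemytskii (partialX f hf) u)) u := by
  rw [hasFDerivAt_iff_isLittleO_nhds_zero, Asymptotics.isLittleO_iff]
  intro ε hε
  obtain ⟨δ, hδ, hδu⟩ := Metric.continuousAt_iff.1
    (continuous_nemytskii (partialX f hf)).continuousAt ε hε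
  filter_upwards [Metric.ball_mem_nhds (0 : C0) hδ] with h hh
  have hsegment : ∀ r ∈ Icc (0 : ℝ) 1, dist (u + r • h) u < δ := fun r hr =>
    calc dist (u + r • h) u = r * ‖h‖ := by
          rw [dist_eq_norm, add_sub_cancel_left, norm_smul, Real.norm_of_nonneg hr.1]
      _ ≤ 1 * ‖h‖ := by gcongr; exact hr.2
      _ < δ := by simpa using hh
  refine (ContinuousMap.norm_le _ (by positivity)).2 fun t => ?_
  calc |f (t, u t + h t) - f (t, u t) - partialX f hf (t, u t) * h t|
    _ ≤ ε * |h t| := abs_sub_sub_mul_le (hasDerivAt_partialX hf t) fun r hr =>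
        (ContinuousMap.dist_apply_le_dist t).trans (hδu (hsegment r hr)).le
    _ ≤ ε * ‖h‖ := by gcongr; exact h.norm_coe_le_norm t

lemma contDiff_nemytskii (hf : IsSmooth f) : ContDiff ℝ ∞ (nemytskii f) := by
  refine contDiff_infty.2 fun n => ?_
  induction n generalizing f with
  | zero => exact contDiff_zero.2 (continuous_nemytskii f)
  | succ n ih =>
    refine contDiff_succ_iff_hasFDerivAt.2 ⟨fun u => mulL (nemytskii (partialX f hf) u), ?_,
      hasFDerivAt_nemytskii hf⟩
    exact (ContinuousLinearMap.contDiff (E := C0) (F := C0 →L[ℝ] C0) mulL).comp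
      (ih (isSmooth_partialX hf))

end Nemytskii

/-! ### Zeros of functions of one variable, and the inverse function theorem -/

lemma exists_zero_deriv_nonpos {φ φ' : ℝ → ℝ} {a b : ℝ} (hab : a < b)
    (hd : ∀ x ∈ Icc a b, HasDerivAt φ (φ' x) x) (ha : 0 ≤ φ a) (hb : φ b ≤ 0) :
    ∃ z ∈ Icc a b, φ z = 0 ∧ φ' z ≤ 0 := by
  by_contra! hpos
  have hnonneg : ∀ x ∈ Icc a b, -φ x ≤ 0 := fun x hx =>
    image_le_of_deriv_right_lt_deriv_boundary (B := fun _ => 0) (B' := fun _ => 0)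
      (fun x hx => (hd x hx).continuousAt.neg.continuousWithinAt)
      (fun x hx => (hd x (Ico_subset_Icc_self hx)).neg.hasDerivWithinAt)
      (neg_nonpos.2 ha) (fun x => hasDerivAt_const x 0)
      (fun x hx h0 => neg_lt_zero.2 (hpos x (Ico_subset_Icc_self hx) (neg_eq_zero.1 h0))) hx
  have hb0 : φ b = 0 := hb.antisymm (neg_nonpos.1 (hnonneg b (right_mem_Icc.2 hab.le)))
  have hslope : Filter.Tendsto (slope φ b) (nhdsWithin b (Iio b)) (nhds (φ' b)) :=
    (hasDerivAt_iff_tendsto_slope.1 (hd b (right_mem_Icc.2 hab.le))).mono_left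
      (nhdsWithin_mono b fun x (hx : x < b) => hx.ne)
  refine (hpos b (right_mem_Icc.2 hab.le) hb0).not_ge (le_of_tendsto hslope ?_)
  filter_upwards [Ico_mem_nhdsLT hab] with x hx
  rw [slope_def_field, hb0, sub_zero]
  exact div_nonpos_of_nonneg_of_nonpos (neg_nonpos.1 (hnonneg x ⟨hx.1, hx.2.le⟩))
    (sub_nonpos.2 hx.2.le)

lemma exists_zero_deriv_nonneg {φ φ' : ℝ → ℝ} {a b : ℝ} (hab : a < b)
    (hd : ∀ x ∈ Icc a b, HasDerivAt φ (φ' x) x) (ha : φ a ≤ 0) (hb : 0 ≤ φ b) :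
    ∃ z ∈ Icc a b, φ z = 0 ∧ 0 ≤ φ' z := by
  obtain ⟨z, hz, h0, h1⟩ := exists_zero_deriv_nonpos hab (fun x hx => (hd x hx).neg)
    (by simpa using ha) (by simpa using hb)
  exact ⟨z, hz, by simpa using h0, by simpa using h1⟩

section InverseFunction

variable {E F : Type*} [NormedAddCommGroup E] [NormedSpace ℝ E] [CompleteSpace E]
  [NormedAddCommGroup F] [NormedSpace ℝ F]

lemma isOpenMap_of_invertible_fderiv {Φ : E → F} (hc : ContDiff ℝ 1 Φ)
    (hd : ∀ x, ∃ L : E ≃L[ℝ] F, HasFDerivAt Φ (L : E →L[ℝ] F) x) : IsOpenMap Φ := by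
  refine isOpenMap_iff_nhds_le.2 fun x => ?_
  obtain ⟨L, hL⟩ := hd x
  exact (hc.contDiffAt.hasStrictFDerivAt' hL (by simp)).map_nhds_eq_of_equiv.ge

lemma contDiff_symm_of_invertible_fderiv {n : ℕ∞} (hn : 1 ≤ n) (e : E ≃ F)
    (hc : ContDiff ℝ n e)
    (hd : ∀ x, ∃ L : E ≃L[ℝ] F, HasFDerivAt e (L : E →L[ℝ] F) x) : ContDiff ℝ n e.symm := by
  choose L hL using hd
  exact (e.toHomeomorphOfContinuousOpen hc.continuous (isOpenMap_of_invertible_fderiv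
    (hc.of_le (mod_cast hn)) fun x => ⟨L x, hL x⟩)).contDiff_symm hL hc

end InverseFunction

/-! ### Periodic linear equations of the first order -/

lemma mul_exp_linePrim {a : C0} {z : ℝ → ℝ} {k : ℝ}
    (hz : ∀ r : ℝ, HasDerivAt z (k - a r * z r) r) (r : ℝ) :
    z r * Real.exp (linePrim a r) = z 0 + k * ∫ s in (0 : ℝ)..r, Real.exp (linePrim a s) := by
  have hderiv : ∀ s : ℝ, HasDerivAt (fun s => z s * Real.exp (linePrim a s))
      (k * Real.exp (linePrim a s)) s := fun s =>
    ((hz s).mul (hasDerivAt_linePrim a s).exp).congr_deriv (by ring)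
  have hcont : Continuous fun s => k * Real.exp (linePrim a s) :=
    continuous_const.mul (continuous_linePrim a).rexp
  have hFTC := intervalIntegral.integral_eq_sub_of_hasDerivAt (fun s _ => hderiv s)
    (hcont.intervalIntegrable 0 r)
  rw [intervalIntegral.integral_const_mul, linePrim_zero, Real.exp_zero, mul_one] at hFTC
  exact (eq_add_of_sub_eq' hFTC.symm)

/-- The weight `∫₀¹ exp (∫₀ʳ a) dr`: it is positive, and it is what the variation of constants
formula for `z' + a z = k` multiplies the constant `k` with over one period. -/
def expWeight (a : C0) : ℝ := ∫ s in (0 : ℝ)..1, Real.exp (linePrim a s)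

lemma expWeight_pos (a : C0) : 0 < expWeight a :=
  intervalIntegral.intervalIntegral_pos_of_pos
    ((continuous_linePrim a).rexp.intervalIntegrable 0 1) (fun _ => Real.exp_pos _) zero_lt_one

lemma hasDerivAt_of_add_primC_eq {n y : C0} {x : ℝ} (h : y + primC n = x • 1) (r : ℝ) :
    HasDerivAt (fun s : ℝ => y (s : UnitAddCircle)) (meanC n - n r) r := by
  rw [eq_sub_of_add_eq h]
  simpa using (hasDerivAt_primC n r).const_sub x

lemma eq_zero_of_add_primC_mul {a z : C0} (h : z + primC (a * z) = 0) : z = 0 := by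
  have hderiv : ∀ r : ℝ, HasDerivAt (fun s : ℝ => z (s : UnitAddCircle))
      (meanC (a * z) - a r * z r) r :=
    hasDerivAt_of_add_primC_eq (x := 0) (by rw [h, zero_smul])
  have hz0 : z 0 = 0 := by simpa [primC_zero] using congrArg (fun u : C0 => u 0) h
  have hmean : meanC (a * z) = 0 := by
    have h1 : _ = _ + _ * expWeight a := mul_exp_linePrim hderiv 1
    rw [coe_one_eq_zero, coe_zero_eq_zero, hz0, zero_mul, zero_add] at h1
    exact (mul_eq_zero.1 h1.symm).resolve_right (expWeight_pos a).ne'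
  ext t
  obtain ⟨s, -, rfl⟩ := exists_coe_eq t
  have hs := mul_exp_linePrim hderiv s
  rw [hmean, coe_zero_eq_zero, hz0, zero_mul, zero_add] at hs
  exact (mul_eq_zero.1 hs).resolve_right (Real.exp_ne_zero _)

/-- The linear Volterra operator `w ↦ w + primC (a w)`, the integral form of `w' + a w`. -/
def linVolterra (a : C0) : C0 →L[ℝ] C0 := ContinuousLinearMap.id ℝ C0 + primC.comp (mulL a)

lemma bijective_linVolterra (a : C0) : Function.Bijective (linVolterra a) := by
  have hcompact : IsCompactOperator (primC.comp (mulL a)) := isCompactOperator_primC.comp_clm _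
  rcases hcompact.hasEigenvalue_or_mem_resolventSet (μ := (-1 : ℝ)) (by norm_num) with h | h
  · obtain ⟨w, hw⟩ := h.exists_hasEigenvector
    have heq : primC (a * w) = (-1 : ℝ) • w := hw.apply_eq_smul
    exact absurd (eq_zero_of_add_primC_mul (a := a) (by rw [heq, neg_one_smul, add_neg_cancel]))
      hw.2
  · rw [spectrum.mem_resolventSet_iff, ← IsUnit.neg_iff,
      ContinuousLinearMap.isUnit_iff_bijective] at h
    convert h using 2
    ext w : 1
    simp [linVolterra, add_comm]

/-- The linear Volterra operator as a continuous linear equivalence. -/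
def linVolterraEquiv (a : C0) : C0 ≃L[ℝ] C0 :=
  ContinuousLinearEquiv.ofBijective (linVolterra a)
    (LinearMap.ker_eq_bot.2 (bijective_linVolterra a).1)
    (LinearMap.range_eq_top.2 (bijective_linVolterra a).2)

lemma linVolterraEquiv_symm_add (a h : C0) :
    (linVolterraEquiv a).symm h + primC (a * (linVolterraEquiv a).symm h) = h :=
  (linVolterraEquiv a).apply_symm_apply h

/-! ### The integral form of the equation -/

lemma exists_meanC_eq_forall_primC_le (n : C0) :
    ∃ t, n t = meanC n ∧ ∀ s, primC n s ≤ primC n t := by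
  obtain ⟨t, -, ht⟩ := isCompact_univ.exists_isMaxOn univ_nonempty
    (primC n).continuous.continuousOn
  obtain ⟨r, -, rfl⟩ := exists_coe_eq t
  have hmax : IsLocalMax (fun s : ℝ => primC n (s : UnitAddCircle)) r :=
    Filter.Eventually.of_forall fun s => ht (mem_univ (s : UnitAddCircle))
  exact ⟨r, sub_eq_zero.1 (hmax.hasDerivAt_eq_zero (hasDerivAt_primC n r)),
    fun s => ht (mem_univ s)⟩

lemma exists_meanC_eq_forall_le_primC (n : C0) :
    ∃ t, n t = meanC n ∧ ∀ s, primC n t ≤ primC n s := by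
  obtain ⟨t, ht, hmax⟩ := exists_meanC_eq_forall_primC_le (-n)
  exact ⟨t, by simpa using ht, fun s => by simpa using hmax s⟩

lemma isClosed_range_id_add_isCompactOperator {E F : Type*} [NormedAddCommGroup E]
    [NormedSpace ℝ E] [NormedAddCommGroup F] [NormedSpace ℝ F] {T : F →L[ℝ] E}
    (hT : IsCompactOperator T) {N : E → F} (hN : Continuous N)
    (hN_bound : ∀ R, ∃ M, ∀ u, ‖u‖ ≤ R → ‖N u‖ ≤ M)
    (h_bound : ∀ B, ∃ R, ∀ u, ‖u + T (N u)‖ ≤ B → ‖u‖ ≤ R) :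
    IsClosed (range fun u => u + T (N u)) := by
  refine IsSeqClosed.isClosed fun h h₀ hh hlim => ?_
  choose u hu using hh
  obtain ⟨B, hB⟩ := (Metric.isBounded_range_of_tendsto h hlim).exists_norm_le
  obtain ⟨R, hR⟩ := h_bound B
  obtain ⟨M, hM⟩ := hN_bound R
  obtain ⟨K, hK, hKsub⟩ := IsCompactOperator.image_closedBall_subset_compact (𝕜₁ := ℝ)
    (f := (T : F →ₗ[ℝ] E)) hT M
  have hmem : ∀ n, T (N (u n)) ∈ K := fun n => hKsub ⟨N (u n), mem_closedBall_zero_iff.2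
    (hM _ (hR _ ((congrArg norm (hu n)).trans_le (hB _ (mem_range_self n))))), rfl⟩
  obtain ⟨y, -, φ, hφ, hy⟩ := hK.tendsto_subseq hmem
  have hulim : Filter.Tendsto (u ∘ φ) Filter.atTop (nhds (h₀ - y)) :=
    ((hlim.comp hφ.tendsto_atTop).sub hy).congr fun n => sub_eq_of_eq_add (hu (φ n)).symm
  have hcont : Continuous fun u => u + T (N u) := continuous_id.add (T.continuous.comp hN)
  exact ⟨h₀ - y, tendsto_nhds_unique ((hcont.tendsto _).comp hulim)
    ((hlim.comp hφ.tendsto_atTop).congr fun n => (hu (φ n)).symm)⟩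

section Volterra

variable {f : C(UnitAddCircle × ℝ, ℝ)}

/-- The Volterra operator `u ↦ u + primC (f (t, u))`: up to constants, `volterra f u = h` is the
equation `u' + f (t, u) = h' + const` in integral form. -/
def volterra (f : C(UnitAddCircle × ℝ, ℝ)) (u : C0) : C0 := u + primC (nemytskii f u)

lemma contDiff_volterra (hf : IsSmooth f) : ContDiff ℝ ∞ (volterra f) :=
  contDiff_id.add (primC.contDiff.comp (contDiff_nemytskii hf))

lemma hasFDerivAt_volterra (hf : IsSmooth f) (u : C0) :
    HasFDerivAt (volterra f) (linVolterraEquiv (nemytskii (partialX f hf) u) : C0 →L[ℝ] C0) u :=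
  (hasFDerivAt_id u).add (primC.hasFDerivAt.comp u (hasFDerivAt_nemytskii hf u))

lemma exists_nemytskii_sub_eq_mul (hf : IsSmooth f) (u v : C0) :
    ∃ a : C0, nemytskii f u - nemytskii f v = a * (u - v) := by
  set A : ℝ → C0 := fun s => nemytskii (partialX f hf) (v + s • (u - v))
  have hline : ∀ s : ℝ, HasDerivAt (fun s : ℝ => v + s • (u - v)) (u - v) s := fun s => by
    simpa using ((hasDerivAt_id s).smul_const (u - v)).const_add v
  have hderiv : ∀ s : ℝ, HasDerivAt (fun s : ℝ => nemytskii f (v + s • (u - v)))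
      (A s * (u - v)) s := fun s => (hasFDerivAt_nemytskii hf _).comp_hasDerivAt s (hline s)
  have hcont : Continuous A := (continuous_nemytskii _).comp (by fun_prop)
  refine ⟨∫ s in (0 : ℝ)..1, A s, ?_⟩
  calc nemytskii f u - nemytskii f v
    _ = nemytskii f (v + (1 : ℝ) • (u - v)) - nemytskii f (v + (0 : ℝ) • (u - v)) := by simp
    _ = ∫ s in (0 : ℝ)..1, A s * (u - v) :=
        (intervalIntegral.integral_eq_sub_of_hasDerivAt (fun s _ => hderiv s)
          ((hcont.mul continuous_const).intervalIntegrable 0 1)).symm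
    _ = (∫ s in (0 : ℝ)..1, A s) * (u - v) :=
        (mulL.flip (u - v)).intervalIntegral_comp_comm (hcont.intervalIntegrable 0 1)

lemma injective_volterra (hf : IsSmooth f) : Function.Injective (volterra f) := by
  intro u v h
  obtain ⟨a, ha⟩ := exists_nemytskii_sub_eq_mul hf u v
  refine sub_eq_zero.1 (eq_zero_of_add_primC_mul (a := a) ?_)
  rw [← ha, map_sub, sub_add_sub_comm]
  exact sub_eq_zero.2 h

lemma exists_apply_volterra_eq_meanC (f : C(UnitAddCircle × ℝ, ℝ)) (u : C0) :
    ∃ t, f (t, volterra f u t) = meanC (nemytskii f u) := by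
  set n := nemytskii f u
  have hvalue : ∀ r : ℝ, primC n r = 0 → f (r, volterra f u r) = n r := fun r hr => by
    rw [volterra, ContinuousMap.add_apply, hr, add_zero]
    rfl
  have hderiv := fun r (_ : r ∈ Icc (0 : ℝ) 1) => hasDerivAt_primC n r
  have h0 : primC n ((0 : ℝ) : UnitAddCircle) = 0 := primC_zero n
  have h1 : primC n ((1 : ℝ) : UnitAddCircle) = 0 := coe_one_eq_zero ▸ primC_zero n
  obtain ⟨r, -, hr0, hr⟩ := exists_zero_deriv_nonpos zero_lt_one hderiv h0.ge h1.le
  obtain ⟨s, -, hs0, hs⟩ := exists_zero_deriv_nonneg zero_lt_one hderiv h0.le h1.ge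
  have hcont : Continuous fun t => f (t, volterra f u t) := by fun_prop
  exact mem_range_of_exists_le_of_exists_ge hcont
    ⟨r, (hvalue r hr0).trans_le (sub_nonpos.1 hr)⟩
    ⟨s, (sub_nonneg.1 hs).trans_eq (hvalue s hs0).symm⟩

lemma exists_norm_nemytskii_le (f : C(UnitAddCircle × ℝ, ℝ)) (R : ℝ) :
    ∃ M, ∀ u : C0, ‖u‖ ≤ R → ‖nemytskii f u‖ ≤ M := by
  have hK : IsCompact ((univ : Set UnitAddCircle) ×ˢ Icc (-R) R) :=
    isCompact_univ.prod isCompact_Icc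
  obtain ⟨M, hM⟩ := hK.exists_bound_of_continuousOn f.continuous.continuousOn
  refine ⟨M, fun u hu => (ContinuousMap.norm_le_of_nonempty _).2 fun t => ?_⟩
  exact hM (t, u t) ⟨mem_univ _, abs_le.1 ((u.norm_coe_le_norm t).trans hu)⟩

lemma exists_abs_snd_le_of_isProperMap {α : Type*} [TopologicalSpace α] {f : α × ℝ → ℝ}
    (hproper : IsProperMap f) (M : ℝ) : ∃ R, ∀ t x, |f (t, x)| ≤ M → |x| ≤ R := by
  obtain ⟨R, hR⟩ := (hproper.isCompact_preimage isCompact_Icc).exists_bound_of_continuousOn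
    (continuous_snd.continuousOn (s := f ⁻¹' Icc (-M) M))
  exact ⟨R, fun t x hx => hR (t, x) (abs_le.1 hx)⟩

lemma exists_norm_le_of_norm_volterra_le (hproper : IsProperMap f) (B : ℝ) :
    ∃ R, ∀ u : C0, ‖volterra f u‖ ≤ B → ‖u‖ ≤ R := by
  obtain ⟨M, hM⟩ := exists_norm_nemytskii_le f B
  obtain ⟨R, hR⟩ := exists_abs_snd_le_of_isProperMap hproper M
  refine ⟨R + 2 * B, fun u hu => (ContinuousMap.norm_le_of_nonempty _).2 fun t => ?_⟩
  set n := nemytskii f u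
  have hcritical : ∀ t, n t = meanC n → |u t| ≤ R := fun t ht => by
    obtain ⟨s, hs⟩ := exists_apply_volterra_eq_meanC f u
    refine hR t (u t) ?_
    calc |n t| = |nemytskii f (volterra f u) s| := congrArg abs (ht.trans hs.symm)
      _ ≤ ‖nemytskii f (volterra f u)‖ := (nemytskii f (volterra f u)).norm_coe_le_norm s
      _ ≤ M := hM _ hu
  have hvolterra : ∀ t, |u t + primC n t| ≤ B := fun t =>
    ((volterra f u).norm_coe_le_norm t).trans hu
  obtain ⟨p, hp, hmax⟩ := exists_meanC_eq_forall_primC_le n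
  obtain ⟨q, hq, hmin⟩ := exists_meanC_eq_forall_le_primC n
  have hup := abs_le.1 (hcritical p hp)
  have huq := abs_le.1 (hcritical q hq)
  have ht := abs_le.1 (hvolterra t)
  refine abs_le.2 ⟨?_, ?_⟩
  · linarith [hmax t, (abs_le.1 (hvolterra p)).2]
  · linarith [hmin t, (abs_le.1 (hvolterra q)).1]

lemma surjective_volterra (hf : IsSmooth f) (hproper : IsProperMap f) :
    Function.Surjective (volterra f) := by
  have hclosed : IsClosed (range (volterra f)) :=
    isClosed_range_id_add_isCompactOperator isCompactOperator_primC (continuous_nemytskii f)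
      (exists_norm_nemytskii_le f) (exists_norm_le_of_norm_volterra_le hproper)
  have hopen : IsOpen (range (volterra f)) :=
    (isOpenMap_of_invertible_fderiv ((contDiff_volterra hf).of_le (by simp))
      fun u => ⟨_, hasFDerivAt_volterra hf u⟩).isOpen_range
  exact range_eq_univ.1 (IsClopen.eq_univ ⟨hclosed, hopen⟩ (range_nonempty _))

/-- The Volterra operator of a smooth proper function, as a bijection. -/
def volterraEquiv (hf : IsSmooth f) (hproper : IsProperMap f) : C0 ≃ C0 :=
  Equiv.ofBijective (volterra f) ⟨injective_volterra hf, surjective_volterra hf hproper⟩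

variable (hf : IsSmooth f) (hproper : IsProperMap f)

lemma volterra_volterraEquiv_symm (h : C0) :
    volterra f ((volterraEquiv hf hproper).symm h) = h :=
  (volterraEquiv hf hproper).apply_symm_apply h

lemma volterraEquiv_symm_volterra (u : C0) :
    (volterraEquiv hf hproper).symm (volterra f u) = u :=
  (volterraEquiv hf hproper).symm_apply_apply u

lemma contDiff_volterraEquiv_symm : ContDiff ℝ ∞ (volterraEquiv hf hproper).symm :=
  contDiff_symm_of_invertible_fderiv le_top _ (contDiff_volterra hf)
    fun u => ⟨_, hasFDerivAt_volterra hf u⟩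

lemma hasFDerivAt_volterraEquiv_symm (h : C0) :
    HasFDerivAt (volterraEquiv hf hproper).symm
      ((linVolterraEquiv (nemytskii (partialX f hf)
        ((volterraEquiv hf hproper).symm h))).symm : C0 →L[ℝ] C0) h :=
  HasFDerivAt.of_local_left_inverse (contDiff_volterraEquiv_symm hf hproper).continuous.continuousAt
    (hasFDerivAt_volterra hf _)
    (Filter.Eventually.of_forall (volterra_volterraEquiv_symm hf hproper))

end Volterra

/-! ### The average of the nonlinearity and its derivatives along the constants -/

lemma linePrim_eq_primC_add (a : C0) (r : ℝ) : linePrim a r = primC a r + r * meanC a :=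
  eq_add_of_sub_eq (primC_coe a r).symm

lemma continuous_expWeight : Continuous expWeight := by
  refine intervalIntegral.continuous_parametric_intervalIntegral_of_continuous' ?_ 0 1
  have heval : Continuous fun p : C0 × ℝ => primC p.1 (p.2 : UnitAddCircle) :=
    continuous_eval.comp ((primC.continuous.comp continuous_fst).prodMk
      ((AddCircle.continuous_mk' 1).comp continuous_snd))
  simp only [Function.uncurry_def, linePrim_eq_primC_add]
  exact (heval.add (continuous_snd.mul (meanC.continuous.comp continuous_fst))).rexp

/-- The function `exp (-v)`; for `v = primC a` with `meanC a = 0` it is the positive solution of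
`w' + a w = 0` with value `1` at `0`. -/
def negExp (v : C0) : C0 := ⟨fun t => Real.exp (-v t), by fun_prop⟩

lemma continuous_negExp : Continuous negExp := by
  refine ContinuousMap.continuous_of_continuous_uncurry _ ?_
  change Continuous fun p : C0 × UnitAddCircle => Real.exp (-p.1 p.2)
  fun_prop

lemma hasDerivAt_linVolterraEquiv_symm_one (a : C0) (r : ℝ) :
    HasDerivAt (fun s : ℝ => (linVolterraEquiv a).symm 1 (s : UnitAddCircle))
      (meanC (a * (linVolterraEquiv a).symm 1) - a r * (linVolterraEquiv a).symm 1 r) r :=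
  hasDerivAt_of_add_primC_eq (x := 1) (by rw [linVolterraEquiv_symm_add, one_smul]) r

lemma linVolterraEquiv_symm_one_zero (a : C0) : (linVolterraEquiv a).symm 1 0 = 1 := by
  simpa [primC_zero] using congrArg (fun u : C0 => u 0) (linVolterraEquiv_symm_add a 1)

lemma meanC_mul_linVolterraEquiv_symm_one (a : C0) :
    meanC (a * (linVolterraEquiv a).symm 1) = (Real.exp (meanC a) - 1) / expWeight a := by
  have h := mul_exp_linePrim (hasDerivAt_linVolterraEquiv_symm_one a) 1
  rw [coe_one_eq_zero, coe_zero_eq_zero, linVolterraEquiv_symm_one_zero, linePrim_one,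
    one_mul] at h
  rw [eq_div_iff (expWeight_pos a).ne', h, expWeight, add_sub_cancel_left]

lemma linVolterraEquiv_symm_one_of_meanC_eq_zero {a : C0} (ha : meanC a = 0) :
    (linVolterraEquiv a).symm 1 = negExp (primC a) := by
  ext t
  obtain ⟨s, -, rfl⟩ := exists_coe_eq t
  have h := mul_exp_linePrim (hasDerivAt_linVolterraEquiv_symm_one a) s
  rw [meanC_mul_linVolterraEquiv_symm_one, ha, Real.exp_zero, sub_self, zero_div, zero_mul,
    add_zero, coe_zero_eq_zero, linVolterraEquiv_symm_one_zero, linePrim_eq_primC_add, ha, mul_zero,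
    add_zero] at h
  exact (eq_inv_of_mul_eq_one_left h).trans (Real.exp_neg _).symm

lemma hasDerivAt_div_of_eq_zero {𝕜 : Type*} [NontriviallyNormedField 𝕜] {N D : 𝕜 → 𝕜} {n' x : 𝕜}
    (hN : HasDerivAt N n' x) (hNx : N x = 0) (hD : ContinuousAt D x) (hDx : D x ≠ 0) :
    HasDerivAt (fun y => N y / D y) (n' / D x) x := by
  rw [hasDerivAt_iff_tendsto_slope] at hN ⊢
  refine (hN.div (hD.tendsto.mono_left nhdsWithin_le_nhds) hDx).congr fun y => ?_
  rw [Pi.div_apply, slope_def_field, slope_def_field, hNx, zero_div, sub_zero, sub_zero,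
    div_right_comm]

section Average

variable {f : C(UnitAddCircle × ℝ, ℝ)} (hf : IsSmooth f)

/-- The second order functional `∫ ∂ₓ²f (t, u) exp (-∫₀ᵗ ∂ₓf (s, u) ds) dt`: on the zero set of
`sigma1 f` its sign decides the type of a critical point. -/
def sigma2 (u : C0) : ℝ :=
  meanC (nemytskii (partialX (partialX f hf) (isSmooth_partialX hf)) u *
    negExp (primC (nemytskii (partialX f hf) u)))

lemma continuous_sigma2 : Continuous (sigma2 hf) :=
  meanC.continuous.comp ((continuous_nemytskii _).mul
    (continuous_negExp.comp (primC.continuous.comp (continuous_nemytskii _))))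

lemma sigma1_eq_meanC (u : C0) : sigma1 f u = meanC (nemytskii (partialX f hf) u) :=
  (meanC_apply (nemytskii (partialX f hf) u)).symm

lemma hasFDerivAt_sigma1 (u : C0) :
    HasFDerivAt (sigma1 f) (meanC.comp (mulL (nemytskii (partialX (partialX f hf)
      (isSmooth_partialX hf)) u))) u := by
  rw [show sigma1 f = meanC ∘ nemytskii (partialX f hf) from funext (sigma1_eq_meanC hf)]
  exact meanC.hasFDerivAt.comp u (hasFDerivAt_nemytskii (isSmooth_partialX hf) u)

include hf in
lemma continuous_sigma1 : Continuous (sigma1 f) :=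
  continuous_iff_continuousAt.2 fun u => (hasFDerivAt_sigma1 hf u).continuousAt

variable (hproper : IsProperMap f)

/-- The average of `f (t, u)`, where `u` is the solution of `volterra f u = V`. -/
def avg (V : C0) : ℝ := meanC (nemytskii f ((volterraEquiv hf hproper).symm V))

lemma contDiff_avg : ContDiff ℝ ∞ (avg hf hproper) :=
  meanC.contDiff.comp ((contDiff_nemytskii hf).comp (contDiff_volterraEquiv_symm hf hproper))

lemma exists_avg_eq (V : C0) : ∃ t, avg hf hproper V = f (t, V t) := by
  obtain ⟨t, ht⟩ := exists_apply_volterra_eq_meanC f ((volterraEquiv hf hproper).symm V)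
  rw [volterra_volterraEquiv_symm] at ht
  exact ⟨t, ht.symm⟩

/-- The derivative of the average along the constants. -/
def avgSlope (V : C0) : ℝ :=
  (Real.exp (sigma1 f ((volterraEquiv hf hproper).symm V)) - 1) /
    expWeight (nemytskii (partialX f hf) ((volterraEquiv hf hproper).symm V))

lemma avgSlope_eq_zero_iff (V : C0) :
    avgSlope hf hproper V = 0 ↔ sigma1 f ((volterraEquiv hf hproper).symm V) = 0 := by
  rw [avgSlope, div_eq_zero_iff, or_iff_left (expWeight_pos _).ne', sub_eq_zero,
    Real.exp_eq_one_iff]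

lemma continuous_avgSlope : Continuous (avgSlope hf hproper) := by
  have hu := (contDiff_volterraEquiv_symm hf hproper).continuous
  exact ((((continuous_sigma1 hf).comp hu).rexp).sub continuous_const).div
    (continuous_expWeight.comp ((continuous_nemytskii _).comp hu)) fun _ => (expWeight_pos _).ne'

lemma hasDerivAt_volterraEquiv_symm_line (V : C0) (x : ℝ) :
    HasDerivAt (fun x : ℝ => (volterraEquiv hf hproper).symm (V + x • 1))
      ((linVolterraEquiv (nemytskii (partialX f hf)
        ((volterraEquiv hf hproper).symm (V + x • 1)))).symm 1) x := by
  have hline : HasDerivAt (fun x : ℝ => V + x • (1 : C0)) 1 x := by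
    simpa using ((hasDerivAt_id x).smul_const (1 : C0)).const_add V
  exact (hasFDerivAt_volterraEquiv_symm hf hproper (V + x • 1)).comp_hasDerivAt x hline

lemma hasDerivAt_avg (V : C0) (x : ℝ) :
    HasDerivAt (fun x : ℝ => avg hf hproper (V + x • 1)) (avgSlope hf hproper (V + x • 1)) x := by
  refine (meanC.hasFDerivAt.comp_hasDerivAt x ((hasFDerivAt_nemytskii hf _).comp_hasDerivAt x
    (hasDerivAt_volterraEquiv_symm_line hf hproper V x))).congr_deriv ?_
  rw [avgSlope, sigma1_eq_meanC hf, ← meanC_mul_linVolterraEquiv_symm_one]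
  rfl

lemma hasDerivAt_avgSlope {V : C0} {x : ℝ}
    (h0 : sigma1 f ((volterraEquiv hf hproper).symm (V + x • 1)) = 0) :
    HasDerivAt (fun x : ℝ => avgSlope hf hproper (V + x • 1))
      (sigma2 hf ((volterraEquiv hf hproper).symm (V + x • 1)) /
        expWeight (nemytskii (partialX f hf) ((volterraEquiv hf hproper).symm (V + x • 1)))) x := by
  have hnum := (((hasFDerivAt_sigma1 hf _).comp_hasDerivAt x
    (hasDerivAt_volterraEquiv_symm_line hf hproper V x)).exp.sub_const 1)
  rw [linVolterraEquiv_symm_one_of_meanC_eq_zero (by rw [← sigma1_eq_meanC hf, h0]),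
    Function.comp_apply, h0, Real.exp_zero, one_mul] at hnum
  refine hasDerivAt_div_of_eq_zero hnum (by simp [h0]) ?_ (expWeight_pos _).ne'
  exact (continuous_expWeight.comp ((continuous_nemytskii _).comp
    ((contDiff_volterraEquiv_symm hf hproper).continuous.comp (by fun_prop)))).continuousAt

end Average

/-! ### Integrals depending smoothly on a parameter -/

section Parametric

lemma hasFDerivAt_integral_of_contDiff {E F : Type*} [NormedAddCommGroup E] [NormedSpace ℝ E]
    [NormedAddCommGroup F] [NormedSpace ℝ F] {H : E × ℝ → F} (hH : ContDiff ℝ 1 H) (e₀ : E) :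
    HasFDerivAt (fun e => ∫ t in (0 : ℝ)..1, H (e, t))
      (∫ t in (0 : ℝ)..1, (fderiv ℝ H (e₀, t)).comp (ContinuousLinearMap.inl ℝ E ℝ)) e₀ := by
  let D : E × ℝ → (E →L[ℝ] F) := fun p => (fderiv ℝ H p).comp (ContinuousLinearMap.inl ℝ E ℝ)
  have hD : Continuous D := (hH.continuous_fderiv one_ne_zero).clm_comp continuous_const
  have hDline : Continuous fun t : ℝ => D (e₀, t) := hD.comp (Continuous.prodMk_right e₀)
  have hHline : ∀ e, Continuous fun t : ℝ => H (e, t) := fun e =>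
    hH.continuous.comp (Continuous.prodMk_right e)
  obtain ⟨C, hC⟩ := (isCompact_Icc (a := (0 : ℝ)) (b := 1)).exists_bound_of_continuousOn
    hDline.continuousOn
  obtain ⟨u, v, hu, -, heu, hv, huv⟩ := generalized_tube_lemma (isCompact_singleton (x := e₀))
    (isCompact_Icc (a := (0 : ℝ)) (b := 1))
    (isOpen_lt hD.norm continuous_const : IsOpen {p | ‖D p‖ < C + 1}) (by
      rintro ⟨e, t⟩ ⟨rfl, ht⟩
      exact (hC t ht).trans_lt (lt_add_one C))
  refine (intervalIntegral.hasFDerivAt_integral_of_dominated_of_fderiv_le (μ := volume)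
    (F := fun e t => H (e, t)) (F' := fun e t => D (e, t)) (bound := fun _ => C + 1)
    (hu.mem_nhds (heu rfl)) (.of_forall fun e => (hHline e).aestronglyMeasurable)
    ((hHline e₀).intervalIntegrable 0 1) hDline.aestronglyMeasurable
    (.of_forall fun t ht e he => ?_) intervalIntegrable_const (.of_forall fun t _ e _ => ?_))
  · rw [uIoc_of_le zero_le_one] at ht
    exact (huv (mk_mem_prod he (hv (Ioc_subset_Icc_self ht)))).le
  · exact (hH.differentiable one_ne_zero).differentiableAt.hasFDerivAt.comp e
      (hasFDerivAt_prodMk_left e t)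

universe u

lemma contDiff_integral_of_contDiff {E F : Type u} [NormedAddCommGroup E] [NormedSpace ℝ E]
    [NormedAddCommGroup F] [NormedSpace ℝ F] {H : E × ℝ → F} (hH : ContDiff ℝ ∞ H) :
    ContDiff ℝ ∞ fun e => ∫ t in (0 : ℝ)..1, H (e, t) := by
  refine contDiff_infty.2 fun n => ?_
  induction n generalizing F with
  | zero =>
    exact contDiff_zero.2 (continuous_iff_continuousAt.2 fun e =>
      (hasFDerivAt_integral_of_contDiff (hH.of_le (by simp)) e).continuousAt)
  | succ n ih =>
    exact contDiff_succ_iff_hasFDerivAt.2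
      ⟨_, ih (H := fun p => (fderiv ℝ H p).comp (ContinuousLinearMap.inl ℝ E ℝ))
        ((hH.fderiv_right (m := ∞) (by simp)).clm_comp contDiff_const),
        hasFDerivAt_integral_of_contDiff (hH.of_le (by simp))⟩

end Parametric

/-! ### Partial derivatives on `ℝ × X` -/

section Partial

variable {X : Type*} [NormedAddCommGroup X] [NormedSpace ℝ X]

/-- The partial derivative in the real variable. -/
def pd (c : ℝ × X → ℝ) (p : ℝ × X) : ℝ := fderiv ℝ c p (1, 0)

lemma contDiff_pd {c : ℝ × X → ℝ} (hc : ContDiff ℝ ∞ c) : ContDiff ℝ ∞ (pd c) :=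
  (hc.fderiv_right (m := ∞) (by simp)).clm_apply contDiff_const

lemma hasDerivAt_pd {c : ℝ × X → ℝ} (hc : Differentiable ℝ c) (x : ℝ) (q : X) :
    HasDerivAt (fun y : ℝ => c (y, q)) (pd c (x, q)) x :=
  (hc (x, q)).hasFDerivAt.comp_hasDerivAt x ((hasDerivAt_id x).prodMk (hasDerivAt_const x q))

lemma exists_equiv_hasFDerivAt_of_pd_ne_zero {y : ℝ × X → ℝ} {p : ℝ × X}
    (hy : DifferentiableAt ℝ y p) (h : pd y p ≠ 0) :
    ∃ T : (ℝ × X) ≃L[ℝ] ℝ × X, HasFDerivAt (fun p : ℝ × X => (y p, p.2)) (T : _ →L[ℝ] _) p := by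
  let T := (ContinuousLinearEquiv.prodComm ℝ ℝ X).trans
    (((ContinuousLinearEquiv.refl ℝ X).skewProd (ContinuousLinearEquiv.unitsEquivAut ℝ
      (Units.mk0 _ h)) ((fderiv ℝ y p).comp (.inr ℝ ℝ X))).trans (.prodComm ℝ X ℝ))
  have hT : (T : ℝ × X →L[ℝ] ℝ × X) = (fderiv ℝ y p).prod (.snd ℝ ℝ X) := by
    ext v
    · simpa [T, pd, -map_zero] using! (fderiv ℝ y p).map_zero
    all_goals simp [T]
  exact ⟨T, hT ▸ hy.hasFDerivAt.prodMk hasFDerivAt_snd⟩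

variable [CompleteSpace X]

lemma contDiff_of_unique_zero {k : ℝ × X → ℝ} (hk : ContDiff ℝ ∞ k) {m : X → ℝ}
    (hm : ∀ x q, k (x, q) = 0 ↔ x = m q) (hnd : ∀ q, pd k (m q, q) ≠ 0) : ContDiff ℝ ∞ m := by
  refine contDiff_iff_contDiffAt.2 fun q₀ => ?_
  have hswap : ContDiff ℝ ∞ fun p : X × ℝ => k (p.2, p.1) :=
    hk.comp (contDiff_snd.prodMk contDiff_fst)
  have hinv : (fderiv ℝ (fun p : X × ℝ => k (p.2, p.1)) (q₀, m q₀) ∘L .inr ℝ X ℝ).IsInvertible := by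
    refine ⟨ContinuousLinearEquiv.unitsEquivAut ℝ (Units.mk0 _ (hnd q₀)), ?_⟩
    have hd : HasFDerivAt (fun p : X × ℝ => k (p.2, p.1)) _ (q₀, m q₀) :=
      (hk.differentiable (by simp) (m q₀, q₀)).hasFDerivAt.comp (q₀, m q₀)
        (hasFDerivAt_snd.prodMk hasFDerivAt_fst)
    ext
    simp [hd.fderiv, pd]
  refine (hswap.contDiffAt.contDiffAt_implicitFunction (by simp) hinv).congr_of_eventuallyEq ?_
  filter_upwards [hswap.contDiffAt.eventually_apply_implicitFunction (by simp) hinv] with q hq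
  exact ((hm _ q).1 (hq.trans ((hm _ q₀).2 rfl))).symm

lemma exists_contDiff_equiv_of_pd_ne_zero {y : ℝ × X → ℝ} (hy : ContDiff ℝ ∞ y)
    (hd : ∀ p, pd y p ≠ 0) (hsurj : ∀ q, Function.Surjective fun x => y (x, q)) :
    ∃ Θ : ℝ × X ≃ ℝ × X, ContDiff ℝ ∞ Θ ∧ ContDiff ℝ ∞ Θ.symm ∧ ∀ p, Θ p = (y p, p.2) := by
  have hdiff : Differentiable ℝ y := hy.differentiable (by simp)
  have hinj : ∀ q, Function.Injective fun x => y (x, q) := fun q => by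
    refine Function.Injective.of_lt_imp_ne fun a b hab heq => ?_
    have hcont : Continuous fun x => y (x, q) := hy.continuous.comp (Continuous.prodMk_left q)
    obtain ⟨z, -, hz⟩ := exists_hasDerivAt_eq_zero hab hcont.continuousOn heq
      fun z _ => hasDerivAt_pd hdiff z q
    exact hd _ hz
  have hbij : Function.Bijective fun p : ℝ × X => (y p, p.2) := by
    refine ⟨?_, fun ⟨v, q⟩ => ?_⟩
    · rintro ⟨x, q⟩ ⟨x', q'⟩ h
      obtain ⟨hxx, rfl : q = q'⟩ := Prod.ext_iff.1 h
      rw [hinj q hxx]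
    · obtain ⟨x, hx⟩ := hsurj q v
      exact ⟨(x, q), Prod.ext hx rfl⟩
  have hΘ : ContDiff ℝ ∞ fun p : ℝ × X => (y p, p.2) := hy.prodMk contDiff_snd
  exact ⟨Equiv.ofBijective _ hbij, hΘ, contDiff_symm_of_invertible_fderiv le_top _ hΘ
    fun p => exists_equiv_hasFDerivAt_of_pd_ne_zero (hdiff p) (hd p), fun _ => rfl⟩

end Partial

/-! ### Families of functions of one variable with one nondegenerate minimum -/

lemma pos_of_forall_zero_deriv_pos {ψ ψ' : ℝ → ℝ} (hd : ∀ x, HasDerivAt ψ (ψ' x) x)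
    (hpos : ∀ x, ψ x = 0 → 0 < ψ' x) {x₀ x : ℝ} (h0 : ψ x₀ = 0) (hx : x₀ < x) : 0 < ψ x := by
  by_contra! hneg
  obtain ⟨z, -, hz0, hz⟩ := exists_zero_deriv_nonpos hx (fun y _ => hd y) h0.ge hneg
  exact (hpos z hz0).not_ge hz

lemma neg_of_forall_zero_deriv_pos {ψ ψ' : ℝ → ℝ} (hd : ∀ x, HasDerivAt ψ (ψ' x) x)
    (hpos : ∀ x, ψ x = 0 → 0 < ψ' x) {x₀ x : ℝ} (h0 : ψ x₀ = 0) (hx : x < x₀) : ψ x < 0 := by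
  by_contra! hneg
  obtain ⟨z, -, hz0, hz⟩ := exists_zero_deriv_nonpos hx (fun y _ => hd y) hneg h0.le
  exact (hpos z hz0).not_ge hz

lemma lt_of_forall_second_deriv_pos {φ φ' φ'' : ℝ → ℝ} (hd : ∀ x, HasDerivAt φ (φ' x) x)
    (hd' : ∀ x, HasDerivAt φ' (φ'' x) x) (hpos : ∀ x, φ' x = 0 → 0 < φ'' x) {x₀ x : ℝ}
    (h0 : φ' x₀ = 0) (hx : x ≠ x₀) : φ x₀ < φ x := by
  have hcont : Continuous φ := continuous_iff_continuousAt.2 fun y => (hd y).continuousAt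
  rcases hx.lt_or_gt with hx | hx
  · refine strictAntiOn_of_deriv_neg (convex_Iic x₀) hcont.continuousOn (fun y hy => ?_) hx.le
      self_mem_Iic hx
    rw [interior_Iic] at hy
    rw [(hd y).deriv]
    exact neg_of_forall_zero_deriv_pos hd' hpos h0 hy
  · refine strictMonoOn_of_deriv_pos (convex_Ici x₀) hcont.continuousOn (fun y hy => ?_)
      self_mem_Ici hx.le hx
    rw [interior_Ici] at hy
    rw [(hd y).deriv]
    exact pos_of_forall_zero_deriv_pos hd' hpos h0 hy

/-- A smooth family `x ↦ c (x, q)` of functions of one real variable, each tending to infinity at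
both ends and with one critical point `m q`, where the second derivative is positive. -/
structure IsParabolicFamily {X : Type*} [NormedAddCommGroup X] [NormedSpace ℝ X] (c : ℝ × X → ℝ)
    (m : X → ℝ) : Prop where
  contDiff : ContDiff ℝ ∞ c
  pd_eq_zero_iff : ∀ x q, pd c (x, q) = 0 ↔ x = m q
  pd_pd_pos : ∀ q, 0 < pd (pd c) (m q, q)
  tendsto_atTop : ∀ q, Filter.Tendsto (fun x => c (x, q)) Filter.atTop Filter.atTop
  tendsto_atBot : ∀ q, Filter.Tendsto (fun x => c (x, q)) Filter.atBot Filter.atTop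

/-- The second order Taylor quotient of `c` along the constants, in integral form:
`c (x, q) = c (m q, q) + (x - m q) * pd c (m q, q) + (x - m q) ^ 2 * taylorQuotient c m (x, q)`. -/
def taylorQuotient {X : Type*} [NormedAddCommGroup X] [NormedSpace ℝ X] (c : ℝ × X → ℝ)
    (m : X → ℝ) (p : ℝ × X) : ℝ :=
  ∫ t in (0 : ℝ)..1, (1 - t) * pd (pd c) (m p.2 + t * (p.1 - m p.2), p.2)

/-- The signed square root of `c - c (m q, q)`, written so that its smoothness at `x = m q` is
visible. -/
def sqrtCoord {X : Type*} [NormedAddCommGroup X] [NormedSpace ℝ X] (c : ℝ × X → ℝ) (m : X → ℝ)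
    (p : ℝ × X) : ℝ :=
  (p.1 - m p.2) * √(taylorQuotient c m p)

section Taylor

variable {X : Type*} [NormedAddCommGroup X] [NormedSpace ℝ X] {c : ℝ × X → ℝ}

lemma taylorQuotient_self (c : ℝ × X → ℝ) (m : X → ℝ) (q : X) :
    taylorQuotient c m (m q, q) = 1 / 2 * pd (pd c) (m q, q) := by
  have hint : ∫ t in (0 : ℝ)..1, (1 - t) = 1 / 2 := by
    rw [intervalIntegral.integral_sub intervalIntegrable_const
      intervalIntegral.intervalIntegrable_id]
    norm_num
  simp only [taylorQuotient, sub_self, mul_zero, add_zero]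
  rw [intervalIntegral.integral_mul_const, hint]

lemma eq_add_sq_mul_taylorQuotient (hc : ContDiff ℝ ∞ c) (m : X → ℝ) (x : ℝ) (q : X) :
    c (x, q) = c (m q, q) + (x - m q) * pd c (m q, q) +
      (x - m q) ^ 2 * taylorQuotient c m (x, q) := by
  have hline : ∀ t : ℝ, HasDerivAt (fun t : ℝ => m q + t * (x - m q)) (x - m q) t := fun t => by
    simpa using ((hasDerivAt_id t).mul_const (x - m q)).const_add (m q)
  have hderiv : ∀ t : ℝ, HasDerivAt (fun t : ℝ => c (m q + t * (x - m q), q) +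
      (1 - t) * ((x - m q) * pd c (m q + t * (x - m q), q)))
      ((x - m q) ^ 2 * ((1 - t) * pd (pd c) (m q + t * (x - m q), q))) t := fun t => by
    have hcline := (hasDerivAt_pd (hc.differentiable (by simp)) _ q).comp t (hline t)
    have hpdline := (hasDerivAt_pd ((contDiff_pd hc).differentiable (by simp)) _ q).comp t (hline t)
    refine (hcline.add (((hasDerivAt_id t).const_sub 1).mul
      (hpdline.const_mul (x - m q)))).congr_deriv ?_
    simp only [Function.comp_apply, id]
    ring
  have hcont : Continuous fun t : ℝ =>
      (x - m q) ^ 2 * ((1 - t) * pd (pd c) (m q + t * (x - m q), q)) := by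
    have := (contDiff_pd (contDiff_pd hc)).continuous
    fun_prop
  have hFTC := intervalIntegral.integral_eq_sub_of_hasDerivAt (a := 0) (b := 1)
    (fun t _ => hderiv t) (hcont.intervalIntegrable 0 1)
  simp only [intervalIntegral.integral_const_mul, one_mul, sub_self, zero_mul, add_zero, sub_zero,
    add_sub_cancel] at hFTC
  rw [taylorQuotient, hFTC]
  ring

end Taylor

namespace IsParabolicFamily

variable {X : Type} [NormedAddCommGroup X] [NormedSpace ℝ X] [CompleteSpace X] {c : ℝ × X → ℝ}
  {m : X → ℝ}

lemma contDiff_min (h : IsParabolicFamily c m) : ContDiff ℝ ∞ m :=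
  contDiff_of_unique_zero (contDiff_pd h.contDiff) h.pd_eq_zero_iff fun q => (h.pd_pd_pos q).ne'

omit [CompleteSpace X] in
lemma sq_mul_taylorQuotient (h : IsParabolicFamily c m) (x : ℝ) (q : X) :
    (x - m q) ^ 2 * taylorQuotient c m (x, q) = c (x, q) - c (m q, q) := by
  rw [eq_add_sq_mul_taylorQuotient h.contDiff m x q, (h.pd_eq_zero_iff _ _).2 rfl]
  ring

omit [CompleteSpace X] in
lemma taylorQuotient_pos (h : IsParabolicFamily c m) : ∀ p, 0 < taylorQuotient c m p := by
  rintro ⟨x, q⟩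
  rcases eq_or_ne x (m q) with rfl | hx
  · rw [taylorQuotient_self]
    exact mul_pos one_half_pos (h.pd_pd_pos q)
  · refine pos_of_mul_pos_right ?_ (sq_nonneg (x - m q))
    rw [h.sq_mul_taylorQuotient, sub_pos]
    exact lt_of_forall_second_deriv_pos
      (fun x => hasDerivAt_pd (h.contDiff.differentiable (by simp)) x q)
      (fun x => hasDerivAt_pd ((contDiff_pd h.contDiff).differentiable (by simp)) x q)
      (fun x hx => (h.pd_eq_zero_iff x q).1 hx ▸ h.pd_pd_pos q) ((h.pd_eq_zero_iff _ q).2 rfl) hx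

lemma contDiff_sqrt_taylorQuotient (h : IsParabolicFamily c m) :
    ContDiff ℝ ∞ fun p => √(taylorQuotient c m p) := by
  refine ContDiff.sqrt ?_ fun p => (h.taylorQuotient_pos p).ne'
  refine contDiff_integral_of_contDiff (E := ℝ × X) (H := fun z : (ℝ × X) × ℝ =>
    (1 - z.2) * pd (pd c) (m z.1.2 + z.2 * (z.1.1 - m z.1.2), z.1.2)) ?_
  have hm := h.contDiff_min
  have hpd := contDiff_pd (contDiff_pd h.contDiff)
  fun_prop

lemma contDiff_sqrtCoord (h : IsParabolicFamily c m) : ContDiff ℝ ∞ (sqrtCoord c m) :=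
  (contDiff_fst.sub (h.contDiff_min.comp contDiff_snd)).mul h.contDiff_sqrt_taylorQuotient

omit [CompleteSpace X] in
lemma sqrtCoord_sq (h : IsParabolicFamily c m) (x : ℝ) (q : X) :
    sqrtCoord c m (x, q) ^ 2 = c (x, q) - c (m q, q) := by
  rw [sqrtCoord, mul_pow, Real.sq_sqrt (h.taylorQuotient_pos _).le, h.sq_mul_taylorQuotient]

lemma pd_sqrtCoord_ne_zero (h : IsParabolicFamily c m) : ∀ p, pd (sqrtCoord c m) p ≠ 0 := by
  rintro ⟨x, q⟩
  have hy := hasDerivAt_pd (h.contDiff_sqrtCoord.differentiable (by simp)) x q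
  by_cases hx : x = m q
  · have hsqrt : HasDerivAt (fun x => √(taylorQuotient c m (x, q))) _ x :=
      hasDerivAt_pd (h.contDiff_sqrt_taylorQuotient.differentiable (by simp)) x q
    rw [hy.unique (((hasDerivAt_id x).sub_const (m q)).mul hsqrt), id, hx, sub_self, zero_mul,
      add_zero, one_mul]
    exact (Real.sqrt_pos.2 (h.taylorQuotient_pos _)).ne'
  · have hc := (hasDerivAt_pd (h.contDiff.differentiable (by simp)) x q).sub_const (c (m q, q))
    have hsq : HasDerivAt (fun x => sqrtCoord c m (x, q) ^ 2) _ x := hy.pow 2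
    simp only [h.sqrtCoord_sq] at hsq
    intro hzero
    rw [hzero, mul_zero] at hsq
    exact hx ((h.pd_eq_zero_iff x q).1 (hc.unique hsq))

lemma surjective_sqrtCoord (h : IsParabolicFamily c m) (q : X) :
    Function.Surjective fun x => sqrtCoord c m (x, q) := by
  have habs : ∀ x, √(c (x, q) - c (m q, q)) = |sqrtCoord c m (x, q)| := fun x => by
    rw [← h.sqrtCoord_sq, Real.sqrt_sq_eq_abs]
  have hsqrt := Real.tendsto_sqrt_atTop.comp
    (Filter.tendsto_atTop_add_const_right Filter.atTop (-c (m q, q)) Filter.tendsto_id)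
  refine (h.contDiff_sqrtCoord.continuous.comp (Continuous.prodMk_left q)).surjective ?_ ?_
  · refine (hsqrt.comp (h.tendsto_atTop q)).congr' ?_
    filter_upwards [Filter.eventually_ge_atTop (m q)] with x hx
    exact (habs x).trans (abs_of_nonneg (mul_nonneg (sub_nonneg.2 hx) (Real.sqrt_nonneg _)))
  · refine (Filter.tendsto_neg_atTop_atBot.comp (hsqrt.comp (h.tendsto_atBot q))).congr' ?_
    filter_upwards [Filter.eventually_le_atBot (m q)] with x hx
    exact neg_eq_iff_eq_neg.2 ((habs x).trans (abs_of_nonpos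
      (mul_nonpos_of_nonpos_of_nonneg (sub_nonpos.2 hx) (Real.sqrt_nonneg _))))

lemma exists_square_coordinates (h : IsParabolicFamily c m) :
    ∃ Θ : ℝ × X ≃ ℝ × X, ContDiff ℝ ∞ Θ ∧ ContDiff ℝ ∞ Θ.symm ∧
      ∀ x q, (Θ (x, q)).2 = q ∧ (Θ (x, q)).1 ^ 2 = c (x, q) - c (m q, q) := by
  obtain ⟨Θ, hΘ, hΘs, hΘ_apply⟩ := exists_contDiff_equiv_of_pd_ne_zero h.contDiff_sqrtCoord
    h.pd_sqrtCoord_ne_zero h.surjective_sqrtCoord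
  exact ⟨Θ, hΘ, hΘs, fun x q => by simp only [hΘ_apply, h.sqrtCoord_sq, and_self]⟩

end IsParabolicFamily

/-- Global smooth coordinates in which `G` becomes the family `(x, q) ↦ (c (x, q), q)`. The
coordinates of the target are taken to be linear. -/
structure FamilyCoordinates {E F X : Type*} [NormedAddCommGroup E] [NormedSpace ℝ E]
    [NormedAddCommGroup F] [NormedSpace ℝ F] [NormedAddCommGroup X] [NormedSpace ℝ X]
    (G : E → F) (c : ℝ × X → ℝ) where
  source : E ≃ ℝ × X
  contDiff_source : ContDiff ℝ ∞ source
  contDiff_source_symm : ContDiff ℝ ∞ source.symm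
  target : F ≃L[ℝ] ℝ × X
  target_apply : ∀ p, target (G (source.symm p)) = (c p, p.2)

namespace FamilyCoordinates

section Neg

variable {E F X : Type*} [NormedAddCommGroup E] [NormedSpace ℝ E] [NormedAddCommGroup F]
  [NormedSpace ℝ F] [NormedAddCommGroup X] [NormedSpace ℝ X] {G : E → F} {c : ℝ × X → ℝ}

lemma apply_source_symm (φ : FamilyCoordinates G c) (p : ℝ × X) :
    G (φ.source.symm p) = φ.target.symm (c p, p.2) :=
  φ.target.eq_symm_apply.2 (φ.target_apply p)

/-- The coordinates obtained by changing the sign of the real coordinate of the target. -/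
def neg (φ : FamilyCoordinates G c) : FamilyCoordinates G (-c) where
  source := φ.source
  contDiff_source := φ.contDiff_source
  contDiff_source_symm := φ.contDiff_source_symm
  target := φ.target.trans ((ContinuousLinearEquiv.neg ℝ).prodCongr (.refl ℝ X))
  target_apply p := by simp [φ.target_apply]

end Neg

lemma isGlobalFold {E F X : Type} [NormedAddCommGroup E] [NormedSpace ℝ E]
    [NormedAddCommGroup F] [NormedSpace ℝ F] [NormedAddCommGroup X] [NormedSpace ℝ X]
    [CompleteSpace X] {G : E → F} {c : ℝ × X → ℝ} {m : X → ℝ} (φ : FamilyCoordinates G c)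
    (h : IsParabolicFamily c m) : IsGlobalFold X G := by
  obtain ⟨Θ, hΘ, hΘs, hΘ_apply⟩ := h.exists_square_coordinates
  have hcm : ContDiff ℝ ∞ fun p : ℝ × X => c (m p.2, p.2) :=
    h.contDiff.comp ((h.contDiff_min.comp contDiff_snd).prodMk contDiff_snd)
  let τ : ℝ × X ≃ ℝ × X :=
    { toFun := fun p => (p.1 - c (m p.2, p.2), p.2)
      invFun := fun p => (p.1 + c (m p.2, p.2), p.2)
      left_inv := fun p => by simp
      right_inv := fun p => by simp }
  have hτ : ContDiff ℝ ∞ τ := (contDiff_fst.sub hcm).prodMk contDiff_snd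
  have hτs : ContDiff ℝ ∞ τ.symm := (contDiff_fst.add hcm).prodMk contDiff_snd
  refine ⟨φ.source.trans Θ, φ.target.toEquiv.trans τ, hΘ.comp φ.contDiff_source,
    φ.contDiff_source_symm.comp hΘs, hτ.comp φ.target.contDiff,
    φ.target.symm.contDiff.comp hτs, fun x v => ?_⟩
  obtain ⟨⟨y, q⟩, hy⟩ := Θ.surjective (x, v)
  obtain ⟨hq, hsq⟩ := hΘ_apply y q
  obtain rfl : v = q := by rw [← hq, hy]
  rw [hy] at hsq
  calc τ (φ.target (G (φ.source.symm (Θ.symm (x, v)))))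
    _ = τ (c (y, v), v) := by rw [← hy, Θ.symm_apply_apply, φ.target_apply]
    _ = (x ^ 2, v) := Prod.ext hsq.symm rfl

end FamilyCoordinates

/-! ### Nondegeneracy of folds -/

section Folds

open Asymptotics Filter Topology

lemma sub_sub_isLittleO_sq {ν ν' : ℝ → ℝ} {A b : ℝ} (hd : ∀ᶠ y in 𝓝 b, HasDerivAt ν (ν' y) y)
    (h0 : ν' b = 0) (hA : HasDerivAt ν' A b) :
    (fun y => ν y - ν b - A / 2 * (y - b) ^ 2) =o[𝓝 b] fun y => (y - b) ^ 2 := by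
  obtain ⟨r, hr, hball⟩ := Metric.eventually_nhds_iff_ball.1 hd
  have hb : b ∈ Metric.ball b r := Metric.mem_ball_self hr
  have hderiv : ∀ z ∈ Metric.ball b r, HasDerivWithinAt (fun y => ν y - A / 2 * (y - b) ^ 2)
      (ν' z - A * (z - b)) (Metric.ball b r) z := fun z hz => by
    have hsq := (((hasDerivAt_id z).sub_const b).pow 2).const_mul (A / 2)
    refine (((hball z hz).sub hsq).congr_deriv ?_).hasDerivWithinAt
    simp only [id, Nat.cast_ofNat]
    ring
  have hderiv_o : (fun z => ν' z - A * (z - b)) =o[𝓝[Metric.ball b r] b] fun z => (z - b) ^ 1 := by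
    refine (hasDerivAt_iff_isLittleO.1 hA).mono nhdsWithin_le_nhds |>.congr (fun z => ?_)
      fun z => (pow_one _).symm
    rw [h0, sub_zero, smul_eq_mul, mul_comm]
  have ho := (convex_ball b r).isLittleO_pow_succ_real hb hderiv hderiv_o
  rw [Metric.isOpen_ball.nhdsWithin_eq hb] at ho
  exact ho.congr_left fun y => by ring

lemma eq_zero_of_isLittleO_sq {E : Type*} [NormedAddCommGroup E] [NormedSpace ℝ E] {g : ℝ → E}
    {g' : E} {x₀ : ℝ} (hg : HasDerivAt g g' x₀)
    (ho : (fun x => g x - g x₀) =o[𝓝 x₀] fun x => (x - x₀) ^ 2) : g' = 0 := by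
  have hsq : (fun x : ℝ => (x - x₀) ^ 2) =o[𝓝 x₀] fun x => x - x₀ := by
    simpa only [Real.norm_eq_abs, sq_abs] using isLittleO_pow_sub_sub x₀ one_lt_two
  refine hg.unique (hasDerivAt_iff_isLittleO.2 ((ho.trans hsq).congr_left fun x => ?_))
  rw [smul_zero, sub_zero]

lemma eq_zero_of_isLittleO_sq_of_nondegenerate {ν : ℝ → ℝ} {r : ℝ → ℝ} {r' x₀ : ℝ}
    (hν : ContDiffAt ℝ 2 ν (r x₀)) (hd1 : deriv ν (r x₀) = 0) (hd2 : iteratedDeriv 2 ν (r x₀) ≠ 0)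
    (hr : HasDerivAt r r' x₀)
    (ho : (fun x => ν (r x) - ν (r x₀)) =o[𝓝 x₀] fun x => (x - x₀) ^ 2) : r' = 0 := by
  have hν1 : ∀ᶠ y in 𝓝 (r x₀), HasDerivAt ν (deriv ν y) y :=
    ((hν.of_le one_le_two).eventually (by simp)).mono fun y hy =>
      (hy.differentiableAt one_ne_zero).hasDerivAt
  have hν2 : HasDerivAt (deriv ν) (iteratedDeriv 2 ν (r x₀)) (r x₀) := by
    rw [iteratedDeriv_succ, iteratedDeriv_one]
    exact ((hν.derivWithin (m := 1) one_add_one_eq_two.le).differentiableAt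
      one_ne_zero).hasDerivAt
  have htaylor := ((sub_sub_isLittleO_sq hν1 hd1 hν2).comp_tendsto
    hr.continuousAt.tendsto).trans_isBigO (hr.isBigO_sub.pow 2)
  have hsq : (fun x => iteratedDeriv 2 ν (r x₀) / 2 * (r x - r x₀) ^ 2) =o[𝓝 x₀]
      fun x => (x - x₀) ^ 2 :=
    (ho.sub htaylor).congr_left fun x => sub_sub_cancel _ _
  have hlin : (fun x => r x - r x₀) =o[𝓝 x₀] fun x => x - x₀ :=
    ((isLittleO_const_mul_left_iff (div_ne_zero hd2 two_ne_zero)).1 hsq).of_pow two_ne_zero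
  exact hr.unique (hasDerivAt_iff_isLittleO.2 (hlin.congr_left fun x => by
    rw [smul_zero, sub_zero]))

lemma eq_zero_of_isLittleO_sq_normalForm {X : Type*} [NormedAddCommGroup X] [NormedSpace ℝ X]
    {μ : X × ℝ → ℝ} {p : ℝ → X × ℝ} {p' : X × ℝ} {x₀ : ℝ} (hμ : ContDiffAt ℝ 2 μ (p x₀))
    (hd1 : deriv (fun y => μ ((p x₀).1, y)) (p x₀).2 = 0)
    (hd2 : iteratedDeriv 2 (fun y => μ ((p x₀).1, y)) (p x₀).2 ≠ 0) (hp : HasDerivAt p p' x₀)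
    (ho : (fun x => ((p x).1, μ (p x)) - ((p x₀).1, μ (p x₀))) =o[𝓝 x₀]
      fun x => (x - x₀) ^ 2) : p' = 0 := by
  have hp_fst : HasDerivAt (fun x => (p x).1) p'.1 x₀ :=
    (hasFDerivAt_fst (𝕜 := ℝ) (p := p x₀)).comp_hasDerivAt x₀ hp
  have hp_snd : HasDerivAt (fun x => (p x).2) p'.2 x₀ :=
    (hasFDerivAt_snd (𝕜 := ℝ) (p := p x₀)).comp_hasDerivAt x₀ hp
  have ho_fst : (fun x => (p x).1 - (p x₀).1) =o[𝓝 x₀] fun x => (x - x₀) ^ 2 :=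
    isBigO_fst_prod.trans_isLittleO ho
  have ho_snd : (fun x => μ (p x) - μ (p x₀)) =o[𝓝 x₀] fun x => (x - x₀) ^ 2 :=
    isBigO_snd_prod.trans_isLittleO ho
  -- The first coordinate is constant to the second order, so it may be frozen in `μ`.
  have ho_freeze : (fun x => μ (p x) - μ ((p x₀).1, (p x).2)) =o[𝓝 x₀]
      fun x => (x - x₀) ^ 2 := by
    obtain ⟨K, t, ht, hK⟩ := (hμ.of_le one_le_two).exists_lipschitzOnWith
    have hfrozen : Tendsto (fun x => ((p x₀).1, (p x).2)) (𝓝 x₀) (𝓝 (p x₀)) :=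
      tendsto_const_nhds.prodMk_nhds hp_snd.continuousAt.tendsto
    refine IsBigO.trans_isLittleO (IsBigO.of_bound K ?_) ho_fst
    filter_upwards [hp.continuousAt.eventually ht, hfrozen.eventually ht] with x hx hx'
    refine (hK.norm_sub_le hx hx').trans_eq ?_
    simp [Prod.norm_def]
  have hν : ContDiffAt ℝ 2 (fun y => μ ((p x₀).1, y)) (p x₀).2 :=
    ContDiffAt.comp (p x₀).2 (f := fun y : ℝ => ((p x₀).1, y)) (g := μ) hμ
      (contDiffAt_const.prodMk contDiffAt_id)
  exact Prod.ext (eq_zero_of_isLittleO_sq hp_fst ho_fst)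
    (eq_zero_of_isLittleO_sq_of_nondegenerate hν hd1 hd2 hp_snd
      ((ho_snd.sub ho_freeze).congr_left fun x => sub_sub_sub_cancel_left _ _ _))

lemma IsFold.not_isLittleO {E F : Type} [NormedAddCommGroup E] [NormedSpace ℝ E]
    [NormedAddCommGroup F] [NormedSpace ℝ F] {G : E → F} {γ : ℝ → E} {γ' : E} {x₀ : ℝ}
    (hG : IsFold G (γ x₀)) (hγ : HasDerivAt γ γ' x₀) (hne : γ' ≠ 0) :
    ¬ (fun x => G (γ x) - G (γ x₀)) =o[𝓝 x₀] fun x => (x - x₀) ^ 2 := by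
  intro ho
  obtain ⟨X, _, _, _, α, β, μ, hu, hmaps, hα, hαs, hβ, -, hμ, hform, hd1, hd2⟩ := hG
  have hαu : α (γ x₀) ∈ α.target := α.map_source hu
  have hαd : HasFDerivAt α (fderiv ℝ α (γ x₀)) (γ x₀) :=
    ((hα.contDiffAt (α.open_source.mem_nhds hu)).differentiableAt (by simp)).hasFDerivAt
  have hαsd : HasFDerivAt α.symm (fderiv ℝ α.symm (α (γ x₀))) (α (γ x₀)) :=
    ((hαs.contDiffAt (α.open_target.mem_nhds hαu)).differentiableAt (by simp)).hasFDerivAt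
  have hβd : HasFDerivAt β (fderiv ℝ β (G (γ x₀))) (G (γ x₀)) :=
    ((hβ.contDiffAt (β.open_source.mem_nhds (hmaps hu))).differentiableAt (by simp)).hasFDerivAt
  have hγ_source : ∀ᶠ x in 𝓝 x₀, γ x ∈ α.source :=
    hγ.continuousAt.eventually (α.open_source.mem_nhds hu)
  have hαγ : HasDerivAt (fun x => α (γ x)) (fderiv ℝ α (γ x₀) γ') x₀ := hαd.comp_hasDerivAt x₀ hγ
  have hGγ : Tendsto (fun x => G (γ x)) (𝓝 x₀) (𝓝 (G (γ x₀))) := by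
    refine tendsto_sub_nhds_zero_iff.1 ((isLittleO_one_iff ℝ).1 (ho.trans_isBigO ?_))
    have hcont : ContinuousAt (fun x : ℝ => (x - x₀) ^ 2) x₀ := by fun_prop
    exact hcont.tendsto.isBigO_one ℝ
  have hβG : ∀ᶠ x in 𝓝 x₀, β (G (γ x)) = ((α (γ x)).1, μ (α (γ x))) :=
    hγ_source.mono fun x hx => by rw [← hform _ (α.map_source hx), α.left_inv hx]
  have ho_form : (fun x => ((α (γ x)).1, μ (α (γ x))) - ((α (γ x₀)).1, μ (α (γ x₀)))) =o[𝓝 x₀]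
      fun x => (x - x₀) ^ 2 := ((hβd.isBigO_sub.comp_tendsto hGγ).trans_isLittleO ho).congr'
    (hβG.mono fun x hx => congrArg₂ (· - ·) hx hβG.self_of_nhds) EventuallyEq.rfl
  have hμ2 : ContDiffAt ℝ 2 μ (α (γ x₀)) :=
    (hμ.contDiffAt (α.open_target.mem_nhds hαu)).of_le ENat.LEInfty.out
  have hzero : fderiv ℝ α (γ x₀) γ' = 0 :=
    eq_zero_of_isLittleO_sq_normalForm (p := fun x => α (γ x)) hμ2 hd1 hd2 hαγ ho_form
  have hγ_eq : HasDerivAt γ (fderiv ℝ α.symm (α (γ x₀)) (fderiv ℝ α (γ x₀) γ')) x₀ :=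
    (hαsd.comp_hasDerivAt x₀ hαγ).congr_of_eventuallyEq
      (hγ_source.mono fun x hx => (α.left_inv hx).symm)
  exact hne (by rw [hγ.unique hγ_eq, hzero, map_zero])

end Folds

section CriticalPoints

open Asymptotics Filter Topology

lemma exists_equiv_hasFDerivAt {E F : Type*} [NormedAddCommGroup E] [NormedSpace ℝ E]
    [NormedAddCommGroup F] [NormedSpace ℝ F] (e : E ≃ F) (he : Differentiable ℝ e)
    (hes : Differentiable ℝ e.symm) (u : E) :
    ∃ T : E ≃L[ℝ] F, HasFDerivAt e (T : E →L[ℝ] F) u := by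
  have hd := (he u).hasFDerivAt
  have hds := (hes (e u)).hasFDerivAt
  have hleft : (fderiv ℝ e.symm (e u)).comp (fderiv ℝ e u) = .id ℝ E := by
    refine (hds.comp u hd).unique ?_
    simpa only [e.symm_comp_self] using hasFDerivAt_id u
  have hright : (fderiv ℝ e u).comp (fderiv ℝ e.symm (e u)) = .id ℝ F := by
    refine (HasFDerivAt.comp (e u) (by rwa [e.symm_apply_apply]) hds).unique ?_
    simpa only [e.self_comp_symm] using hasFDerivAt_id (e u)
  exact ⟨.equivOfInverse _ _ (DFunLike.congr_fun hleft) (DFunLike.congr_fun hright), hd⟩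

lemma surjective_prod_snd_iff {X : Type*} [NormedAddCommGroup X] [NormedSpace ℝ X]
    {L : ℝ × X →L[ℝ] ℝ} : Function.Surjective (L.prod (.snd ℝ ℝ X)) ↔ L (1, 0) ≠ 0 := by
  have hL : ∀ x q, L (x, q) = x * L (1, 0) + L (0, q) := fun x q => by
    rw [← smul_eq_mul, ← map_smul, ← map_add]
    simp
  constructor
  · intro h h0
    obtain ⟨⟨x, q⟩, hxq⟩ := h (1, 0)
    obtain ⟨hx, rfl : q = 0⟩ := Prod.ext_iff.1 hxq
    have hx1 : L (x, 0) = 1 := hx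
    rw [hL, h0, mul_zero, zero_add, ← Prod.zero_eq_mk, map_zero] at hx1
    exact zero_ne_one hx1
  · rintro h ⟨y, q⟩
    refine ⟨((y - L (0, q)) / L (1, 0), q), Prod.ext ?_ rfl⟩
    change L _ = y
    rw [hL, div_mul_cancel₀ _ h, sub_add_cancel]

namespace FamilyCoordinates

variable {E F X : Type} [NormedAddCommGroup E] [NormedSpace ℝ E] [NormedAddCommGroup F]
  [NormedSpace ℝ F] [NormedAddCommGroup X] [NormedSpace ℝ X] {G : E → F} {c : ℝ × X → ℝ}

lemma isCriticalPoint_iff (φ : FamilyCoordinates G c) {p : ℝ × X} (hc : DifferentiableAt ℝ c p) :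
    IsCriticalPoint G (φ.source.symm p) ↔ pd c p = 0 := by
  obtain ⟨T, hT⟩ := exists_equiv_hasFDerivAt φ.source (φ.contDiff_source.differentiable (by simp))
    (φ.contDiff_source_symm.differentiable (by simp)) (φ.source.symm p)
  have hform : HasFDerivAt (fun p : ℝ × X => (c p, p.2)) ((fderiv ℝ c p).prod (.snd ℝ ℝ X))
      (φ.source (φ.source.symm p)) := by
    rw [φ.source.apply_symm_apply]
    exact hc.hasFDerivAt.prodMk hasFDerivAt_snd
  have hG : G = φ.target.symm ∘ (fun p : ℝ × X => (c p, p.2)) ∘ φ.source := funext fun u => by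
    simpa using φ.apply_source_symm (φ.source u)
  have hGd := φ.target.symm.hasFDerivAt.comp _ (hform.comp _ hT)
  rw [← hG] at hGd
  rw [IsCriticalPoint, hGd.fderiv, not_iff_comm, pd, ← ne_eq, ← surjective_prod_snd_iff]
  change _ ↔ Function.Surjective (φ.target.symm ∘ ((fderiv ℝ c p).prod (.snd ℝ ℝ X)) ∘ T)
  rw [Function.Surjective.of_comp_iff' φ.target.symm.bijective, T.surjective.of_comp_iff]

lemma pd_pd_ne_zero (φ : FamilyCoordinates G c) (hc : ContDiff ℝ ∞ c) {p : ℝ × X}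
    (hfold : IsFold G (φ.source.symm p)) (h0 : pd c p = 0) : pd (pd c) p ≠ 0 := by
  obtain ⟨x, q⟩ := p
  intro h2
  obtain ⟨T, hT⟩ := exists_equiv_hasFDerivAt φ.source.symm
    (φ.contDiff_source_symm.differentiable (by simp))
    (φ.contDiff_source.differentiable (by simp)) (x, q)
  have hγ : HasDerivAt (fun y : ℝ => φ.source.symm (y, q)) (T (1, 0)) x :=
    hT.comp_hasDerivAt (f := fun y : ℝ => (y, q)) x
      ((hasDerivAt_id' x).prodMk (hasDerivAt_const x q))
  refine IsFold.not_isLittleO hfold hγ (T.map_ne_zero_iff.2 (by simp)) ?_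
  have hc_o : (fun y => c (y, q) - c (x, q)) =o[𝓝 x] fun y => (y - x) ^ 2 := by
    have htaylor := sub_sub_isLittleO_sq (Eventually.of_forall fun y =>
      hasDerivAt_pd (hc.differentiable (by simp)) y q) h0
      (hasDerivAt_pd ((contDiff_pd hc).differentiable (by simp)) x q)
    simpa only [h2, zero_div, zero_mul, sub_zero] using htaylor
  have hG : ∀ y, G (φ.source.symm (y, q)) - G (φ.source.symm (x, q)) =
      φ.target.symm (c (y, q) - c (x, q), 0) := fun y => by
    rw [φ.apply_source_symm, φ.apply_source_symm, ← map_sub, Prod.mk_sub_mk, sub_self]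
  simp only [hG]
  exact ((φ.target.symm : ℝ × X →L[ℝ] F).isBigO_comp _ _).trans_isLittleO
    (hc_o.prod_left (isLittleO_zero _ _))

end FamilyCoordinates

end CriticalPoints

/-! ### Continuously differentiable functions -/

/-- The algebra of the functions on the circle whose lift to the line is continuously
differentiable. -/
def C1Subalgebra : Subalgebra ℝ C0 where
  carrier := {u | ∃ u' : C0, ∀ s : ℝ, HasDerivAt (fun r : ℝ => u (r : UnitAddCircle)) (u' s) s}
  add_mem' := fun ⟨u', hu⟩ ⟨v', hv⟩ => ⟨u' + v', fun s => (hu s).add (hv s)⟩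
  mul_mem' := fun {u v} ⟨u', hu⟩ ⟨v', hv⟩ => ⟨u' * v + u * v', fun s => (hu s).mul (hv s)⟩
  algebraMap_mem' := fun c => ⟨0, fun s => hasDerivAt_const s c⟩

lemma primC_mem_C1Subalgebra (v : C0) : primC v ∈ C1Subalgebra :=
  ⟨v - meanC v • (1 : C0), fun s => by simpa using hasDerivAt_primC v s⟩

lemma comp_mem_C1Subalgebra {g : C(ℝ, ℝ)} (hg : ContDiff ℝ 1 g) {u : C0} (hu : u ∈ C1Subalgebra) :
    g.comp u ∈ C1Subalgebra := by
  obtain ⟨u', hu'⟩ := hu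
  exact ⟨(⟨deriv g, hg.continuous_deriv le_rfl⟩ : C(ℝ, ℝ)).comp u * u', fun s =>
    (hg.differentiable one_ne_zero _).hasDerivAt.comp s (hu' s)⟩

lemma negExp_mem_C1Subalgebra {u : C0} (hu : u ∈ C1Subalgebra) : negExp u ∈ C1Subalgebra :=
  comp_mem_C1Subalgebra (g := ⟨fun x => Real.exp (-x), by fun_prop⟩)
    (Real.contDiff_exp.comp contDiff_neg) hu

/-! ### Averages of rapidly oscillating functions -/

/-- The rapidly oscillating function `t ↦ q (N t)`. -/
def scale (N : ℕ) (q : C0) : C0 := ⟨fun t => q (N • t), by fun_prop⟩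

lemma scale_mem_C1Subalgebra (N : ℕ) {q : C0} (hq : q ∈ C1Subalgebra) :
    scale N q ∈ C1Subalgebra := by
  obtain ⟨q', hq'⟩ := hq
  refine ⟨(N : ℝ) • scale N q', fun s => ?_⟩
  have hcoe : ∀ (v : C0) (r : ℝ), scale N v (r : UnitAddCircle) = v ((N * r : ℝ)) := fun v r => by
    rw [← nsmul_eq_mul, AddCircle.coe_nsmul]
    rfl
  simp only [hcoe, ContinuousMap.smul_apply, smul_eq_mul]
  have hd := (hq' (N * s)).comp s ((hasDerivAt_id s).const_mul (N : ℝ))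
  exact hd.congr_deriv (by rw [mul_one, mul_comm])

lemma meanC_scale {N : ℕ} (hN : N ≠ 0) (q : C0) : meanC (scale N q) = meanC q := by
  have hpres : MeasurePreserving (fun t : UnitAddCircle => N • t) volume volume := by
    simpa only [natCast_zsmul] using
      Measure.measurePreserving_zsmul volume (Int.natCast_ne_zero.2 hN)
  rw [meanC_apply, meanC_apply]
  calc ∫ t, q (N • t) = ∫ t, q t ∂(volume.map fun t : UnitAddCircle => N • t) :=
        (integral_map hpres.aemeasurable q.continuous.aestronglyMeasurable).symm
    _ = ∫ t, q t := by rw [hpres.map_eq]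

/-- The average of the `N` translates of `D` by the multiples of `1 / N`. -/
def translateAverage (N : ℕ) (D : C0) : C0 :=
  (N : ℝ)⁻¹ • ∑ k ∈ Finset.range N, D.comp (.addRight ((k / N : ℝ) : UnitAddCircle))

lemma meanC_scale_mul_translateAverage {N : ℕ} (hN : N ≠ 0) (q D : C0) :
    meanC (scale N q * translateAverage N D) = meanC (scale N q * D) := by
  have hN' : (N : ℝ) ≠ 0 := Nat.cast_ne_zero.2 hN
  have htranslate : ∀ k : ℕ, meanC (scale N q * D.comp (.addRight ((k / N : ℝ) : UnitAddCircle))) =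
      meanC (scale N q * D) := fun k => by
    have hperiod : N • ((k / N : ℝ) : UnitAddCircle) = 0 := by
      rw [← AddCircle.coe_nsmul, nsmul_eq_mul, mul_div_cancel₀ _ hN']
      exact AddCircle.coe_eq_zero_iff 1 |>.2 ⟨k, by simp⟩
    rw [meanC_apply, meanC_apply, ← integral_add_right_eq_self
      (fun t => (scale N q * D) t) ((k / N : ℝ) : UnitAddCircle)]
    refine integral_congr_ae (.of_forall fun t => ?_)
    change q (N • t) * _ = q (N • (t + _)) * _
    rw [nsmul_add, hperiod, add_zero]
    rfl
  rw [translateAverage, mul_smul_comm, Finset.mul_sum, map_smul, map_sum,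
    Finset.sum_congr rfl fun _ _ => htranslate _, Finset.sum_const, Finset.card_range,
    nsmul_eq_mul, smul_eq_mul, inv_mul_cancel_left₀ hN']

lemma meanC_eq_sum_integral (D : C0) {N : ℕ} (hN : N ≠ 0) (t : UnitAddCircle) :
    meanC D = (N : ℝ)⁻¹ * ∑ k ∈ Finset.range N,
      ∫ r in (k : ℝ)..(k + 1 : ℕ), D (t + ((r / N : ℝ) : UnitAddCircle)) := by
  have hcont : Continuous fun r : ℝ => D (t + ((r / N : ℝ) : UnitAddCircle)) := by fun_prop
  rw [intervalIntegral.sum_integral_adjacent_intervals (a := fun k : ℕ => (k : ℝ))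
      fun k _ => hcont.intervalIntegrable _ _, ← smul_eq_mul,
    intervalIntegral.inv_smul_integral_comp_div fun r : ℝ => D (t + (r : UnitAddCircle)),
    Nat.cast_zero, zero_div, div_self (Nat.cast_ne_zero.2 hN),
    intervalIntegral_coe fun s => D (t + s), integral_add_left_eq_self (fun s => D s) t,
    meanC_apply]

lemma exists_abs_translateAverage_sub_meanC_le (D : C0) {η : ℝ} (hη : 0 < η) :
    ∃ N₀ : ℕ, ∀ N > N₀, ∀ t, |translateAverage N D t - meanC D| ≤ η := by
  obtain ⟨δ, hδ, hD⟩ := Metric.uniformContinuous_iff.1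
    (CompactSpace.uniformContinuous_of_continuous D.continuous) η hη
  obtain ⟨N₀, hN₀⟩ := exists_nat_gt (1 / δ)
  refine ⟨N₀, fun N hN t => ?_⟩
  have hNpos : (0 : ℝ) < N := Nat.cast_pos.2 (Nat.zero_lt_of_lt hN)
  have hstep : 1 / (N : ℝ) < δ := one_div_lt hδ hNpos |>.1 (hN₀.trans (Nat.cast_lt.2 hN))
  let W : ℝ → ℝ := fun r => D (t + ((r / N : ℝ) : UnitAddCircle))
  have hWc : Continuous W := by fun_prop
  have hpiece : ∀ k : ℕ, |W k - ∫ r in (k : ℝ)..(k + 1 : ℕ), W r| ≤ η := fun k => by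
    have hosc : ∀ r ∈ uIoc (k : ℝ) (k + 1 : ℕ), ‖W k - W r‖ ≤ η := fun r hr => by
      rw [Nat.cast_succ, uIoc_of_le (by simp)] at hr
      refine (hD (a := t + _) (b := t + _) ?_).le
      rw [dist_add_left, dist_comm, dist_eq_norm, ← AddCircle.coe_sub, ← sub_div]
      refine (QuotientAddGroup.norm_mk_le_norm).trans_lt (lt_of_le_of_lt ?_ hstep)
      rw [Real.norm_of_nonneg (div_nonneg (by linarith [hr.1]) hNpos.le)]
      gcongr
      linarith [hr.2]
    have hint := intervalIntegral.norm_integral_le_of_norm_le_const hosc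
    rw [intervalIntegral.integral_sub intervalIntegrable_const (hWc.intervalIntegrable _ _)] at hint
    simpa using hint
  have hsum : translateAverage N D t - meanC D =
      (N : ℝ)⁻¹ * ∑ k ∈ Finset.range N, (W k - ∫ r in (k : ℝ)..(k + 1 : ℕ), W r) := by
    rw [meanC_eq_sum_integral D (Nat.cast_pos.1 hNpos).ne' t, Finset.sum_sub_distrib, mul_sub]
    simp [translateAverage, W]
  calc |translateAverage N D t - meanC D|
      ≤ (N : ℝ)⁻¹ * ∑ _k ∈ Finset.range N, η := by
        rw [hsum, abs_mul, abs_of_pos (inv_pos.2 hNpos)]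
        gcongr
        exact (Finset.abs_sum_le_sum_abs _ _).trans (Finset.sum_le_sum fun _ _ => hpiece _)
    _ = η := by
        rw [Finset.sum_const, Finset.card_range, nsmul_eq_mul, inv_mul_cancel_left₀ hNpos.ne']

lemma exists_abs_meanC_scale_mul_sub_le (D : C0) {η : ℝ} (hη : 0 < η) :
    ∃ N₀ : ℕ, ∀ N > N₀, ∀ q : C0, (∀ t, |q t| ≤ 1) →
      |meanC (scale N q * D) - meanC q * meanC D| ≤ η := by
  obtain ⟨N₀, hN₀⟩ := exists_abs_translateAverage_sub_meanC_le D hη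
  refine ⟨N₀, fun N hN q hq => ?_⟩
  have hN0 : N ≠ 0 := Nat.ne_zero_of_lt hN
  have herror : meanC (scale N q * D) - meanC q * meanC D =
      meanC (scale N q * (translateAverage N D - meanC D • 1)) := by
    rw [mul_sub, map_sub, meanC_scale_mul_translateAverage hN0, mul_smul_one, map_smul,
      meanC_scale hN0, smul_eq_mul, mul_comm (meanC D)]
  have hbound : ∀ t, |(scale N q * (translateAverage N D - meanC D • 1)) t| ≤ (η • (1 : C0)) t :=
    fun t => by
      have h := mul_le_mul (hq (N • t)) (hN₀ N hN t) (abs_nonneg _) zero_le_one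
      rw [← abs_mul] at h
      simpa [scale] using h
  simpa [herror, meanC_one] using abs_meanC_le_meanC hbound

/-! ### Mixing the constants `0` and `1` -/

/-- The function `t ↦ cos (2 π t)` on the circle. -/
def cosCircle : C0 :=
  ⟨Function.Periodic.lift (f := fun r : ℝ => Real.cos (2 * Real.pi * r)) (c := 1) fun r => by
      simp only [mul_add, mul_one, Real.cos_add_two_pi],
    continuous_coinduced_dom.2 (by
      change Continuous fun r : ℝ => Real.cos (2 * Real.pi * r)
      fun_prop)⟩

lemma cosCircle_coe (r : ℝ) : cosCircle (r : UnitAddCircle) = Real.cos (2 * Real.pi * r) := rfl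

lemma cosCircle_mem_Icc (t : UnitAddCircle) : cosCircle t ∈ Icc (-1 : ℝ) 1 := by
  obtain ⟨r, -, rfl⟩ := exists_coe_eq t
  exact Real.cos_mem_Icc _

lemma cosCircle_mem_C1Subalgebra : cosCircle ∈ C1Subalgebra := by
  let sinCircle : C0 :=
    ⟨Function.Periodic.lift (f := fun r : ℝ => Real.sin (2 * Real.pi * r)) (c := 1) fun r => by
        simp only [mul_add, mul_one, Real.sin_add_two_pi],
      continuous_coinduced_dom.2 (by
        change Continuous fun r : ℝ => Real.sin (2 * Real.pi * r)
        fun_prop)⟩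
  refine ⟨-(2 * Real.pi) • sinCircle, fun r => ?_⟩
  have hcos := ((hasDerivAt_id r).const_mul (2 * Real.pi)).cos
  exact hcos.congr_deriv (by
    change _ = -(2 * Real.pi) * Real.sin (2 * Real.pi * r)
    simp only [id_eq]
    ring)

/-- A trapezoidal function, equal to `1` on `[0, 1]` and to `0` outside `(-1, 2)`. -/
def trapezoid (x : ℝ) : ℝ := max 0 (min 1 (min (x + 1) (2 - x)))

@[fun_prop]
lemma continuous_trapezoid : Continuous trapezoid := by
  unfold trapezoid
  fun_prop

lemma trapezoid_mem_Icc (x : ℝ) : trapezoid x ∈ Icc (0 : ℝ) 1 :=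
  ⟨le_max_left _ _, max_le zero_le_one (min_le_left _ _)⟩

lemma trapezoid_eq_one {x : ℝ} (hx : x ∈ Icc (0 : ℝ) 1) : trapezoid x = 1 := by
  have hx₀ := hx.1
  have hx₁ := hx.2
  rw [trapezoid, min_eq_left (le_min (by linarith) (by linarith)), max_eq_right zero_le_one]

lemma mem_Ioo_of_trapezoid_ne_zero {x : ℝ} (hx : trapezoid x ≠ 0) : x ∈ Ioo (-1 : ℝ) 2 := by
  by_contra h
  refine hx (max_eq_left ?_)
  rcases not_and_or.1 h with h | h
  · exact (min_le_right _ _).trans ((min_le_left _ _).trans (by linarith))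
  · exact (min_le_right _ _).trans ((min_le_right _ _).trans (by linarith))

/-- A cut-off, at the scale `ε`, of the points where `cos (2 π t)` is close to `l`. It dominates
the indicator function of the set where `smoothStep ε l` is neither `0` nor `1`. -/
def levelBump (ε l : ℝ) : C0 := ⟨fun t => trapezoid ((l - cosCircle t) / ε), by fun_prop⟩

lemma levelBump_mem_Icc (ε l : ℝ) (t : UnitAddCircle) : levelBump ε l t ∈ Icc (0 : ℝ) 1 :=
  trapezoid_mem_Icc _

lemma two_pi_mul_mem_Icc_of_levelBump_ne_zero {ε l r : ℝ} (hε : 0 < ε)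
    (hr : r ∈ Icc (0 : ℝ) (1 / 2)) (h : levelBump ε l (r : UnitAddCircle) ≠ 0) :
    2 * Real.pi * r ∈ Icc (Real.arccos (l + ε)) (Real.arccos (l - 2 * ε)) := by
  obtain ⟨hlower, hupper⟩ := mem_Ioo_of_trapezoid_ne_zero h
  rw [cosCircle_coe, lt_div_iff₀ hε] at hlower
  rw [cosCircle_coe, div_lt_iff₀ hε] at hupper
  have harccos : Real.arccos (Real.cos (2 * Real.pi * r)) = 2 * Real.pi * r :=
    Real.arccos_cos (mul_nonneg Real.two_pi_pos.le hr.1) (by nlinarith [Real.pi_pos, hr.2])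
  rw [← harccos]
  exact ⟨Real.antitone_arccos (by linarith), Real.antitone_arccos (by linarith)⟩

lemma integral_levelBump_le {ε : ℝ} (hε : 0 < ε) (l : ℝ) :
    ∫ r in (0 : ℝ)..1 / 2, levelBump ε l (r : UnitAddCircle) ≤
      (Real.arccos (l - 2 * ε) - Real.arccos (l + ε)) / (2 * Real.pi) := by
  let A : ℝ := Real.arccos (l + ε) / (2 * Real.pi)
  let B : ℝ := Real.arccos (l - 2 * ε) / (2 * Real.pi)
  have hAB : A ≤ B :=
    div_le_div_of_nonneg_right (Real.antitone_arccos (by linarith)) Real.two_pi_pos.le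
  have hindicator : Integrable ((Icc A B).indicator fun _ => (1 : ℝ)) :=
    (integrable_indicator_iff measurableSet_Icc).2 (integrableOn_const measure_Icc_lt_top.ne)
  have hle : ∀ r ∈ Icc (0 : ℝ) (1 / 2),
      levelBump ε l (r : UnitAddCircle) ≤ (Icc A B).indicator (fun _ => (1 : ℝ)) r := by
    intro r hr
    by_cases h : levelBump ε l (r : UnitAddCircle) = 0
    · exact h.trans_le (indicator_nonneg (fun _ _ => zero_le_one) r)
    · obtain ⟨hlower, hupper⟩ := two_pi_mul_mem_Icc_of_levelBump_ne_zero hε hr h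
      have hmem : r ∈ Icc A B :=
        ⟨(div_le_iff₀' Real.two_pi_pos).2 hlower, (le_div_iff₀' Real.two_pi_pos).2 hupper⟩
      rw [indicator_of_mem hmem]
      exact (levelBump_mem_Icc ε l _).2
  calc ∫ r in (0 : ℝ)..1 / 2, levelBump ε l (r : UnitAddCircle)
      ≤ ∫ r in (0 : ℝ)..1 / 2, (Icc A B).indicator (fun _ => (1 : ℝ)) r :=
        intervalIntegral.integral_mono_on (by norm_num)
          ((continuous_comp_coe _).intervalIntegrable _ _) hindicator.intervalIntegrable hle
    _ ≤ ∫ r, (Icc A B).indicator (fun _ => (1 : ℝ)) r := by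
        rw [intervalIntegral.integral_of_le (by norm_num)]
        exact setIntegral_le_integral hindicator
          (.of_forall (indicator_nonneg fun _ _ => zero_le_one))
    _ = _ := by
        rw [integral_indicator_const _ measurableSet_Icc, Real.volume_real_Icc_of_le hAB,
          smul_eq_mul, mul_one, sub_div]

lemma meanC_levelBump_le {ε : ℝ} (hε : 0 < ε) (l : ℝ) :
    meanC (levelBump ε l) ≤ (Real.arccos (l - 2 * ε) - Real.arccos (l + ε)) / Real.pi := by
  have hint : ∀ a b : ℝ,
      IntervalIntegrable (fun r : ℝ => levelBump ε l (r : UnitAddCircle)) volume a b :=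
    fun a b => (continuous_comp_coe _).intervalIntegrable a b
  have hreflect : ∫ r in (1 / 2 : ℝ)..1, levelBump ε l (r : UnitAddCircle) =
      ∫ r in (0 : ℝ)..1 / 2, levelBump ε l (r : UnitAddCircle) := by
    have heven : ∀ r : ℝ, levelBump ε l ((1 - r : ℝ) : UnitAddCircle) =
        levelBump ε l (r : UnitAddCircle) := fun r => by
      change trapezoid ((l - cosCircle ((1 - r : ℝ) : UnitAddCircle)) / ε) =
        trapezoid ((l - cosCircle (r : UnitAddCircle)) / ε)
      rw [cosCircle_coe, cosCircle_coe, mul_sub, mul_one, Real.cos_two_pi_sub]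
    have h := intervalIntegral.integral_comp_sub_left (a := 0) (b := 1 / 2)
      (fun r : ℝ => levelBump ε l (r : UnitAddCircle)) (1 : ℝ)
    simp only [heven] at h
    rw [h]
    norm_num
  rw [meanC_apply, ← intervalIntegral_coe, ← intervalIntegral.integral_add_adjacent_intervals
    (hint 0 (1 / 2)) (hint (1 / 2) 1), hreflect]
  refine (add_le_add (integral_levelBump_le hε l) (integral_levelBump_le hε l)).trans_eq ?_
  field_simp
  ring

lemma uniformContinuous_arccos : UniformContinuous Real.arccos := by
  have hcompact : UniformContinuous fun x : Icc (-1 : ℝ) 1 => Real.arccos x :=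
    CompactSpace.uniformContinuous_of_continuous (by fun_prop)
  have hproj : Real.arccos =
      (fun x : Icc (-1 : ℝ) 1 => Real.arccos x) ∘ projIcc (-1 : ℝ) 1 (by norm_num) := by
    ext x
    simp only [Function.comp_apply, Real.arccos, Real.arcsin_projIcc]
  rw [hproj]
  exact hcompact.comp (LipschitzWith.projIcc _).uniformContinuous

lemma exists_meanC_levelBump_le {η : ℝ} (hη : 0 < η) :
    ∃ ε > 0, ∀ l, meanC (levelBump ε l) ≤ η := by
  obtain ⟨δ, hδ, harccos⟩ := Metric.uniformContinuous_iff.1 uniformContinuous_arccos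
    (Real.pi * η) (mul_pos Real.pi_pos hη)
  refine ⟨δ / 4, by positivity, fun l => (meanC_levelBump_le (by positivity) l).trans ?_⟩
  rw [div_le_iff₀' Real.pi_pos]
  have hdist : dist (l - 2 * (δ / 4)) (l + δ / 4) < δ := by
    rw [Real.dist_eq, abs_lt]
    constructor <;> linarith
  exact (le_abs_self _).trans (harccos hdist).le

/-- A smoothed indicator function of the set where `cos (2 π t) ≤ l`. -/
def smoothStep (ε l : ℝ) : C0 :=
  ⟨fun t => Real.smoothTransition ((l - cosCircle t) / ε),
    Real.smoothTransition.continuous.comp (by fun_prop)⟩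

lemma smoothStep_mem_Icc (ε l : ℝ) (t : UnitAddCircle) : smoothStep ε l t ∈ Icc (0 : ℝ) 1 :=
  ⟨Real.smoothTransition.nonneg _, Real.smoothTransition.le_one _⟩

lemma smoothStep_eq_zero_or_one_or_levelBump_eq_one (ε l : ℝ) (t : UnitAddCircle) :
    smoothStep ε l t = 0 ∨ smoothStep ε l t = 1 ∨ levelBump ε l t = 1 := by
  rcases le_total ((l - cosCircle t) / ε) 0 with h₀ | h₀
  · exact .inl (Real.smoothTransition.zero_of_nonpos h₀)
  · rcases le_total 1 ((l - cosCircle t) / ε) with h₁ | h₁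
    · exact .inr (.inl (Real.smoothTransition.one_of_one_le h₁))
    · exact .inr (.inr (trapezoid_eq_one ⟨h₀, h₁⟩))

lemma smoothStep_mem_C1Subalgebra (ε l : ℝ) : smoothStep ε l ∈ C1Subalgebra := by
  have hsmooth : ContDiff ℝ 1 fun x => Real.smoothTransition ((l - x) / ε) :=
    Real.smoothTransition.contDiff.comp (by fun_prop)
  exact comp_mem_C1Subalgebra (g := ⟨_, hsmooth.continuous⟩) hsmooth cosCircle_mem_C1Subalgebra

lemma smoothStep_of_le_neg_one {ε l : ℝ} (hε : 0 < ε) (hl : l ≤ -1) : smoothStep ε l = 0 := by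
  ext t
  refine Real.smoothTransition.zero_of_nonpos (div_nonpos_of_nonpos_of_nonneg ?_ hε.le)
  linarith [(cosCircle_mem_Icc t).1]

lemma smoothStep_of_one_add_le {ε l : ℝ} (hε : 0 < ε) (hl : 1 + ε ≤ l) : smoothStep ε l = 1 := by
  ext t
  refine Real.smoothTransition.one_of_one_le ((one_le_div hε).2 ?_)
  linarith [(cosCircle_mem_Icc t).2]

lemma continuous_scale_smoothStep (N : ℕ) (ε : ℝ) :
    Continuous fun l => scale N (smoothStep ε l) := by
  refine ContinuousMap.continuous_of_continuous_uncurry _ ?_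
  change Continuous fun p : ℝ × UnitAddCircle =>
    Real.smoothTransition ((p.1 - cosCircle (N • p.2)) / ε)
  exact Real.smoothTransition.continuous.comp (by fun_prop)

-- Where `θ` is `0` or `1`, the left-hand side is `0`.
lemma abs_nemytskii_sub_mix_le (H : C(UnitAddCircle × ℝ, ℝ)) {M : ℝ}
    (hM : ∀ t, ∀ x ∈ Icc (0 : ℝ) 1, |H (t, x)| ≤ M) {θ w : C0} (hθ : ∀ t, θ t ∈ Icc (0 : ℝ) 1)
    (hw : ∀ t, 0 ≤ w t) (hθw : ∀ t, θ t = 0 ∨ θ t = 1 ∨ w t = 1) (t : UnitAddCircle) :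
    |(nemytskii H θ - nemytskii H 0 - θ * (nemytskii H 1 - nemytskii H 0)) t| ≤
      ((2 * M) • w) t := by
  change |H (t, θ t) - H (t, 0) - θ t * (H (t, 1) - H (t, 0))| ≤ 2 * M * w t
  have h0 := hM t 0 (left_mem_Icc.2 zero_le_one)
  have hbound : 0 ≤ 2 * M * w t := by
    have hM0 : 0 ≤ M := (abs_nonneg _).trans h0
    have hwt := hw t
    positivity
  rcases hθw t with h | h | h
  · simpa [h] using hbound
  · simpa [h] using hbound
  · obtain ⟨h0l, h0u⟩ := abs_le.1 h0
    obtain ⟨h1l, h1u⟩ := abs_le.1 (hM t 1 (right_mem_Icc.2 zero_le_one))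
    obtain ⟨hθl, hθu⟩ := abs_le.1 (hM t _ (hθ t))
    rw [h, mul_one, abs_le]
    constructor <;> nlinarith [(hθ t).1, (hθ t).2]

lemma abs_meanC_nemytskii_scale_smoothStep_sub_le (H : C(UnitAddCircle × ℝ, ℝ)) {η M : ℝ}
    (hM : ∀ t, ∀ x ∈ Icc (0 : ℝ) 1, |H (t, x)| ≤ M) {N : ℕ} (hN : N ≠ 0) {ε l : ℝ}
    (hbump : meanC (levelBump ε l) ≤ η)
    (hosc : |meanC (scale N (smoothStep ε l) * (nemytskii H 1 - nemytskii H 0)) -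
      meanC (smoothStep ε l) * meanC (nemytskii H 1 - nemytskii H 0)| ≤ η) :
    |meanC (nemytskii H (scale N (smoothStep ε l))) -
      ((1 - meanC (smoothStep ε l)) * meanC (nemytskii H 0) +
        meanC (smoothStep ε l) * meanC (nemytskii H 1))| ≤ (2 * M + 1) * η := by
  have hM0 : 0 ≤ M := (abs_nonneg _).trans (hM 0 0 (left_mem_Icc.2 zero_le_one))
  have hmix := abs_meanC_le_meanC (abs_nemytskii_sub_mix_le H hM
    (θ := scale N (smoothStep ε l)) (w := scale N (levelBump ε l))
    (fun _ => smoothStep_mem_Icc _ _ _) (fun _ => (levelBump_mem_Icc _ _ _).1)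
    fun _ => smoothStep_eq_zero_or_one_or_levelBump_eq_one _ _ _)
  rw [map_smul, smul_eq_mul, meanC_scale hN, map_sub, map_sub] at hmix
  rw [map_sub meanC (nemytskii H 1)] at hosc
  have hsmall : 2 * M * meanC (levelBump ε l) ≤ 2 * M * η := by gcongr
  obtain ⟨hmix₁, hmix₂⟩ := abs_le.1 hmix
  obtain ⟨hosc₁, hosc₂⟩ := abs_le.1 hosc
  rw [abs_le]
  constructor <;> linarith

lemma exists_forall_abs_le_of_finite {S : Set C(UnitAddCircle × ℝ, ℝ)} (hS : S.Finite) {K : Set ℝ}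
    (hK : IsCompact K) : ∃ M, ∀ H ∈ S, ∀ t, ∀ x ∈ K, |H (t, x)| ≤ M := by
  have hbound : ∀ H : C(UnitAddCircle × ℝ, ℝ), ∃ M, ∀ p ∈ univ ×ˢ K, ‖H p‖ ≤ M := fun H =>
    (isCompact_univ.prod hK).exists_bound_of_continuousOn H.continuous.continuousOn
  choose M hM using hbound
  obtain ⟨M', hM'⟩ := (hS.image M).bddAbove
  exact ⟨M', fun H hH t x hx =>
    (hM H (t, x) ⟨mem_univ t, hx⟩).trans (hM' (mem_image_of_mem M hH))⟩

lemma exists_forall_abs_meanC_scale_mul_sub_le_of_finite {S : Set C0} (hS : S.Finite) {η : ℝ}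
    (hη : 0 < η) : ∃ N ≠ 0, ∀ D ∈ S, ∀ q : C0, (∀ t, |q t| ≤ 1) →
      |meanC (scale N q * D) - meanC q * meanC D| ≤ η := by
  choose N hN using fun D : C0 => exists_abs_meanC_scale_mul_sub_le D hη
  obtain ⟨N', hN'⟩ := (hS.image N).bddAbove
  exact ⟨N' + 1, N'.succ_ne_zero, fun D hD =>
    hN D _ (Nat.lt_succ_of_le (hN' (mem_image_of_mem N hD)))⟩

lemma exists_path_meanC_nemytskii_interpolates {S : Set C(UnitAddCircle × ℝ, ℝ)} (hS : S.Finite)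
    {ε : ℝ} (hε : 0 < ε) :
    ∃ Θ : ℝ → C0, Continuous Θ ∧ Θ 0 = 0 ∧ Θ 1 = 1 ∧ (∀ s, Θ s ∈ C1Subalgebra) ∧
      (∀ s t, Θ s t ∈ Icc (0 : ℝ) 1) ∧ ∀ s, ∃ m ∈ Icc (0 : ℝ) 1, ∀ H ∈ S,
        |meanC (nemytskii H (Θ s)) -
          ((1 - m) * meanC (nemytskii H 0) + m * meanC (nemytskii H 1))| ≤ ε := by
  obtain ⟨M₀, hM₀⟩ := exists_forall_abs_le_of_finite hS (isCompact_Icc (a := (0 : ℝ)) (b := 1))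
  let M : ℝ := max M₀ 0
  have hM : ∀ H ∈ S, ∀ t, ∀ x ∈ Icc (0 : ℝ) 1, |H (t, x)| ≤ M := fun H hH t x hx =>
    (hM₀ H hH t x hx).trans (le_max_left _ _)
  have : 0 ≤ M := le_max_right _ _
  have hη : 0 < ε / (2 * M + 1) := by positivity
  obtain ⟨r, hr, hbump⟩ := exists_meanC_levelBump_le hη
  obtain ⟨N, hN0, hN⟩ := exists_forall_abs_meanC_scale_mul_sub_le_of_finite
    (hS.image fun H => nemytskii H 1 - nemytskii H 0) hη
  let l : ℝ → ℝ := fun s => -1 + (2 + r) * s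
  have hstep : ∀ s t, |smoothStep r (l s) t| ≤ 1 := fun s t =>
    (abs_of_nonneg (smoothStep_mem_Icc _ _ t).1).trans_le (smoothStep_mem_Icc _ _ t).2
  refine ⟨fun s => scale N (smoothStep r (l s)),
    (continuous_scale_smoothStep N r).comp (by fun_prop), ?_, ?_,
    fun s => scale_mem_C1Subalgebra N (smoothStep_mem_C1Subalgebra _ _),
    fun s t => smoothStep_mem_Icc _ _ _, fun s => ⟨meanC (smoothStep r (l s)), ⟨?_, ?_⟩,
    fun H hH => ?_⟩⟩
  · exact congrArg (scale N) (smoothStep_of_le_neg_one hr (by simp [l]))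
  · exact congrArg (scale N) (smoothStep_of_one_add_le hr (by simp only [l]; linarith))
  · exact (map_zero meanC).ge.trans (meanC_mono fun t => (smoothStep_mem_Icc _ _ t).1)
  · exact (meanC_mono (v := 1) fun t => (smoothStep_mem_Icc _ _ t).2).trans meanC_one.le
  · exact (abs_meanC_nemytskii_scale_smoothStep_sub_le H (hM H hH) hN0 (hbump _)
      (hN _ (mem_image_of_mem _ hH) _ (hstep s))).trans_eq (mul_div_cancel₀ _ (by positivity))

/-! ### Paths of zeros of `Σ₁` -/

lemma exists_norm_nemytskii_sub_le (f : C(UnitAddCircle × ℝ, ℝ)) (B : ℝ) {ε : ℝ} (hε : 0 < ε) :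
    ∃ δ > 0, ∀ u v : C0, ‖u‖ ≤ B → ‖v - u‖ ≤ δ → ‖nemytskii f v - nemytskii f u‖ ≤ ε := by
  have hcompact : IsCompact ((univ : Set UnitAddCircle) ×ˢ Icc (-(B + 1)) (B + 1)) :=
    isCompact_univ.prod isCompact_Icc
  obtain ⟨δ, hδ, hf⟩ := Metric.uniformContinuousOn_iff.1
    (hcompact.uniformContinuousOn_of_continuous f.continuous.continuousOn) ε hε
  refine ⟨min (δ / 2) 1, by positivity, fun u v hu hv => ?_⟩
  refine (ContinuousMap.norm_le _ hε.le).2 fun t => ?_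
  have hut : |u t| ≤ B := (u.norm_coe_le_norm t).trans hu
  have hvt : |v t - u t| ≤ min (δ / 2) 1 := ((v - u).norm_coe_le_norm t).trans hv
  have hvt₁ : |v t - u t| < δ := hvt.trans_lt ((min_le_left _ _).trans_lt (half_lt_self hδ))
  obtain ⟨hut₁, hut₂⟩ := abs_le.1 hut
  obtain ⟨hvt₂, hvt₃⟩ := abs_le.1 (hvt.trans (min_le_right _ _))
  refine (hf (t, v t) ⟨mem_univ _, ?_, ?_⟩ (t, u t) ⟨mem_univ _, ?_, ?_⟩ ?_).le
  all_goals try linarith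
  rw [Prod.dist_eq, dist_self, Real.dist_eq]
  exact max_lt hδ hvt₁

lemma exists_continuous_zero {S : Type*} [TopologicalSpace S] {h : S → ℝ → ℝ}
    (hc : Continuous fun p : S × ℝ => h p.1 p.2) {a b : ℝ} (hab : a ≤ b)
    (hmono : ∀ s, StrictMonoOn (h s) (Icc a b)) (ha : ∀ s, h s a ≤ 0) (hb : ∀ s, 0 ≤ h s b) :
    ∃ τ : S → ℝ, Continuous τ ∧ ∀ s, τ s ∈ Icc a b ∧ h s (τ s) = 0 := by
  have hcs : ∀ s, Continuous (h s) := fun s => hc.comp (Continuous.prodMk_right s)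
  have hct : ∀ t, Continuous fun s => h s t := fun t => hc.comp (Continuous.prodMk_left t)
  have hex : ∀ s, ∃ t ∈ Icc a b, h s t = 0 := fun s =>
    intermediate_value_Icc hab (hcs s).continuousOn ⟨ha s, hb s⟩
  choose τ hτ hzero using hex
  refine ⟨τ, continuous_iff_continuousAt.2 fun s₀ => tendsto_order.2
    ⟨fun x hx => ?_, fun x hx => ?_⟩, fun s => ⟨hτ s, hzero s⟩⟩
  · by_cases hxa : x < a
    · exact .of_forall fun s => hxa.trans_le (hτ s).1
    · have hxm : x ∈ Icc a b := ⟨not_lt.1 hxa, hx.le.trans (hτ s₀).2⟩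
      have hlt : h s₀ x < 0 := hzero s₀ ▸ hmono s₀ hxm (hτ s₀) hx
      filter_upwards [(hct x).continuousAt.eventually (gt_mem_nhds hlt)] with s hs
      rw [← hzero s] at hs
      exact (hmono s).lt_iff_lt hxm (hτ s) |>.1 hs
  · by_cases hxb : b < x
    · exact .of_forall fun s => (hτ s).2.trans_lt hxb
    · have hxm : x ∈ Icc a b := ⟨(hτ s₀).1.trans hx.le, not_lt.1 hxb⟩
      have hlt : 0 < h s₀ x := hzero s₀ ▸ hmono s₀ (hτ s₀) hxm hx
      filter_upwards [(hct x).continuousAt.eventually (lt_mem_nhds hlt)] with s hs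
      rw [← hzero s] at hs
      exact (hmono s).lt_iff_lt (hτ s) hxm |>.1 hs

lemma exists_continuous_zero_of_le_deriv {S : Type*} [TopologicalSpace S] {h h' : S → ℝ → ℝ}
    (hc : Continuous fun p : S × ℝ => h p.1 p.2) (hd : ∀ s x, HasDerivAt (h s) (h' s x) x)
    {κ r : ℝ} (hκ : 0 < κ) (hr : 0 ≤ r) (hκd : ∀ s, ∀ x ∈ Icc (-r) r, κ ≤ h' s x)
    (h0 : ∀ s, |h s 0| ≤ κ * r) :
    ∃ τ : S → ℝ, Continuous τ ∧ ∀ s, h s (τ s) = 0 ∧ (h s 0 = 0 → τ s = 0) := by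
  have hgrow : ∀ s, ∀ x ∈ Icc (-r) r, ∀ y ∈ Icc (-r) r, x ≤ y → κ * (y - x) ≤ h s y - h s x :=
    fun s => (convex_Icc (-r) r).mul_sub_le_image_sub_of_le_deriv
      (fun x _ => (hd s x).continuousAt.continuousWithinAt)
      (fun x _ => (hd s x).differentiableAt.differentiableWithinAt) fun x hx => by
        rw [(hd s x).deriv]
        exact hκd s x (interior_subset hx)
  have hmono : ∀ s, StrictMonoOn (h s) (Icc (-r) r) := fun s x hx y hy hxy => by
    linarith [hgrow s x hx y hy hxy.le, mul_pos hκ (sub_pos.2 hxy)]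
  have hmem : (0 : ℝ) ∈ Icc (-r) r := ⟨neg_nonpos.2 hr, hr⟩
  obtain ⟨τ, hτc, hτ⟩ := exists_continuous_zero hc (neg_le_self hr) hmono
    (fun s => by
      linarith [hgrow s (-r) ⟨le_rfl, neg_le_self hr⟩ 0 hmem hmem.1, (abs_le.1 (h0 s)).2])
    (fun s => by linarith [hgrow s 0 hmem r ⟨neg_le_self hr, le_rfl⟩ hr, (abs_le.1 (h0 s)).1])
  exact ⟨τ, hτc, fun s =>
    ⟨(hτ s).2, fun hs => (hmono s).injOn (hτ s).1 hmem ((hτ s).2.trans hs.symm)⟩⟩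

/-- The function `u + θ (v - u)`, equal to `u` where `θ = 0` and to `v` where `θ = 1`. -/
def mix (θ u v : C0) : C0 := u + θ * (v - u)

@[simp] lemma mix_zero (u v : C0) : mix 0 u v = u := by simp [mix]

@[simp] lemma mix_one (u v : C0) : mix 1 u v = v := by simp [mix]

lemma continuous_mix (u v : C0) : Continuous fun θ => mix θ u v := by
  unfold mix
  fun_prop

lemma mix_mem_C1Subalgebra {θ u v : C0} (hθ : θ ∈ C1Subalgebra) (hu : u ∈ C1Subalgebra)
    (hv : v ∈ C1Subalgebra) : mix θ u v ∈ C1Subalgebra :=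
  add_mem hu (mul_mem hθ (sub_mem hv hu))

lemma norm_mix_le {θ : C0} (hθ : ∀ t, θ t ∈ Icc (0 : ℝ) 1) (u v : C0) :
    ‖mix θ u v‖ ≤ ‖u‖ + ‖v - u‖ := by
  have hθ' : ‖θ‖ ≤ 1 := (ContinuousMap.norm_le _ zero_le_one).2 fun t =>
    (abs_of_nonneg (hθ t).1).trans_le (hθ t).2
  calc ‖u + θ * (v - u)‖ ≤ ‖u‖ + ‖θ‖ * ‖v - u‖ :=
        (norm_add_le _ _).trans (by gcongr; exact norm_mul_le _ _)
    _ ≤ ‖u‖ + ‖v - u‖ := by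
        gcongr
        exact mul_le_of_le_one_left (norm_nonneg _) hθ'

lemma exists_path_meanC_nemytskii_mix (g b : C(UnitAddCircle × ℝ, ℝ)) (u₀ u₁ φ₀ φ₁ : C0) {ε : ℝ}
    (hε : 0 < ε) :
    ∃ Θ : ℝ → C0, Continuous Θ ∧ Θ 0 = 0 ∧ Θ 1 = 1 ∧ (∀ s, Θ s ∈ C1Subalgebra) ∧
      (∀ s t, Θ s t ∈ Icc (0 : ℝ) 1) ∧ ∀ s, ∃ m ∈ Icc (0 : ℝ) 1,
        |meanC (nemytskii g (mix (Θ s) u₀ u₁)) -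
          ((1 - m) * meanC (nemytskii g u₀) + m * meanC (nemytskii g u₁))| ≤ ε ∧
        |meanC (nemytskii b (mix (Θ s) u₀ u₁) * mix (Θ s) φ₀ φ₁) -
          ((1 - m) * meanC (nemytskii b u₀ * φ₀) + m * meanC (nemytskii b u₁ * φ₁))| ≤ ε := by
  let H₁ : C(UnitAddCircle × ℝ, ℝ) :=
    ⟨fun p => g (p.1, u₀ p.1 + p.2 * (u₁ p.1 - u₀ p.1)), by fun_prop⟩
  let H₂ : C(UnitAddCircle × ℝ, ℝ) :=
    ⟨fun p => b (p.1, u₀ p.1 + p.2 * (u₁ p.1 - u₀ p.1)) * (φ₀ p.1 + p.2 * (φ₁ p.1 - φ₀ p.1)),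
      by fun_prop⟩
  have hH₁ : ∀ θ, nemytskii H₁ θ = nemytskii g (mix θ u₀ u₁) := fun _ => rfl
  have hH₂ : ∀ θ, nemytskii H₂ θ = nemytskii b (mix θ u₀ u₁) * mix θ φ₀ φ₁ := fun _ => rfl
  obtain ⟨Θ, hΘc, hΘ0, hΘ1, hΘC1, hΘmem, hΘ⟩ :=
    exists_path_meanC_nemytskii_interpolates (toFinite {H₁, H₂}) hε
  refine ⟨Θ, hΘc, hΘ0, hΘ1, hΘC1, hΘmem, fun s => ?_⟩
  obtain ⟨m, hm, hmix⟩ := hΘ s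
  have hmix₁ := hmix H₁ (by simp)
  have hmix₂ := hmix H₂ (by simp)
  simp only [hH₁, mix_zero, mix_one] at hmix₁
  simp only [hH₂, mix_zero, mix_one] at hmix₂
  exact ⟨m, hm, hmix₁, hmix₂⟩

lemma exists_forall_half_le_meanC_nemytskii_line (b : C(UnitAddCircle × ℝ, ℝ)) (B R : ℝ) {δ : ℝ}
    (hδ : 0 < δ) :
    ∃ r : ℝ, 0 < r ∧ ∀ u v : C0, ‖u‖ ≤ B → ‖v‖ ≤ R → δ ≤ meanC (nemytskii b u * v) →
      ∀ x ∈ Icc (-r) r, δ / 2 ≤ meanC (nemytskii b (u + x • v) * v) := by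
  let R' : ℝ := max R 1
  have hR' : 0 < R' := zero_lt_one.trans_le (le_max_right _ _)
  obtain ⟨ρ, hρ, hmod⟩ := exists_norm_nemytskii_sub_le b B (ε := δ / 2 / R') (by positivity)
  refine ⟨ρ / R', by positivity, fun u v hu hv hδuv x hx => ?_⟩
  have hvR : ‖v‖ ≤ R' := hv.trans (le_max_left _ _)
  have hclose : ‖u + x • v - u‖ ≤ ρ := by
    rw [add_sub_cancel_left, norm_smul, Real.norm_eq_abs]
    calc |x| * ‖v‖ ≤ ρ / R' * R' := by
          gcongr
          exact abs_le.2 hx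
      _ = ρ := div_mul_cancel₀ _ hR'.ne'
  have hdiff : |meanC ((nemytskii b (u + x • v) - nemytskii b u) * v)| ≤ δ / 2 :=
    calc _ ≤ ‖nemytskii b (u + x • v) - nemytskii b u‖ * ‖v‖ :=
          (abs_meanC_le _).trans (norm_mul_le _ _)
      _ ≤ δ / 2 / R' * R' := by
          gcongr
          exact hmod u _ hu hclose
      _ = δ / 2 := div_mul_cancel₀ _ hR'.ne'
  rw [sub_mul, map_sub] at hdiff
  linarith [(abs_le.1 hdiff).1]

section

variable {f : C(UnitAddCircle × ℝ, ℝ)} (hf : IsSmooth f)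

lemma hasDerivAt_sigma1_line (u v : C0) (r : ℝ) :
    HasDerivAt (fun r : ℝ => sigma1 f (u + r • v))
      (meanC (nemytskii (partialX (partialX f hf) (isSmooth_partialX hf)) (u + r • v) * v)) r := by
  have hline : HasDerivAt (fun r : ℝ => u + r • v) v r := by
    simpa using ((hasDerivAt_id r).smul_const v).const_add u
  exact (hasFDerivAt_sigma1 hf _).comp_hasDerivAt r hline

lemma exists_forall_continuous_zero_sigma1 (B R : ℝ) {δ : ℝ} (hδ : 0 < δ) :
    ∃ ε > 0, ∀ P Q : ℝ → C0, Continuous P → Continuous Q → (∀ s, ‖P s‖ ≤ B) → (∀ s, ‖Q s‖ ≤ R) →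
      (∀ s, |sigma1 f (P s)| ≤ ε) →
      (∀ s, δ ≤ meanC (nemytskii (partialX (partialX f hf) (isSmooth_partialX hf)) (P s) * Q s)) →
      ∃ τ : ℝ → ℝ, Continuous τ ∧
        ∀ s, sigma1 f (P s + τ s • Q s) = 0 ∧ (sigma1 f (P s) = 0 → τ s = 0) := by
  obtain ⟨r, hr, hderiv⟩ := exists_forall_half_le_meanC_nemytskii_line
    (partialX (partialX f hf) (isSmooth_partialX hf)) B R hδ
  refine ⟨δ / 2 * r, by positivity, fun P Q hPc hQc hP hQ hsmall hδPQ => ?_⟩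
  have hpath : Continuous fun p : ℝ × ℝ => P p.1 + p.2 • Q p.1 := by fun_prop
  simpa only [zero_smul, add_zero] using
    exists_continuous_zero_of_le_deriv (h := fun s x => sigma1 f (P s + x • Q s))
      ((continuous_sigma1 hf).comp hpath) (fun s x => hasDerivAt_sigma1_line hf _ _ x)
      (half_pos hδ) hr.le (fun s => hderiv _ _ (hP s) (hQ s) (hδPQ s))
      (by simpa only [zero_smul, add_zero] using hsmall)

-- Mixing `u₀` and `u₁` keeps `Σ₁` small, and its derivative in the direction of the mixture of `φ₀`
-- and `φ₁` away from `0`; a correction in this direction gives a path of zeros of `Σ₁`.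
lemma exists_path_sigma1_eq_zero {u₀ u₁ φ₀ φ₁ : C0} (hu₀ : u₀ ∈ C1Subalgebra)
    (hu₁ : u₁ ∈ C1Subalgebra) (hφ₀ : φ₀ ∈ C1Subalgebra) (hφ₁ : φ₁ ∈ C1Subalgebra)
    (h₀ : sigma1 f u₀ = 0) (h₁ : sigma1 f u₁ = 0)
    (hpos₀ : 0 < meanC (nemytskii (partialX (partialX f hf) (isSmooth_partialX hf)) u₀ * φ₀))
    (hpos₁ : 0 < meanC (nemytskii (partialX (partialX f hf) (isSmooth_partialX hf)) u₁ * φ₁)) :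
    ∃ U : ℝ → C0, Continuous U ∧ U 0 = u₀ ∧ U 1 = u₁ ∧
      ∀ s, U s ∈ C1Subalgebra ∧ sigma1 f (U s) = 0 := by
  let g := partialX f hf
  let b := partialX g (isSmooth_partialX hf)
  obtain ⟨δ, hδ, hδlt⟩ := exists_between (lt_min hpos₀ hpos₁)
  obtain ⟨hδ₀, hδ₁⟩ := lt_min_iff.1 hδlt
  obtain ⟨ε, hε, hzeros⟩ := exists_forall_continuous_zero_sigma1 hf (‖u₀‖ + ‖u₁ - u₀‖)
    (‖φ₀‖ + ‖φ₁ - φ₀‖) (half_pos hδ)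
  obtain ⟨Θ, hΘc, hΘ0, hΘ1, hΘC1, hΘmem, hΘ⟩ :=
    exists_path_meanC_nemytskii_mix g b u₀ u₁ φ₀ φ₁ (lt_min hε (half_pos hδ))
  have hsigma1 : ∀ s, |sigma1 f (mix (Θ s) u₀ u₁)| ≤ ε := fun s => by
    obtain ⟨m, -, h, -⟩ := hΘ s
    simp only [g, ← sigma1_eq_meanC hf, h₀, h₁, mul_zero, add_zero, sub_zero] at h
    exact h.trans (min_le_left _ _)
  have hslope : ∀ s, δ / 2 ≤ meanC (nemytskii b (mix (Θ s) u₀ u₁) * mix (Θ s) φ₀ φ₁) := fun s => by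
    obtain ⟨m, hm, -, h⟩ := hΘ s
    have hclose := (abs_le.1 (h.trans (min_le_right _ _))).1
    nlinarith [hm.1, hm.2]
  obtain ⟨τ, hτc, hτ⟩ := hzeros (fun s => mix (Θ s) u₀ u₁) (fun s => mix (Θ s) φ₀ φ₁)
    ((continuous_mix _ _).comp hΘc) ((continuous_mix _ _).comp hΘc)
    (fun s => norm_mix_le (hΘmem s) _ _) (fun s => norm_mix_le (hΘmem s) _ _) hsigma1 hslope
  refine ⟨fun s => mix (Θ s) u₀ u₁ + τ s • mix (Θ s) φ₀ φ₁,
    ((continuous_mix _ _).comp hΘc).add (hτc.smul ((continuous_mix _ _).comp hΘc)), ?_, ?_,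
    fun s => ⟨add_mem (mix_mem_C1Subalgebra (hΘC1 s) hu₀ hu₁)
      (C1Subalgebra.smul_mem (mix_mem_C1Subalgebra (hΘC1 s) hφ₀ hφ₁) (τ s)), (hτ s).1⟩⟩
  · simp only [(hτ 0).2 (by rw [hΘ0, mix_zero, h₀]), hΘ0, mix_zero, zero_smul, add_zero]
  · simp only [(hτ 1).2 (by rw [hΘ1, mix_one, h₁]), hΘ1, mix_one, zero_smul, add_zero]

theorem exists_sigma1_eq_zero_sigma2_eq_zero {u₀ u₁ : C0} (hu₀ : u₀ ∈ C1Subalgebra)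
    (hu₁ : u₁ ∈ C1Subalgebra) (h₀ : sigma1 f u₀ = 0) (h₁ : sigma1 f u₁ = 0)
    (hpos : 0 < sigma2 hf u₀) (hneg : sigma2 hf u₁ < 0) :
    ∃ u ∈ C1Subalgebra, sigma1 f u = 0 ∧ sigma2 hf u = 0 := by
  have hnegExp : ∀ u : C0, negExp (primC (nemytskii (partialX f hf) u)) ∈ C1Subalgebra := fun u =>
    negExp_mem_C1Subalgebra (primC_mem_C1Subalgebra _)
  obtain ⟨U, hUc, hU0, hU1, hU⟩ := exists_path_sigma1_eq_zero hf hu₀ hu₁ (hnegExp u₀)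
    (neg_mem (hnegExp u₁)) h₀ h₁ hpos (by
      rw [mul_neg, map_neg]
      exact neg_pos.2 hneg)
  obtain ⟨s, hs⟩ := mem_range_of_exists_le_of_exists_ge ((continuous_sigma2 hf).comp hUc) (c := 0)
    ⟨1, by simp [hU1, hneg.le]⟩ ⟨0, by simp [hU0, hpos.le]⟩
  exact ⟨U s, (hU s).1, (hU s).2, hs⟩

end

/-! ### Critical points have the same type -/

lemma eventually_exists_zero_of_deriv_pos {S : Type*} [TopologicalSpace S] {h : S → ℝ → ℝ}
    (hc : ∀ x, Continuous fun s => h s x) (hcs : ∀ s, Continuous (h s)) {s₀ : S} {x₀ d : ℝ}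
    (h0 : h s₀ x₀ = 0) (hd : HasDerivAt (h s₀) d x₀) (hpos : 0 < d) {P : S × ℝ → Prop}
    (hP : ∀ᶠ p in nhds (s₀, x₀), P p) : ∀ᶠ s in nhds s₀, ∃ x, P (s, x) ∧ h s x = 0 := by
  rw [nhds_prod_eq] at hP
  obtain ⟨Ps, hPs, Px, hPx, hP⟩ := Filter.eventually_prod_iff.1 hP
  obtain ⟨a, ha, hball⟩ := Metric.nhds_basis_closedBall.eventually_iff.1
    (hPx.and (eventually_nhdsWithin_sign_eq_of_deriv_pos (hd.deriv.symm ▸ hpos) h0))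
  rw [Real.closedBall_eq_Icc] at hball
  have hlo : h s₀ (x₀ - a) < 0 := by
    rw [← sign_eq_neg_one_iff, (hball ⟨le_rfl, by linarith⟩).2, sign_eq_neg_one_iff]
    linarith
  have hhi : 0 < h s₀ (x₀ + a) := by
    rw [← sign_eq_one_iff, (hball ⟨by linarith, le_rfl⟩).2, sign_eq_one_iff]
    linarith
  filter_upwards [hPs, (hc _).continuousAt.eventually (gt_mem_nhds hlo),
    (hc _).continuousAt.eventually (lt_mem_nhds hhi)] with s hs hslo hshi
  obtain ⟨x, hx, hx0⟩ := intermediate_value_Icc (by linarith) (hcs s).continuousOn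
    ⟨hslo.le, hshi.le⟩
  exact ⟨x, hP hs (hball hx).1, hx0⟩

lemma eventually_exists_zero_of_deriv_ne_zero {S : Type*} [TopologicalSpace S] {h : S → ℝ → ℝ}
    (hc : ∀ x, Continuous fun s => h s x) (hcs : ∀ s, Continuous (h s)) {s₀ : S} {x₀ d : ℝ}
    (h0 : h s₀ x₀ = 0) (hd : HasDerivAt (h s₀) d x₀) (hne : d ≠ 0) {P : S × ℝ → Prop}
    (hP : ∀ᶠ p in nhds (s₀, x₀), P p) : ∀ᶠ s in nhds s₀, ∃ x, P (s, x) ∧ h s x = 0 := by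
  rcases hne.lt_or_gt with hneg | hpos
  · simpa only [Pi.neg_apply, neg_eq_zero] using
      eventually_exists_zero_of_deriv_pos (h := fun s => -h s) (fun x => (hc x).neg)
        (fun s => (hcs s).neg) (neg_eq_zero.2 h0) hd.neg (neg_pos.2 hneg) hP
  · exact eventually_exists_zero_of_deriv_pos hc hcs h0 hd hpos hP

section CriticalPoints

variable {f : C(UnitAddCircle × ℝ, ℝ)} (hf : IsSmooth f) (hproper : IsProperMap f)

lemma volterraEquiv_symm_mem_C1Subalgebra {V : C0} (hV : V ∈ C1Subalgebra) :
    (volterraEquiv hf hproper).symm V ∈ C1Subalgebra := by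
  have h := volterra_volterraEquiv_symm hf hproper V
  rw [volterra, ← eq_sub_iff_add_eq] at h
  rw [h]
  exact sub_mem hV (primC_mem_C1Subalgebra _)

lemma mem_closure_sigma1_zeros {V : C0} (hV : V ∈ closure (C1Subalgebra : Set C0))
    (h1 : sigma1 f ((volterraEquiv hf hproper).symm V) = 0)
    (h2 : sigma2 hf ((volterraEquiv hf hproper).symm V) ≠ 0) :
    (volterraEquiv hf hproper).symm V ∈ closure {u | u ∈ C1Subalgebra ∧ sigma1 f u = 0} := by
  refine mem_closure_iff_nhds.2 fun T hT => ?_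
  have hV0 : V + (0 : ℝ) • (1 : C0) = V := by rw [zero_smul, add_zero]
  have hslope := hasDerivAt_avgSlope hf hproper (V := V) (x := 0) (by rwa [hV0])
  rw [hV0] at hslope
  have hcont : Continuous fun p : C0 × ℝ => (volterraEquiv hf hproper).symm (p.1 + p.2 • 1) :=
    (contDiff_volterraEquiv_symm hf hproper).continuous.comp (by fun_prop)
  have hnear := eventually_exists_zero_of_deriv_ne_zero
    (h := fun W x => avgSlope hf hproper (W + x • 1))
    (fun x => (continuous_avgSlope hf hproper).comp (by fun_prop))
    (fun W => (continuous_avgSlope hf hproper).comp (by fun_prop))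
    (by rw [hV0, (avgSlope_eq_zero_iff hf hproper V).2 h1]) hslope
    (div_ne_zero h2 (expWeight_pos _).ne')
    (hcont.continuousAt.eventually_mem (by rwa [hV0]))
  obtain ⟨W, hW, x, hxT, hx0⟩ := ((mem_closure_iff_frequently.1 hV).and_eventually hnear).exists
  exact ⟨_, hxT, volterraEquiv_symm_mem_C1Subalgebra hf hproper
    (add_mem hW (C1Subalgebra.smul_mem (one_mem _) x)), (avgSlope_eq_zero_iff hf hproper _).1 hx0⟩

lemma sigma2_nonneg_of_pos (hnd : ∀ u ∈ C1Subalgebra, sigma1 f u = 0 → sigma2 hf u ≠ 0) {V W : C0}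
    (hV : V ∈ closure (C1Subalgebra : Set C0)) (hW : W ∈ closure (C1Subalgebra : Set C0))
    (hV0 : sigma1 f ((volterraEquiv hf hproper).symm V) = 0)
    (hW0 : sigma1 f ((volterraEquiv hf hproper).symm W) = 0)
    (hVpos : 0 < sigma2 hf ((volterraEquiv hf hproper).symm V)) :
    0 ≤ sigma2 hf ((volterraEquiv hf hproper).symm W) := by
  by_contra! hneg
  obtain ⟨u, hu2, hu, hu1⟩ := mem_closure_iff.1
    (mem_closure_sigma1_zeros hf hproper hV hV0 hVpos.ne') _
    (isOpen_lt continuous_const (continuous_sigma2 hf)) hVpos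
  obtain ⟨v, hv2, hv, hv1⟩ := mem_closure_iff.1
    (mem_closure_sigma1_zeros hf hproper hW hW0 hneg.ne) _
    (isOpen_lt (continuous_sigma2 hf) continuous_const) hneg
  obtain ⟨w, hw, hw1, hw2⟩ := exists_sigma1_eq_zero_sigma2_eq_zero hf hu hv hu1 hv1 hu2 hv2
  exact hnd w hw hw1 hw2

end CriticalPoints

/-! ### Behaviour at infinity -/

lemma pos_of_isPreconnected {Y : Type*} [TopologicalSpace Y] {h : Y → ℝ} {A : Set Y}
    (hA : IsPreconnected A) (hc : ContinuousOn h A) {L : ℝ} (hlarge : ∀ y ∈ A, |L| < |h y|) {y₀ : Y}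
    (hy₀ : y₀ ∈ A) (hL : L ≤ h y₀) {y : Y} (hy : y ∈ A) : 0 < h y := by
  have hpos : 0 < h y₀ := by
    by_contra! hneg
    have h1 := hlarge y₀ hy₀
    rw [abs_of_nonpos hneg] at h1
    linarith [neg_abs_le L]
  by_contra! hneg
  obtain ⟨z, hz, hz0⟩ := hA.intermediate_value hy hy₀ hc ⟨hneg, hpos.le⟩
  exact (abs_nonneg L).not_gt (by simpa only [hz0, abs_zero] using hlarge z hz)

lemma exists_forall_pos_of_isProperMap {g : C(UnitAddCircle × ℝ, ℝ)} (hproper : IsProperMap g)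
    {c : ℝ → ℝ} {V : C0} (hc : ∀ x, ∃ t, c x = g (t, V t + x)) {L : ℝ} (hL : ∀ x, L ≤ c x) :
    ∃ R, ∀ t x, R < |x| → 0 < g (t, x) := by
  obtain ⟨R, hR⟩ := exists_abs_snd_le_of_isProperMap hproper |L|
  have hlarge : ∀ p : UnitAddCircle × ℝ, R < |p.2| → |L| < |g p| := fun p hp => by
    contrapose! hp
    exact hR p.1 p.2 hp
  have hV : ∀ t, |V t| ≤ ‖V‖ := V.norm_coe_le_norm
  have htop : ∀ p ∈ (univ : Set UnitAddCircle) ×ˢ Ioi R, 0 < g p := fun p hp => by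
    obtain ⟨t, ht⟩ := hc (R + ‖V‖ + 1)
    refine pos_of_isPreconnected (isPreconnected_univ.prod isPreconnected_Ioi)
      g.continuous.continuousOn (fun p hp => hlarge p (hp.2.trans_le (le_abs_self _)))
      ⟨mem_univ _, ?_⟩ (ht ▸ hL _) hp
    rw [mem_Ioi]
    linarith [neg_le_of_abs_le (hV t)]
  have hbot : ∀ p ∈ (univ : Set UnitAddCircle) ×ˢ Iio (-R), 0 < g p := fun p hp => by
    obtain ⟨t, ht⟩ := hc (-(R + ‖V‖ + 1))
    refine pos_of_isPreconnected (isPreconnected_univ.prod isPreconnected_Iio)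
      g.continuous.continuousOn
      (fun p hp => hlarge p ((lt_neg_of_lt_neg hp.2).trans_le (neg_le_abs _)))
      ⟨mem_univ _, ?_⟩ (ht ▸ hL _) hp
    rw [mem_Iio]
    linarith [le_of_abs_le (hV t)]
  refine ⟨R, fun t x hx => ?_⟩
  rcases lt_abs.1 hx with h | h
  · exact htop (t, x) ⟨mem_univ _, h⟩
  · exact hbot (t, x) ⟨mem_univ _, lt_neg_of_lt_neg h⟩

lemma tendsto_cocompact_atTop_of_isProperMap {g : C(UnitAddCircle × ℝ, ℝ)}
    (hproper : IsProperMap g) {R : ℝ} (hpos : ∀ t x, R < |x| → 0 < g (t, x)) {c : ℝ → ℝ} {V : C0}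
    (hc : ∀ x, ∃ t, c x = g (t, V t + x)) :
    Filter.Tendsto c (Filter.cocompact ℝ) Filter.atTop := by
  refine Filter.tendsto_atTop.2 fun M => ?_
  obtain ⟨R', hR'⟩ := exists_abs_snd_le_of_isProperMap hproper M
  filter_upwards [(tendsto_norm_cocompact_atTop (E := ℝ)).eventually_gt_atTop (max R R' + ‖V‖)]
    with x hx
  rw [Real.norm_eq_abs] at hx
  obtain ⟨t, ht⟩ := hc x
  have hVt : |V t| ≤ ‖V‖ := V.norm_coe_le_norm t
  have habs : max R R' < |V t + x| := by
    have htri := abs_sub (V t + x) (V t)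
    rw [add_sub_cancel_left] at htri
    linarith
  have hgpos := hpos t _ ((le_max_left _ _).trans_lt habs)
  contrapose! habs
  exact (hR' t _ (by rw [abs_of_pos hgpos, ← ht]; exact habs.le)).trans (le_max_right _ _)

/-! ### Families of averages -/

lemma exists_isParabolicFamily {X : Type*} [NormedAddCommGroup X] [NormedSpace ℝ X]
    {c : ℝ × X → ℝ} (hc : ContDiff ℝ ∞ c) (hpos : ∀ p, pd c p = 0 → 0 < pd (pd c) p)
    (hcoercive : ∀ q, Filter.Tendsto (fun x => c (x, q)) (Filter.cocompact ℝ) Filter.atTop) :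
    ∃ m, IsParabolicFamily c m := by
  have hd : ∀ q x, HasDerivAt (fun y => c (y, q)) (pd c (x, q)) x := fun q x =>
    hasDerivAt_pd (hc.differentiable (by simp)) x q
  have hd' : ∀ q x, HasDerivAt (fun y => pd c (y, q)) (pd (pd c) (x, q)) x := fun q x =>
    hasDerivAt_pd ((contDiff_pd hc).differentiable (by simp)) x q
  have hmin : ∀ q, ∃ x, pd c (x, q) = 0 := fun q => by
    have hcont : Continuous fun x => c (x, q) := hc.continuous.comp (.prodMk_left q)
    obtain ⟨z, hz⟩ := hcont.exists_forall_le (hcoercive q)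
    exact ⟨z, IsLocalMin.hasDerivAt_eq_zero (.of_forall hz) (hd q z)⟩
  choose m hm using hmin
  refine ⟨m, hc, fun x q => ⟨fun hx => ?_, fun hx => hx ▸ hm q⟩, fun q => hpos _ (hm q),
    fun q => (hcoercive q).mono_left atTop_le_cocompact,
    fun q => (hcoercive q).mono_left atBot_le_cocompact⟩
  by_contra hne
  exact (lt_of_forall_second_deriv_pos (hd q) (hd' q) (fun x => hpos (x, q)) (hm q) hne).not_gt
    (lt_of_forall_second_deriv_pos (hd q) (hd' q) (fun x => hpos (x, q)) hx (Ne.symm hne))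

lemma exists_isParabolicFamily_of_isProperMap {X : Type*} [NormedAddCommGroup X] [NormedSpace ℝ X]
    {g : C(UnitAddCircle × ℝ, ℝ)} (hproper : IsProperMap g) {c : ℝ × X → ℝ} (hc : ContDiff ℝ ∞ c)
    {K : X → C0} (hcK : ∀ x q, ∃ t, c (x, q) = g (t, K q t + x))
    (hpos : ∀ p, pd c p = 0 → 0 < pd (pd c) p) (hcrit : ∃ p, pd c p = 0) :
    ∃ m, IsParabolicFamily c m := by
  obtain ⟨⟨x₀, q₀⟩, h₀⟩ := hcrit
  have hbounded : ∀ x, c (x₀, q₀) ≤ c (x, q₀) := fun x => by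
    rcases eq_or_ne x x₀ with rfl | hx
    · exact le_rfl
    · exact (lt_of_forall_second_deriv_pos
        (fun x => hasDerivAt_pd (hc.differentiable (by simp)) x q₀)
        (fun x => hasDerivAt_pd ((contDiff_pd hc).differentiable (by simp)) x q₀)
        (fun x => hpos (x, q₀)) h₀ hx).le
  obtain ⟨R, hR⟩ := exists_forall_pos_of_isProperMap hproper (hcK · q₀) hbounded
  exact exists_isParabolicFamily hc hpos fun q =>
    tendsto_cocompact_atTop_of_isProperMap hproper hR (hcK · q)

lemma pd_neg {X : Type*} [NormedAddCommGroup X] [NormedSpace ℝ X] (c : ℝ × X → ℝ) :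
    pd (-c) = -pd c := by
  ext p
  simp [pd, fderiv_neg]

/-- The affine family of data `K q + x` of the integral equation `u + primC (f (t, u)) = K q + x`,
parametrised by the constant `x` and by `q`. -/
def familyDatum {X : Type*} [NormedAddCommGroup X] [NormedSpace ℝ X] (K : X →L[ℝ] C0) :
    ℝ × X →L[ℝ] C0 :=
  K.comp (.snd ℝ ℝ X) + (ContinuousLinearMap.fst ℝ ℝ X).smulRight 1

lemma familyDatum_apply {X : Type*} [NormedAddCommGroup X] [NormedSpace ℝ X] (K : X →L[ℝ] C0)
    (p : ℝ × X) : familyDatum K p = K p.2 + p.1 • 1 := rfl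

section Family

variable {X : Type*} [NormedAddCommGroup X] [NormedSpace ℝ X] {f : C(UnitAddCircle × ℝ, ℝ)}
  (hf : IsSmooth f) (hproper : IsProperMap f) (K : X →L[ℝ] C0)

/-- The solution of the integral equation with datum `familyDatum K p`. -/
def familySolution (p : ℝ × X) : C0 := (volterraEquiv hf hproper).symm (familyDatum K p)

/-- The average of `f (t, u t)`, where `u` solves the integral equation with datum
`familyDatum K p`. -/
def avgFamily (p : ℝ × X) : ℝ := avg hf hproper (familyDatum K p)

lemma contDiff_familySolution : ContDiff ℝ ∞ (familySolution hf hproper K) :=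
  (contDiff_volterraEquiv_symm hf hproper).comp (familyDatum K).contDiff

lemma contDiff_avgFamily : ContDiff ℝ ∞ (avgFamily hf hproper K) :=
  (contDiff_avg hf hproper).comp (familyDatum K).contDiff

lemma exists_avgFamily_eq (x : ℝ) (q : X) :
    ∃ t, avgFamily hf hproper K (x, q) = f (t, K q t + x) := by
  simpa [avgFamily, familyDatum_apply] using exists_avg_eq hf hproper (familyDatum K (x, q))

lemma pd_avgFamily (p : ℝ × X) :
    pd (avgFamily hf hproper K) p = avgSlope hf hproper (familyDatum K p) :=
  (hasDerivAt_pd ((contDiff_avgFamily hf hproper K).differentiable (by simp)) p.1 p.2).unique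
    (hasDerivAt_avg hf hproper (K p.2) p.1)

lemma pd_avgFamily_eq_zero_iff (p : ℝ × X) :
    pd (avgFamily hf hproper K) p = 0 ↔ sigma1 f (familySolution hf hproper K p) = 0 := by
  rw [pd_avgFamily, avgSlope_eq_zero_iff, familySolution]

lemma pd_pd_avgFamily {p : ℝ × X} (h0 : sigma1 f (familySolution hf hproper K p) = 0) :
    pd (pd (avgFamily hf hproper K)) p = sigma2 hf (familySolution hf hproper K p) /
      expWeight (nemytskii (partialX f hf) (familySolution hf hproper K p)) := by
  have hd : HasDerivAt (fun x : ℝ => avgSlope hf hproper (K p.2 + x • 1))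
      (pd (pd (avgFamily hf hproper K)) p) p.1 := by
    simpa only [pd_avgFamily, familyDatum_apply] using hasDerivAt_pd
      ((contDiff_pd (contDiff_avgFamily hf hproper K)).differentiable (by simp)) p.1 p.2
  rw [familySolution, familyDatum_apply] at h0 ⊢
  exact hd.unique (hasDerivAt_avgSlope hf hproper h0)

variable {K}

lemma sigma2_pos_or_neg
    (hrange : (C1Subalgebra : Set C0) ⊆ range (familyDatum K))
    (hdense : range (familyDatum K) ⊆ closure (C1Subalgebra : Set C0))
    (hnd : ∀ p, sigma1 f (familySolution hf hproper K p) = 0 →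
      sigma2 hf (familySolution hf hproper K p) ≠ 0) :
    (∀ p, sigma1 f (familySolution hf hproper K p) = 0 →
      0 < sigma2 hf (familySolution hf hproper K p)) ∨
    ∀ p, sigma1 f (familySolution hf hproper K p) = 0 →
      sigma2 hf (familySolution hf hproper K p) < 0 := by
  have hndC1 : ∀ u ∈ C1Subalgebra, sigma1 f u = 0 → sigma2 hf u ≠ 0 := fun u hu h0 => by
    obtain ⟨p, hp⟩ := hrange (add_mem hu (primC_mem_C1Subalgebra (nemytskii f u)))
    have hpu : familySolution hf hproper K p = u := by
      rw [familySolution, hp]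
      exact volterraEquiv_symm_volterra hf hproper u
    rw [← hpu] at h0 ⊢
    exact hnd p h0
  by_contra! h
  obtain ⟨⟨p, hp, hpneg⟩, q, hq, hqpos⟩ := h
  exact (sigma2_nonneg_of_pos hf hproper hndC1 (hdense (mem_range_self q))
    (hdense (mem_range_self p)) hq hp (hqpos.lt_of_ne (hnd q hq).symm)).not_gt
    (hpneg.lt_of_ne (hnd p hp))

end Family

theorem isGlobalFold_of_familyCoordinates {f : C(UnitAddCircle × ℝ, ℝ)} (hf : IsSmooth f)
    (hproper : IsProperMap f) {X E F : Type} [NormedAddCommGroup X] [NormedSpace ℝ X]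
    [CompleteSpace X] [NormedAddCommGroup E] [NormedSpace ℝ E] [NormedAddCommGroup F]
    [NormedSpace ℝ F] {G : E → F} {K : X →L[ℝ] C0}
    (φ : FamilyCoordinates G (avgFamily hf hproper K))
    (hrange : (C1Subalgebra : Set C0) ⊆ range (familyDatum K))
    (hdense : range (familyDatum K) ⊆ closure (C1Subalgebra : Set C0))
    (hcrit : ∃ u, IsCriticalPoint G u) (hfold : ∀ u, IsCriticalPoint G u → IsFold G u) :
    IsGlobalFold X G := by
  have hc := contDiff_avgFamily hf hproper K
  have hiff : ∀ p, IsCriticalPoint G (φ.source.symm p) ↔ pd (avgFamily hf hproper K) p = 0 :=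
    fun p => φ.isCriticalPoint_iff (hc.differentiable (by simp) p)
  have hcrit' : ∃ p, pd (avgFamily hf hproper K) p = 0 := by
    obtain ⟨u, hu⟩ := hcrit
    exact ⟨φ.source u, (hiff _).1 (by rwa [φ.source.symm_apply_apply])⟩
  have hzero := pd_avgFamily_eq_zero_iff hf hproper K
  have hnd : ∀ p, sigma1 f (familySolution hf hproper K p) = 0 →
      sigma2 hf (familySolution hf hproper K p) ≠ 0 := fun p h0 h2 => by
    have hpd := (hzero p).2 h0
    exact φ.pd_pd_ne_zero hc (hfold _ ((hiff p).2 hpd)) hpd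
      (by rw [pd_pd_avgFamily hf hproper K h0, h2, zero_div])
  rcases sigma2_pos_or_neg hf hproper hrange hdense hnd with hpos | hneg
  · obtain ⟨m, hm⟩ := exists_isParabolicFamily_of_isProperMap hproper hc
      (exists_avgFamily_eq hf hproper K) (fun p hp => by
        rw [pd_pd_avgFamily hf hproper K ((hzero p).1 hp)]
        exact div_pos (hpos p ((hzero p).1 hp)) (expWeight_pos _)) hcrit'
    exact φ.isGlobalFold hm
  · have hc' : ContDiff ℝ ∞ (-avgFamily hf hproper K) := hc.neg
    have hproper' : IsProperMap (-f) := (Homeomorph.neg ℝ).isProperMap.comp hproper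
    obtain ⟨m, hm⟩ := exists_isParabolicFamily_of_isProperMap hproper' hc'
      (fun x q => (exists_avgFamily_eq hf hproper K x q).imp fun t ht => congrArg Neg.neg ht)
      (fun p hp => by
        rw [pd_neg, Pi.neg_apply, neg_eq_zero] at hp
        rw [pd_neg, pd_neg, Pi.neg_apply, pd_pd_avgFamily hf hproper K ((hzero p).1 hp), neg_pos]
        exact div_neg_of_neg_of_pos (hneg p ((hzero p).1 hp)) (expWeight_pos _))
      (by simpa [pd_neg] using hcrit')
    exact φ.neg.isGlobalFold hm

/-! ### Operators in integral form -/

lemma contDiff_submodule_val {E : Type*} [NormedAddCommGroup E] [NormedSpace ℝ E]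
    (W : Submodule ℝ E) : ContDiff ℝ ∞ (Subtype.val : W → E) :=
  W.subtypeL.contDiff

lemma contDiff_clm_submodule {E F : Type*} [NormedAddCommGroup E] [NormedSpace ℝ E]
    [NormedAddCommGroup F] [NormedSpace ℝ F] {W : Submodule ℝ F} (L : E →L[ℝ] W) :
    ContDiff ℝ ∞ L :=
  L.contDiff

/-- The data of an operator `u ↦ u' + f (t, u)` from `W` to `B`: the continuous functions are
dense in `B`, the subspace `X` of `B` is the kernel of the average `mean`, and `W` consists of the
pairs `(u, u')` with `u' ∈ X` and `u = u 0 + prim u'`. -/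
structure OperatorSetting {B : Type} [NormedAddCommGroup B] [NormedSpace ℝ B]
    (X : Submodule ℝ B) (W : Submodule ℝ (C0 × B)) where
  incl : C0 →L[ℝ] B
  denseRange_incl : DenseRange incl
  mean : B →L[ℝ] ℝ
  mean_incl : ∀ v, mean (incl v) = meanC v
  prim : B →L[ℝ] C0
  prim_incl : ∀ v, prim (incl v) = primC v
  prim_apply_zero : ∀ v, prim v 0 = 0
  mem_kernel_iff : ∀ v, v ∈ X ↔ mean v = 0
  mem_domain_iff : ∀ p, p ∈ W ↔ mean p.2 = 0 ∧ p.1 = p.1 0 • 1 + prim p.2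

/-- The pairs `(u, u')` in `C¹(S¹)`, with values in `C⁰(S¹)`. -/
def settingC : OperatorSetting C0tilde C1 where
  incl := .id ℝ C0
  denseRange_incl := Function.surjective_id.denseRange
  mean := meanC
  mean_incl _ := rfl
  prim := primC
  prim_incl _ := rfl
  prim_apply_zero := primC_zero
  mem_kernel_iff v := by rw [meanC_apply]; rfl
  mem_domain_iff := mem_C1_iff

/-- The pairs `(u, u')` in `H¹(S¹)`, with values in `L²(S¹)`. -/
def settingH : OperatorSetting H0tilde H1 where
  incl := toH0L
  denseRange_incl := ContinuousMap.toLp_denseRange ℝ volume ℝ (by norm_num)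
  mean := meanH
  mean_incl _ := rfl
  prim := primH
  prim_incl _ := rfl
  prim_apply_zero := primH_zero
  mem_kernel_iff _ := Iff.rfl
  mem_domain_iff := mem_H1_iff

namespace OperatorSetting

variable {B : Type} [NormedAddCommGroup B] [NormedSpace ℝ B] {X : Submodule ℝ B}
  {W : Submodule ℝ (C0 × B)} (S : OperatorSetting X W)

include S in
lemma completeSpace_kernel [CompleteSpace B] : CompleteSpace X := by
  have hX : (X : Set B) = S.mean ⁻¹' {0} := ext S.mem_kernel_iff
  have hclosed : IsClosed (X : Set B) := hX ▸ isClosed_singleton.preimage S.mean.continuous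
  exact hclosed.completeSpace_coe

lemma mean_incl_one : S.mean (S.incl 1) = 1 := by rw [S.mean_incl, meanC_one]

lemma prim_incl_one : S.prim (S.incl 1) = 0 := by rw [S.prim_incl, primC_one]

lemma mean_coe (q : X) : S.mean q = 0 := (S.mem_kernel_iff _).1 q.2

/-- The projection of `B` onto the elements of average zero, along the constants. -/
def proj : B →L[ℝ] X :=
  (ContinuousLinearMap.id ℝ B - S.mean.smulRight (S.incl 1)).codRestrict X fun v => by
    simp [S.mem_kernel_iff, S.mean_incl_one]

lemma coe_proj (v : B) : (S.proj v : B) = v - S.mean v • S.incl 1 := rfl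

@[simp] lemma proj_coe (q : X) : S.proj q = q := by
  ext1
  rw [coe_proj, mean_coe, zero_smul, sub_zero]

lemma prim_proj (v : B) : S.prim (S.proj v) = S.prim v := by
  rw [coe_proj, map_sub, map_smul, prim_incl_one, smul_zero, sub_zero]

/-- The average of an element of `B`, together with its deviation from the average. -/
def meanProj : B ≃L[ℝ] ℝ × X :=
  ContinuousLinearEquiv.equivOfInverse (S.mean.prod S.proj)
    ((ContinuousLinearMap.fst ℝ ℝ X).smulRight (S.incl 1) + X.subtypeL.comp (.snd ℝ ℝ X))
    (fun v => by simp [coe_proj])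
    (fun a => Prod.ext (by simp [mean_incl_one, mean_coe])
      (Subtype.ext (by simp [coe_proj, mean_incl_one, mean_coe])))

lemma meanProj_apply (v : B) : S.meanProj v = (S.mean v, S.proj v) := rfl

/-- The pair `(u, u')` with `u 0 = x` and `u' = q`. -/
def ofDeriv : ℝ × X →L[ℝ] W :=
  ((familyDatum (S.prim.comp X.subtypeL)).prod (X.subtypeL.comp (.snd ℝ ℝ X))).codRestrict W
    fun a => by
      simp [S.mem_domain_iff, familyDatum_apply, S.prim_apply_zero, S.mean_coe, add_comm]

lemma ofDeriv_fst (a : ℝ × X) : (S.ofDeriv a).1.1 = S.prim a.2 + a.1 • 1 := rfl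

lemma ofDeriv_snd (a : ℝ × X) : (S.ofDeriv a).1.2 = a.2 := rfl

lemma ofDeriv_apply_zero_proj (u : W) : S.ofDeriv (u.1.1 0, S.proj u.1.2) = u := by
  obtain ⟨h0, h1⟩ := (S.mem_domain_iff _).1 u.2
  refine Subtype.ext (Prod.ext ?_ ?_)
  · rw [ofDeriv_fst, prim_proj, add_comm]
    exact h1.symm
  · rw [ofDeriv_snd, coe_proj, h0, zero_smul, sub_zero]

lemma C1Subalgebra_subset_range_familyDatum :
    (C1Subalgebra : Set C0) ⊆ range (familyDatum (S.prim.comp X.subtypeL)) := by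
  rintro V ⟨V', hV'⟩
  obtain ⟨h0, h1⟩ := eq_add_primC_of_hasDerivAt (y := V) (n := V') (k := 0) (by simpa using hV')
  refine ⟨(V 0, ⟨S.incl V', (S.mem_kernel_iff _).2 (by rw [S.mean_incl, h0])⟩), ?_⟩
  change S.prim (S.incl V') + V 0 • 1 = V
  rw [S.prim_incl, add_comm, ← h1]

lemma range_familyDatum_subset_closure :
    range (familyDatum (S.prim.comp X.subtypeL)) ⊆ closure (C1Subalgebra : Set C0) := by
  rintro _ ⟨⟨x, q⟩, rfl⟩
  have hcont : Continuous fun v => S.prim v + x • 1 := S.prim.continuous.add continuous_const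
  refine map_mem_closure (f := fun v => S.prim v + x • 1) hcont (S.denseRange_incl (q : B)) ?_
  rintro _ ⟨v, rfl⟩
  change S.prim (S.incl v) + x • 1 ∈ C1Subalgebra
  rw [S.prim_incl]
  exact add_mem (primC_mem_C1Subalgebra v) (C1Subalgebra.smul_mem (one_mem _) x)

section Operator

variable (f : C(UnitAddCircle × ℝ, ℝ))

/-- The operator `u ↦ u' + f (t, u)`. -/
def operator (u : W) : B := u.1.2 + S.incl (nemytskii f u.1.1)

lemma volterra_eq (u : W) : volterra f u.1.1 =
    familyDatum (S.prim.comp X.subtypeL) (u.1.1 0, S.proj (S.operator f u)) := by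
  have h1 := ((S.mem_domain_iff _).1 u.2).2
  change u.1.1 + primC (nemytskii f u.1.1) =
    S.prim (S.proj (u.1.2 + S.incl (nemytskii f u.1.1))) + u.1.1 0 • 1
  rw [prim_proj, map_add, S.prim_incl, add_right_comm, add_comm (S.prim _), ← h1]

variable {f} (hf : IsSmooth f) (hproper : IsProperMap f)

/-- The solution with `u 0 = x` of `u' + f (t, u) = q` modulo constants, in integral form. -/
def solution (a : ℝ × X) : C0 := familySolution hf hproper (S.prim.comp X.subtypeL) a

lemma solution_add (a : ℝ × X) :
    S.solution hf hproper a + primC (nemytskii f (S.solution hf hproper a)) =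
      S.prim a.2 + a.1 • 1 :=
  volterra_volterraEquiv_symm hf hproper _

/-- The pair `(u, u')` solving `u' + f (t, u) = q` modulo constants with `u 0 = x`. -/
def solutionPair (a : ℝ × X) : W :=
  S.ofDeriv (a.1, S.proj (a.2 - S.incl (nemytskii f (S.solution hf hproper a))))

lemma solutionPair_fst (a : ℝ × X) :
    (S.solutionPair hf hproper a).1.1 = S.solution hf hproper a := by
  rw [solutionPair, ofDeriv_fst, prim_proj, map_sub, S.prim_incl, sub_add_eq_add_sub,
    ← solution_add S hf hproper, add_sub_cancel_right]

lemma operator_solutionPair (a : ℝ × X) :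
    S.operator f (S.solutionPair hf hproper a) =
      a.2 + meanC (nemytskii f (S.solution hf hproper a)) • S.incl 1 := by
  rw [operator, solutionPair_fst, solutionPair, ofDeriv_snd, coe_proj, map_sub, mean_coe,
    S.mean_incl]
  module

/-- The initial value of `u` and the deviation of `u' + f (t, u)` from its average, as coordinates
of `u`. -/
def sourceEquiv : W ≃ ℝ × X where
  toFun u := (u.1.1 0, S.proj (S.operator f u))
  invFun := S.solutionPair hf hproper
  left_inv u := by
    have hu : S.solution hf hproper (u.1.1 0, S.proj (S.operator f u)) = u.1.1 := by
      rw [solution, familySolution, ← volterra_eq, volterraEquiv_symm_volterra]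
    rw [solutionPair, hu, map_sub, proj_coe, ← map_sub, operator, add_sub_cancel_right,
      ofDeriv_apply_zero_proj]
  right_inv a := by
    refine Prod.ext ?_ ?_
    · have h0 := DFunLike.congr_fun (S.solution_add hf hproper a) 0
      simpa [solutionPair_fst, primC_zero, S.prim_apply_zero] using h0
    · ext1
      simp [operator_solutionPair, coe_proj, mean_incl_one]

lemma contDiff_sourceEquiv : ContDiff ℝ ∞ (S.sourceEquiv hf hproper) := by
  have hfst : ContDiff ℝ ∞ fun u : W => u.1.1 := (contDiff_submodule_val W).fst
  have hsnd : ContDiff ℝ ∞ fun u : W => u.1.2 := (contDiff_submodule_val W).snd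
  have heval : ContDiff ℝ ∞ fun u : C0 => u 0 :=
    (ContinuousMap.evalCLM ℝ (0 : UnitAddCircle) : C0 →L[ℝ] ℝ).contDiff
  exact (heval.comp hfst).prodMk (S.proj.contDiff.comp
    (hsnd.add (S.incl.contDiff.comp ((contDiff_nemytskii hf).comp hfst))))

lemma contDiff_sourceEquiv_symm : ContDiff ℝ ∞ (S.sourceEquiv hf hproper).symm := by
  have hsolution : ContDiff ℝ ∞ (S.solution hf hproper) := contDiff_familySolution hf hproper _
  exact (contDiff_clm_submodule S.ofDeriv).comp (contDiff_fst.prodMk (S.proj.contDiff.comp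
    ((contDiff_submodule_val X).comp contDiff_snd |>.sub
      (S.incl.contDiff.comp ((contDiff_nemytskii hf).comp hsolution)))))

/-- In the coordinates `sourceEquiv` and `meanProj` the operator is a family of averages. -/
def familyCoordinates :
    FamilyCoordinates (S.operator f) (avgFamily hf hproper (S.prim.comp X.subtypeL)) where
  source := S.sourceEquiv hf hproper
  contDiff_source := S.contDiff_sourceEquiv hf hproper
  contDiff_source_symm := S.contDiff_sourceEquiv_symm hf hproper
  target := S.meanProj
  target_apply a := by
    change S.meanProj (S.operator f (S.solutionPair hf hproper a)) = _
    rw [operator_solutionPair, meanProj_apply]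
    refine Prod.ext ?_ (Subtype.ext ?_)
    · simp only [map_add, map_smul, mean_coe, mean_incl_one, smul_eq_mul, mul_one, zero_add]
      rfl
    · simp [coe_proj, mean_incl_one]

include hf hproper in
theorem isGlobalFold [CompleteSpace B] (hcrit : ∃ u, IsCriticalPoint (S.operator f) u)
    (hfold : ∀ u, IsCriticalPoint (S.operator f) u → IsFold (S.operator f) u) :
    IsGlobalFold X (S.operator f) :=
  have := S.completeSpace_kernel
  isGlobalFold_of_familyCoordinates hf hproper (S.familyCoordinates hf hproper)
    S.C1Subalgebra_subset_range_familyDatum S.range_familyDatum_subset_closure hcrit hfold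

end Operator

end OperatorSetting

end

end PeriodicFirstOrder

/-- Let `f : S¹ × ℝ → ℝ` be smooth and proper. In the `C` case (`F : C¹(S¹) → C⁰(S¹)`) and in the
`H` case (`F : H¹(S¹) → L²(S¹)`): if `0` is a regular value of `Σ₁`, `F` has a critical point and
every critical point of `F` is a fold, then `F` is a smooth global fold. -/
theorem theorem4p5 (f : C(UnitAddCircle × ℝ, ℝ)) (hf : IsSmooth f) (hproper : IsProperMap f) :
    (IsRegularValue (fun u : C1 => sigma1 f u.1.1) 0 →
      (∃ u : C1, IsCriticalPoint (operatorC f) u) →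
      (∀ u : C1, IsCriticalPoint (operatorC f) u → IsFold (operatorC f) u) →
      IsGlobalFold C0tilde (operatorC f)) ∧
    (IsRegularValue (fun u : H1 => sigma1 f u.1.1) 0 →
      (∃ u : H1, IsCriticalPoint (operatorH f) u) →
      (∀ u : H1, IsCriticalPoint (operatorH f) u → IsFold (operatorH f) u) →
      IsGlobalFold H0tilde (operatorH f)) := by
  refine ⟨fun _ hcrit hfold => ?_, fun _ hcrit hfold => ?_⟩
  · exact settingC.isGlobalFold hf hproper hcrit hfold
  · exact settingH.isGlobalFold hf hproper hcrit hfold
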